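/- Let $K$ be a field of characteristic zero and let $q\in K^\times$ not be a root of unity other than $1$. Let $m,n\ge 0$, and let $p_{ij},q_{ij}\in K^\times$ $(1\le i,j\le m+n)$ satisfy $p_{ii}=q_{ii}=1$, $p_{ji}=p_{ij}^{-1}$, $q_{ji}=q_{ij}^{-1}$, and $p_{ij}q_{ij}=q^{\varepsilon_{ij}}$ for $i\ne j$, where $\varepsilon_{ij}=\pm1$ and $(\varepsilon_{ik}-\varepsilon_{ij})(\varepsilon_{jk}-\varepsilon_{ik})=0$ for $i<j<k$. Put $\hat i=0$ for $i\le m$, $\hat i=1$ for $i>m$, and let $$R^{kl}_{ij}=\frac{q-p_{ij}q_{ij}}{1+p_{ij}q_{ij}}\,\delta^k_i\delta^l_j+(-1)^{\hat i\hat j}\frac{p_{ij}(q+1)}{1+p_{ij}q_{ij}}\,\delta^k_j\delta^l_i .$$ Let $R_e$ and $R_o$ be the submatrices of $R$ with all indices $\le m$, respectively all indices $>m$. A square matrix $Z=(z^j_i)$ of size $m+n$ (row $j$, column $i$) over an associative unital $K$-algebra $L$ is a *quantum super matrix* if for all $i,j,k,l$ $$\sum_{a,b}(-1)^{\hat b(\hat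 i+\hat a)}R^{kl}_{ab}\,z^a_iz^b_j=\sum_{a,b}(-1)^{\hat l(\hat a+\hat k)}z^k_az^l_b\,R^{ab}_{ij},$$ and a square matrix $X$ of size $m$ (respectively $n$) is a *quantum matrix* with respect to $R'=R_e$ (respectively $R'=R_o$) if $\sum_{a,b} R'^{kl}_{ab}x^a_ix^b_j=\sum_{a,b} x^k_ax^l_bR'^{ab}_{ij}$. Its quantum determinant is $$\det{}_qX=\sum_{\sigma\in\mathfrak S_m}\Big(\prod_{i<j,\ \sigma i>\sigma j}(-p_{\sigma i,\sigma j})\Big)x^{\sigma1}_1\cdots x^{\sigma m}_m,\qquad \det{}_qX=\sum_{\sigma\in\mathfrak S_n}\Big(\prod_{i<j,\ \sigma i>\sigma j}(-q_{m+\sigma i,m+\sigma j}^{-1})\Big)x^{\sigma1}_1\cdots x^{\sigma n}_n$$ for $R_e$ and $R_o$ respectively. Let $H$ be the $K$-algebra with generators $z^j_i,t^j_i$, the relations above for $(z^j_i)$, and $\sum_k(-1)^{\hat i(\hat k+1)}z^j_kt^k_i=\sum_k(-1)^{\hat k(\hat j+1)}t^j_kz^k_i=\delta^j_i$. Let $V$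 have basis $x_1,\dots,x_{m+n}$ and $V^*$ basis $\xi^1,\dots,\xi^{m+n}$ (parities $\hat i$), with $R(x_i\otimes x_j)=\sum x_k\otimes x_l\,R^{kl}_{ij}$ and $R^*(\xi^i\otimes\xi^j)=\sum\xi^k\otimes\xi^l\,R^{ji}_{lk}$. Let $\Lambda=T(V)/(\mathrm{Im}(R+1))$, $S^\vee=T(V^*)/(\mathrm{Im}(R^*-q))$, and let $\mathrm D:\Lambda_k\otimes S^\vee_l\to\Lambda_{k+1}\otimes S^\vee_{l+1}$, $\mathrm D(a\otimes b)=\sum_i a x_i\otimes\xi^i b$, be the Koszul differential. $H$ coacts (with the usual super sign rule) by $x_i\mapsto\sum_j x_j\otimes z^j_i$, $\xi^i\mapsto\sum_j\xi^j\otimes t^i_j$. The *quantum Berezinian* is the element $\mathrm{Ber}_q\in H$ such that the induced coaction on the cohomology group at the term $\Lambda_m\otimes S^\vee_n$ is $c\mapsto c\otimes\mathrm{Ber}_q$. If $Z$ is a quantum super matrix over $L$ that is invertible (as a matrix over $L$), then $\mathrm{Ber}_qZ\in L$ denotes the image of $\mathrm{Ber}_q$ under the algebra homomorphism $H\to L$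 that sends the matrix of generators $(z^j_i)$ to $Z$ and its inverse $((-1)^{\hat i(\hat j+1)}t^j_i)$ to $Z^{-1}$. **Theorem.** The element $\mathrm{Ber}_q\in H$ exists and is unique. Let $Z=\begin{pmatrix}A&B\\ C&D\end{pmatrix}$ be a quantum super matrix over $L$, with $A$ of size $m\times m$ and $D$ of size $n\times n$. Then $A$ and $D$ are quantum matrices (with respect to $R_e$ and $R_o$). If $Z$ is invertible, then $A$ and $D$ are invertible, the matrices $A-BD^{-1}C$ and $D-CA^{-1}B$ are invertible, and they are quantum matrices (with respect to $R_e$ and $R_o$); moreover $\det_qD$ and $\det_q(D-CA^{-1}B)$ are invertible in $L$, and $$\mathrm{Ber}_qZ=\det{}_qA\cdot\big(\det{}_q(D-CA^{-1}B)\big)^{-1}=\big(\det{}_qD\big)^{-1}\cdot\det{}_q(A-BD^{-1}C).$$ -/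

import Mathlib

open scoped TensorProduct

noncomputable section

namespace QSuper

/-! ### Parameters and the multiparameter `R`-matrix -/

/-- The parities of a homogeneous basis `x_1, …, x_{m+n}` in standard format: the first `m` basis
vectors are even (`0`), the last `n` are odd (`1`). -/
def parity (m n : ℕ) (i : Fin (m + n)) : ℕ := if i.val < m then 0 else 1

/-- The standing assumptions on the parameters `q`, `p_{ij}`, `q_{ij}` (the latter written `r i j`).
-/
structure IsParameterSystem {K : Type*} [Field K] {d : ℕ} (q : K) (p r : Fin d → Fin d → K) :
    Prop where
  q_ne_zero : q ≠ 0
  /-- `q` is not a root of unity other than `1` -/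
  q_root : ∀ k : ℕ, 0 < k → q ^ k = 1 → q = 1
  p_ne_zero : ∀ i j, p i j ≠ 0
  r_ne_zero : ∀ i j, r i j ≠ 0
  p_diag : ∀ i, p i i = 1
  r_diag : ∀ i, r i i = 1
  p_symm : ∀ i j, p j i = (p i j)⁻¹
  r_symm : ∀ i j, r j i = (r i j)⁻¹
  epsilon : ∃ ε : Fin d → Fin d → ℤ,
    (∀ i j, i ≠ j → (ε i j = 1 ∨ ε i j = -1) ∧ p i j * r i j = q ^ ε i j) ∧
    ∀ i j k, i < j → j < k → (ε i k - ε i j) * (ε j k - ε i k) = 0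

/-- The matrix `R^{kl}_{ij}` of the operator `R`, `R (x_i ⊗ x_j) = ∑ x_k ⊗ x_l R^{kl}_{ij}`.
The arguments are `k l i j`, in this order. -/
def rMatrix {K : Type*} [Field K] {d : ℕ} (par : Fin d → ℕ) (q : K) (p r : Fin d → Fin d → K)
    (k l i j : Fin d) : K :=
  (q - p i j * r i j) / (1 + p i j * r i j) * (if k = i ∧ l = j then 1 else 0) +
  (-1) ^ (par i * par j) * (p i j * (q + 1) / (1 + p i j * r i j)) *
    (if k = j ∧ l = i then 1 else 0)

/-! ### Quantum (super) matrices and the quantum determinant -/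

section Matrices

variable {K : Type*} [Field K] {d : ℕ} {L : Type*} [Ring L] [Algebra K L]

/-- Quantum super matrices with entries in a `K`-algebra `L`; `Z j i` (row `j`, column `i`) is the
entry `z^j_i`. The relations are
`(-1)^{s(i+p)} R^{kl}_{ps} z^p_i z^s_j = (-1)^{l(q+k)} z^k_q z^l_n R^{qn}_{ij}`. -/
def IsQuantumSuperMatrix (par : Fin d → ℕ) (R : Fin d → Fin d → Fin d → Fin d → K)
    (Z : Matrix (Fin d) (Fin d) L) : Prop :=
  ∀ k l i j : Fin d,
    (∑ p, ∑ s, ((-1 : K) ^ (par s * (par i + par p)) * R k l p s) • (Z p i * Z s j)) =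
    ∑ q, ∑ n, ((-1 : K) ^ (par l * (par q + par k)) * R q n i j) • (Z k q * Z l n)

/-- Quantum matrices with respect to `R`: the same relations with all signs trivial,
that is `R Z₁ Z₂ = Z₁ Z₂ R`. -/
def IsQuantumMatrix (R : Fin d → Fin d → Fin d → Fin d → K) (Z : Matrix (Fin d) (Fin d) L) :
    Prop :=
  IsQuantumSuperMatrix (fun _ => 0) R Z

/-- `∑_σ σ(c) z_1^{σ1} ⋯ z_d^{σd}`, where `σ(c)` is the product of `c_{σi,σj}` over the
inversions `i < j`, `σi > σj`. -/
def qdet (c : Fin d → Fin d → K) (Z : Matrix (Fin d) (Fin d) L) : L :=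
  ∑ σ : Equiv.Perm (Fin d),
    (∏ i, ∏ j, if i < j ∧ σ j < σ i then c (σ i) (σ j) else 1) •
      (List.ofFn fun i => Z (σ i) i).prod

end Matrices

section Blocks

variable {m n : ℕ} {L : Type*}

/-- The even-even block of `Z = (A B; C D)`. -/
def blockA (Z : Matrix (Fin (m + n)) (Fin (m + n)) L) : Matrix (Fin m) (Fin m) L :=
  Z.submatrix (Fin.castAdd n) (Fin.castAdd n)

/-- The even-odd block. -/
def blockB (Z : Matrix (Fin (m + n)) (Fin (m + n)) L) : Matrix (Fin m) (Fin n) L :=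
  Z.submatrix (Fin.castAdd n) (Fin.natAdd m)

/-- The odd-even block. -/
def blockC (Z : Matrix (Fin (m + n)) (Fin (m + n)) L) : Matrix (Fin n) (Fin m) L :=
  Z.submatrix (Fin.natAdd m) (Fin.castAdd n)

/-- The odd-odd block. -/
def blockD (Z : Matrix (Fin (m + n)) (Fin (m + n)) L) : Matrix (Fin n) (Fin n) L :=
  Z.submatrix (Fin.natAdd m) (Fin.natAdd m)

variable {K : Type*} [Field K] [Ring L] [Algebra K L]

/-- The submatrix of `R` with all indices even. -/
def rEven (R : Fin (m + n) → Fin (m + n) → Fin (m + n) → Fin (m + n) → K) (k l i j : Fin m) : K :=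
  R (Fin.castAdd n k) (Fin.castAdd n l) (Fin.castAdd n i) (Fin.castAdd n j)

/-- The submatrix of `R` with all indices odd. -/
def rOdd (R : Fin (m + n) → Fin (m + n) → Fin (m + n) → Fin (m + n) → K) (k l i j : Fin n) : K :=
  R (Fin.natAdd m k) (Fin.natAdd m l) (Fin.natAdd m i) (Fin.natAdd m j)

/-- The quantum determinant of a quantum matrix of the even-even format: the coefficient of the
coaction on `x_1 ⋯ x_m`, where `x_i x_j = -p_{ij} x_j x_i`. -/
def detEven (p : Fin (m + n) → Fin (m + n) → K) (A : Matrix (Fin m) (Fin m) L) : L :=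
  qdet (fun i j => -p (Fin.castAdd n i) (Fin.castAdd n j)) A

/-- The quantum determinant of a quantum matrix of the odd-odd format: the coefficient of the
coaction on `x_{m+1} ⋯ x_{m+n}`, where `x_i x_j = -q_{ij}⁻¹ x_j x_i`. -/
def detOdd (r : Fin (m + n) → Fin (m + n) → K) (D : Matrix (Fin n) (Fin n) L) : L :=
  qdet (fun i j => -(r (Fin.natAdd m i) (Fin.natAdd m j))⁻¹) D

end Blocks

/-! ### The function algebra `H` of the quantum general linear super group -/

section HopfEnvelope

variable {K : Type*} [Field K] {d : ℕ}

/-- Free generators `z^j_i` (`Sum.inl (j, i)`) and `t^j_i` (`Sum.inr (j, i)`). -/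
abbrev Gen (d : ℕ) : Type := (Fin d × Fin d) ⊕ (Fin d × Fin d)

def freeZ (K : Type*) [Field K] {d : ℕ} (j i : Fin d) : FreeAlgebra K (Gen d) :=
  FreeAlgebra.ι K (Sum.inl (j, i))

def freeT (K : Type*) [Field K] {d : ℕ} (j i : Fin d) : FreeAlgebra K (Gen d) :=
  FreeAlgebra.ι K (Sum.inr (j, i))

/-- The defining relations of `H`. -/
inductive HopfRel (par : Fin d → ℕ) (R : Fin d → Fin d → Fin d → Fin d → K) :
    FreeAlgebra K (Gen d) → FreeAlgebra K (Gen d) → Prop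
  | zz (k l i j : Fin d) : HopfRel par R
      (∑ p, ∑ s, ((-1 : K) ^ (par s * (par i + par p)) * R k l p s) •
        (freeZ K p i * freeZ K s j))
      (∑ q, ∑ n, ((-1 : K) ^ (par l * (par q + par k)) * R q n i j) •
        (freeZ K k q * freeZ K l n))
  | zt (i j : Fin d) : HopfRel par R
      (∑ k, (-1 : K) ^ (par i * (par k + 1)) • (freeZ K j k * freeT K k i))
      (if i = j then 1 else 0)
  | tz (i j : Fin d) : HopfRel par R
      (∑ k, (-1 : K) ^ (par k * (par j + 1)) • (freeT K j k * freeZ K k i))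
      (if i = j then 1 else 0)

/-- The algebra `H`, the Hopf envelope of the quantum super matrix bialgebra. -/
def HopfEnvelope (par : Fin d → ℕ) (R : Fin d → Fin d → Fin d → Fin d → K) : Type _ :=
  RingQuot (HopfRel par R)

instance (par : Fin d → ℕ) (R : Fin d → Fin d → Fin d → Fin d → K) :
    Ring (HopfEnvelope par R) :=
  inferInstanceAs (Ring (RingQuot (HopfRel par R)))

instance (par : Fin d → ℕ) (R : Fin d → Fin d → Fin d → Fin d → K) :
    Algebra K (HopfEnvelope par R) :=
  inferInstanceAs (Algebra K (RingQuot (HopfRel par R)))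

/-- The generator `z^j_i` of `H`. -/
def hz (par : Fin d → ℕ) (R : Fin d → Fin d → Fin d → Fin d → K) (j i : Fin d) :
    HopfEnvelope par R :=
  RingQuot.mkAlgHom K (HopfRel par R) (freeZ K j i)

/-- The generator `t^j_i` of `H`. -/
def ht (par : Fin d → ℕ) (R : Fin d → Fin d → Fin d → Fin d → K) (j i : Fin d) :
    HopfEnvelope par R :=
  RingQuot.mkAlgHom K (HopfRel par R) (freeT K j i)

variable {L : Type*} [Ring L] [Algebra K L]

/-- On the free algebra: `z^j_i ↦ Z^j_i`, `t^j_i ↦ (-1)^{i(j+1)} T^j_i`. -/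
def freeEval (par : Fin d → ℕ) (Z T : Matrix (Fin d) (Fin d) L) : FreeAlgebra K (Gen d) →ₐ[K] L :=
  FreeAlgebra.lift K (Sum.elim (fun x => Z x.1 x.2)
    (fun x => (-1 : K) ^ (par x.2 * (par x.1 + 1)) • T x.1 x.2))

theorem freeEval_rel {par : Fin d → ℕ} {R : Fin d → Fin d → Fin d → Fin d → K}
    {Z T : Matrix (Fin d) (Fin d) L} (hZ : IsQuantumSuperMatrix par R Z)
    (hZT : Z * T = 1) (hTZ : T * Z = 1) ⦃x y : FreeAlgebra K (Gen d)⦄ (h : HopfRel par R x y) :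
    freeEval par Z T x = freeEval par Z T y := by
  have hs : ∀ a : ℕ, (-1 : K) ^ a * (-1) ^ a = 1 := fun a => by
    rw [← mul_pow]; simp
  cases h with
  | zz k l i j => simpa [freeEval, freeZ] using hZ k l i j
  | zt i j =>
    have := congrFun (congrFun hZT j) i
    rw [Matrix.mul_apply, Matrix.one_apply] at this
    simp only [eq_comm (a := j)] at this
    simpa [freeEval, freeZ, freeT, smul_smul, hs, apply_ite] using this
  | tz i j =>
    have := congrFun (congrFun hTZ j) i
    rw [Matrix.mul_apply, Matrix.one_apply] at this
    simp only [eq_comm (a := j)] at this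
    simpa [freeEval, freeZ, freeT, smul_smul, hs, apply_ite] using this

/-- An invertible quantum super matrix `Z` over `L` is an `L`-point of the quantum super group: the
algebra homomorphism `H → L` that sends the generic matrix to `Z` (and hence its inverse
`(-1)^{i(j+1)} t^j_i` to `Z⁻¹`). -/
def evalAt {par : Fin d → ℕ} {R : Fin d → Fin d → Fin d → Fin d → K}
    {Z : Matrix (Fin d) (Fin d) L} (hZ : IsQuantumSuperMatrix par R Z) (hU : IsUnit Z) :
    HopfEnvelope par R →ₐ[K] L :=
  RingQuot.liftAlgHom K
    ⟨freeEval par Z ((hU.unit⁻¹ : (Matrix (Fin d) (Fin d) L)ˣ) : Matrix (Fin d) (Fin d) L),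
      freeEval_rel hZ (IsUnit.mul_val_inv hU) (IsUnit.val_inv_mul hU)⟩

end HopfEnvelope

/-! ### The Koszul complex and the quantum Berezinian -/

section Koszul

variable {K : Type*} [Field K] {d : ℕ}

/-- The relations `R = -1` on `V ⊗ V`. -/
inductive LambdaRel (R : Fin d → Fin d → Fin d → Fin d → K) :
    FreeAlgebra K (Fin d) → FreeAlgebra K (Fin d) → Prop
  | mk (i j : Fin d) : LambdaRel R
      (∑ k, ∑ l, R k l i j • (FreeAlgebra.ι K k * FreeAlgebra.ι K l))
      (-(FreeAlgebra.ι K i * FreeAlgebra.ι K j))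

/-- The relations `R^* = q` on `V^* ⊗ V^*`, where `R^* (ξ^i ⊗ ξ^j) = ∑ ξ^k ⊗ ξ^l R^{ji}_{lk}`. -/
inductive SDualRel (q : K) (R : Fin d → Fin d → Fin d → Fin d → K) :
    FreeAlgebra K (Fin d) → FreeAlgebra K (Fin d) → Prop
  | mk (i j : Fin d) : SDualRel q R
      (∑ k, ∑ l, R j i l k • (FreeAlgebra.ι K k * FreeAlgebra.ι K l))
      (q • (FreeAlgebra.ι K i * FreeAlgebra.ι K j))

/-- The quantum exterior algebra `Λ = T(V) / (Im (R + 1))`. -/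
def Lambda (R : Fin d → Fin d → Fin d → Fin d → K) : Type _ := RingQuot (LambdaRel R)

instance (R : Fin d → Fin d → Fin d → Fin d → K) : Ring (Lambda R) :=
  inferInstanceAs (Ring (RingQuot (LambdaRel R)))

instance (R : Fin d → Fin d → Fin d → Fin d → K) : Algebra K (Lambda R) :=
  inferInstanceAs (Algebra K (RingQuot (LambdaRel R)))

/-- The dual quantum symmetric algebra `S^∨ = T(V^*) / (Im (R^* - q))`. -/
def SDual (q : K) (R : Fin d → Fin d → Fin d → Fin d → K) : Type _ := RingQuot (SDualRel q R)

instance (q : K) (R : Fin d → Fin d → Fin d → Fin d → K) : Ring (SDual q R) :=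
  inferInstanceAs (Ring (RingQuot (SDualRel q R)))

instance (q : K) (R : Fin d → Fin d → Fin d → Fin d → K) : Algebra K (SDual q R) :=
  inferInstanceAs (Algebra K (RingQuot (SDualRel q R)))

/-- The generator `x_i` of `Λ`. -/
def lx (R : Fin d → Fin d → Fin d → Fin d → K) (i : Fin d) : Lambda R :=
  RingQuot.mkAlgHom K (LambdaRel R) (FreeAlgebra.ι K i)

/-- The generator `ξ^i` of `S^∨`. -/
def sxi (q : K) (R : Fin d → Fin d → Fin d → Fin d → K) (i : Fin d) : SDual q R :=
  RingQuot.mkAlgHom K (SDualRel q R) (FreeAlgebra.ι K i)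

/-- The total space `Λ ⊗ S^∨ = ⨁ Λ_k ⊗ S^∨_l` of the Koszul complexes. -/
abbrev Koszul (q : K) (R : Fin d → Fin d → Fin d → Fin d → K) : Type _ := Lambda R ⊗[K] SDual q R

/-- The Koszul differential `a ⊗ b ↦ ∑ i, a x_i ⊗ ξ^i b`, of bidegree `(1, 1)`. -/
def koszulD (q : K) (R : Fin d → Fin d → Fin d → Fin d → K) : Koszul q R →ₗ[K] Koszul q R :=
  ∑ i, TensorProduct.map (LinearMap.mulRight K (lx R i)) (LinearMap.mulLeft K (sxi q R i))

/-- Pairs of words; they index the basis `x_{a_1} ⊗ ⋯ ⊗ x_{a_k} ⊗ ξ^{b_1} ⊗ ⋯ ⊗ ξ^{b_l}` of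
`V^{⊗ k} ⊗ V^{* ⊗ l}`. -/
abbrev Word (d k l : ℕ) : Type := (Fin k → Fin d) × (Fin l → Fin d)

/-- The element `x_{a_1} ⋯ x_{a_k} ⊗ ξ^{b_1} ⋯ ξ^{b_l}` of `Λ_k ⊗ S^∨_l`. -/
def monomial (q : K) (R : Fin d → Fin d → Fin d → Fin d → K) {k l : ℕ} (w : Word d k l) :
    Koszul q R :=
  (List.ofFn fun u => lx R (w.1 u)).prod ⊗ₜ[K] (List.ofFn fun v => sxi q R (w.2 v)).prod

/-- The canonical projection `V^{⊗ k} ⊗ V^{* ⊗ l} → Λ_k ⊗ S^∨_l`. -/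
def koszulProj (q : K) (R : Fin d → Fin d → Fin d → Fin d → K) (k l : ℕ) :
    (Word d k l →₀ K) →ₗ[K] Koszul q R :=
  Finsupp.linearCombination K (monomial q R)

/-- The exponent of the sign that collects the coefficients of
`(x_{c_1} ⊗ z^{c_1}_{a_1}) ⋯ (x_{c_k} ⊗ z^{c_k}_{a_k})
 (ξ^{e_1} ⊗ t^{b_1}_{e_1}) ⋯ (ξ^{e_l} ⊗ t^{b_l}_{e_l})` on the right, by the rule of signs
`(v ⊗ f) (w ⊗ g) = (-1)^{|f| |w|} v w ⊗ f g`; here `w = (a, b)` and `w' = (c, e)`. -/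
def signExponent (par : Fin d → ℕ) {k l : ℕ} (w' w : Word d k l) : ℕ :=
  (∑ u, ∑ u', if u < u' then (par (w.1 u) + par (w'.1 u)) * par (w'.1 u') else 0) +
  (∑ u, ∑ v, (par (w.1 u) + par (w'.1 u)) * par (w'.2 v)) +
  (∑ v, ∑ v', if v < v' then (par (w.2 v) + par (w'.2 v)) * par (w'.2 v') else 0)

/-- The matrix coefficients in `H` of the super comodule `V^{⊗ k} ⊗ V^{* ⊗ l}`, where `H` coacts by
`x_i ↦ ∑ x_j ⊗ z^j_i` and `ξ^i ↦ ∑ ξ^j ⊗ t^i_j`. -/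
def coactionCoeff (par : Fin d → ℕ) (R : Fin d → Fin d → Fin d → Fin d → K) {k l : ℕ}
    (w' w : Word d k l) : HopfEnvelope par R :=
  (-1 : K) ^ signExponent par w' w •
    ((List.ofFn fun u => hz par R (w'.1 u) (w.1 u)).prod *
      (List.ofFn fun v => ht par R (w.2 v) (w'.2 v)).prod)

/-- The coaction of `H` on `V^{⊗ k} ⊗ V^{* ⊗ l}`, followed by the projection to
`Λ_k ⊗ S^∨_l ⊗ H`. -/
def koszulCoaction (par : Fin d → ℕ) (q : K) (R : Fin d → Fin d → Fin d → Fin d → K) (k l : ℕ) :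
    (Word d k l →₀ K) →ₗ[K] (Koszul q R ⊗[K] HopfEnvelope par R) :=
  Finsupp.linearCombination K fun w =>
    ∑ w' : Word d k l, monomial q R w' ⊗ₜ[K] coactionCoeff par R w' w

/-- `b ∈ H` is the quantum Berezinian of format `m|n`: `H` coacts on the cohomology group of the
Koszul complex at the term `Λ_m ⊗ S^∨_n` by `c ↦ c ⊗ b`. Classes are given by cocycles
(represented by elements `u` of `V^{⊗ m} ⊗ V^{* ⊗ n}`), and equality of classes with coefficients
in `H` is congruence modulo the image of the differential. -/
def IsBerezinian (m n : ℕ) (par : Fin d → ℕ) (q : K) (R : Fin d → Fin d → Fin d → Fin d → K)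
    (b : HopfEnvelope par R) : Prop :=
  ∀ u : Word d m n →₀ K, koszulD q R (koszulProj q R m n u) = 0 →
    koszulCoaction par q R m n u - koszulProj q R m n u ⊗ₜ[K] b ∈
      LinearMap.range ((koszulD q R).rTensor (HopfEnvelope par R))

end Koszul

end QSuper

end

/-! The algebras `Λ` and `S^∨` are of quantum affine type: their relations say that distinct
generators commute up to scalars and that the squares of the even `x_i`, respectively of the odd
`ξ^i`, vanish. Ordered monomials therefore form a basis; independence is seen by letting the algebra
act on a space with the exponents as basis (`isQAffine_ly`, `model_omon`). In this basis the Koszul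
differential is a sum of anticommuting maps along the edges `(a, b) → (a + e_i, b + e_i)`, so it
preserves `a - b`. Unless `a - b` is the difference belonging to `x_1 ⋯ x_m ⊗ ξ^{m+1} ⋯ ξ^{m+n}`,
there is a direction whose edges pair off all basis elements with that difference, and inverting
these edges is a contracting homotopy (`diffl_htpy_add_htpy_diffl`). Thus the cohomology is spanned
by one class, with any coefficients.

The coaction commutes with the differential (`koszulG_diffl'`) because `∑ x_i ⊗ ξ^i` is invariant.
So it multiplies the class by the coefficient of the generator, which is computed to be `α β`, where
`α` is the determinant of `A` and `β` a determinant of the transposed odd block of `Z⁻¹`. This is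
existence and uniqueness of the Berezinian (`isBerezinian_iff`).

When `Z` is an ordinary quantum matrix, the coaction has an inverse, built from products in the
reversed order; it acts on the class by `γ τ`, with `γ` from the block `D` and `τ` from the even
block of `Z⁻¹`. Its construction needs an inverse of the transpose of `Z⁻¹`, which comes from the
crossing relations between `Z` and `Z⁻¹` (`exists_inverse_transpose`); the same relations make `α`
commute with `β`, and `γ` with `τ`. Hence all four are units. Super matrices are reduced to this
case by absorbing the signs into anticommuting matrices of size two (`qdet_relations`).

It remains to understand determinants of ordinary quantum matrices. The coaction on the top degree
of a quantum exterior algebra evaluates the determinant of any word of columns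
(`IsQuantumMatrix.sum_word`); Laplace expansion then inverts a matrix with invertible determinants.
Row and column determinants agree after multiplication by a `q`-factorial times a nonzero scalar,
and the `q`-factorial is nonzero by the assumption on `q` (`sum_extCoef_mul_ne_zero`). So `γ` is the
determinant of `D`, and `A`, `D` are invertible. The Schur complements are the inverses of the
diagonal blocks of `Z⁻¹`, so they are quantum matrices with determinants `τ⁻¹` and `β⁻¹`. The two
formulas for the Berezinian are the two sides of `α β = (γ τ)⁻¹`. -/

noncomputable section

namespace QSuper

/-! ### Matrices intertwining a four-index tensor -/

section Intertwining

variable {K : Type*} [Field K] {d : ℕ} {L : Type*} [Ring L] [Algebra K L]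

/-- The tensor `Q` with entries in `L` commutes with the scalar tensor `P`, both being seen as
matrices indexed by pairs. -/
def Intertwines (P : Fin d → Fin d → Fin d → Fin d → K)
    (Q : Fin d → Fin d → Fin d → Fin d → L) : Prop :=
  ∀ k l i j : Fin d, ∑ a, ∑ b, P k l a b • Q a b i j = ∑ a, ∑ b, P a b i j • Q k l a b

/-- The super product `Z₁ Z₂` as a tensor. -/
def superSquare (K : Type*) [Field K] [Algebra K L] (par : Fin d → ℕ)
    (Z : Matrix (Fin d) (Fin d) L) (k l i j : Fin d) : L :=
  (-1 : K) ^ (par l * (par i + par k)) • (Z k i * Z l j)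

/-- The inverse of the super product `Z₁ Z₂`, in terms of the inverse `T` of `Z`. -/
def superSquareInv (K : Type*) [Field K] [Algebra K L] (par : Fin d → ℕ)
    (T : Matrix (Fin d) (Fin d) L) (k l i j : Fin d) : L :=
  (-1 : K) ^ (par j * (par k + par i)) • (T l j * T k i)

theorem isQuantumSuperMatrix_iff {par : Fin d → ℕ} {P : Fin d → Fin d → Fin d → Fin d → K}
    {Z : Matrix (Fin d) (Fin d) L} :
    IsQuantumSuperMatrix par P Z ↔ Intertwines P (superSquare K par Z) := by
  simp only [IsQuantumSuperMatrix, Intertwines, superSquare, smul_smul, mul_comm]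

/-- A scalar tensor as a matrix over `L`. -/
def scalarMatrix (L : Type*) [Ring L] [Algebra K L] (P : Fin d → Fin d → Fin d → Fin d → K) :
    Matrix (Fin d × Fin d) (Fin d × Fin d) L :=
  Matrix.of fun x y => algebraMap K L (P x.1 x.2 y.1 y.2)

/-- A tensor as a matrix indexed by pairs. -/
def pairMatrix (Q : Fin d → Fin d → Fin d → Fin d → L) :
    Matrix (Fin d × Fin d) (Fin d × Fin d) L :=
  Matrix.of fun x y => Q x.1 x.2 y.1 y.2

/-- Scalars are central in `L`, so the coefficients may be written on either side of the entries. In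
this form inverses can be handled as inverses of units in a matrix ring. -/
theorem intertwines_iff_commute {P : Fin d → Fin d → Fin d → Fin d → K}
    {Q : Fin d → Fin d → Fin d → Fin d → L} :
    Intertwines P Q ↔ Commute (scalarMatrix L P) (pairMatrix Q) := by
  constructor
  · intro h
    ext ⟨k, l⟩ ⟨i, j⟩
    have := h k l i j
    simp only [Matrix.mul_apply, Fintype.sum_prod_type, scalarMatrix, pairMatrix, Matrix.of_apply]
    simpa only [Algebra.smul_def, ← Algebra.commutes] using this
  · intro h k l i j
    have := congrFun (congrFun h (k, l)) (i, j)
    simp only [Matrix.mul_apply, Fintype.sum_prod_type, scalarMatrix, pairMatrix,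
      Matrix.of_apply] at this
    simpa only [Algebra.smul_def, ← Algebra.commutes] using this

theorem Intertwines.inverse {P : Fin d → Fin d → Fin d → Fin d → K}
    {Q Q' : Fin d → Fin d → Fin d → Fin d → L} (h : Intertwines P Q)
    (h₁ : pairMatrix Q * pairMatrix Q' = 1) (h₂ : pairMatrix Q' * pairMatrix Q = 1) :
    Intertwines P Q' := by
  rw [intertwines_iff_commute] at h ⊢
  exact (Commute.units_inv_right (u := ⟨pairMatrix Q, pairMatrix Q', h₁, h₂⟩) h)

/-- All sign identities below are checked by pushing the exponent into `ZMod 2` and deciding over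
the finitely many parities. -/
theorem neg_one_pow_congr_zmod {a b : ℕ} (h : (a : ZMod 2) = b) : (-1 : K) ^ a = (-1) ^ b := by
  rw [ZMod.natCast_eq_natCast_iff] at h
  rw [neg_one_pow_eq_pow_mod_two, neg_one_pow_eq_pow_mod_two (n := b), h]

/-- The inverse of `Z₁ Z₂` is `Z₂⁻¹ Z₁⁻¹`; as entries do not commute, the factors of
`superSquareInv` stand in the opposite order. Summing over the inner index first collapses the
product. -/
theorem superSquare_mul_inv (par : Fin d → ℕ) {Z T : Matrix (Fin d) (Fin d) L} (h : Z * T = 1) :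
    pairMatrix (superSquare K par Z) * pairMatrix (superSquareInv K par T) = 1 := by
  ext ⟨k, l⟩ ⟨i, j⟩
  have h' : ∀ i j, ∑ a, Z i a * T a j = if i = j then 1 else 0 := fun i j => by
    rw [← Matrix.mul_apply, h, Matrix.one_apply]
  simp only [Matrix.mul_apply, Fintype.sum_prod_type, pairMatrix, Matrix.of_apply, superSquare,
    superSquareInv]
  have : ∀ a b, ((-1 : K) ^ (par l * (par a + par k)) • (Z k a * Z l b)) *
      ((-1 : K) ^ (par j * (par a + par i)) • (T b j * T a i)) =
      (-1 : K) ^ (par l * (par a + par k) + par j * (par a + par i)) •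
        (Z k a * (Z l b * T b j) * T a i) := fun a b => by
    rw [smul_mul_smul_comm, ← pow_add]; simp only [mul_assoc]
  simp only [this, ← Finset.smul_sum, ← Finset.mul_sum, ← Finset.sum_mul, h']
  by_cases hlj : l = j
  · subst hlj
    have hs : ∀ a, (-1 : K) ^ (par l * (par a + par k) + par l * (par a + par i)) =
        (-1) ^ (par l * (par k + par i)) := fun a => by
      apply neg_one_pow_congr_zmod
      push_cast
      generalize (par a : ZMod 2) = x
      generalize (par l : ZMod 2) = y
      generalize (par k : ZMod 2) = z
      generalize (par i : ZMod 2) = w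
      revert x y z w
      decide
    simp only [hs, if_true, mul_one, ← Finset.smul_sum, h', Matrix.one_apply, Prod.mk.injEq,
      and_true]
    split_ifs with hki
    · subst hki
      rw [neg_one_pow_congr_zmod (b := 0), pow_zero, one_smul]
      push_cast
      generalize (par l : ZMod 2) = y
      generalize (par k : ZMod 2) = z
      revert y z
      decide
    · simp
  · simp [hlj]

theorem superSquareInv_mul (par : Fin d → ℕ) {Z T : Matrix (Fin d) (Fin d) L} (h : T * Z = 1) :
    pairMatrix (superSquareInv K par T) * pairMatrix (superSquare K par Z) = 1 := by
  ext ⟨k, l⟩ ⟨i, j⟩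
  have h' : ∀ i j, ∑ a, T i a * Z a j = if i = j then 1 else 0 := fun i j => by
    rw [← Matrix.mul_apply, h, Matrix.one_apply]
  simp only [Matrix.mul_apply, Fintype.sum_prod_type, pairMatrix, Matrix.of_apply, superSquare,
    superSquareInv]
  rw [Finset.sum_comm]
  have : ∀ a b, ((-1 : K) ^ (par b * (par k + par a)) • (T l b * T k a)) *
      ((-1 : K) ^ (par b * (par i + par a)) • (Z a i * Z b j)) =
      (-1 : K) ^ (par b * (par k + par i)) • (T l b * (T k a * Z a i) * Z b j) := fun a b => by
    rw [smul_mul_smul_comm, ← pow_add]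
    simp only [mul_assoc]
    congr 1
    apply neg_one_pow_congr_zmod
    push_cast
    generalize (par a : ZMod 2) = x
    generalize (par b : ZMod 2) = y
    generalize (par k : ZMod 2) = z
    generalize (par i : ZMod 2) = w
    revert x y z w
    decide
  simp only [this, ← Finset.smul_sum, ← Finset.mul_sum, ← Finset.sum_mul, h']
  by_cases hki : k = i
  · subst hki
    have hs : ∀ b, (-1 : K) ^ (par b * (par k + par k)) = 1 := fun b => by
      rw [neg_one_pow_congr_zmod (b := 0), pow_zero]
      push_cast
      generalize (par b : ZMod 2) = y
      generalize (par k : ZMod 2) = z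
      revert y z
      decide
    simp only [hs, if_true, mul_one, one_smul, h', Matrix.one_apply, Prod.mk.injEq, true_and]
  · simp [hki]

theorem Intertwines.superSquareInv {par : Fin d → ℕ} {P : Fin d → Fin d → Fin d → Fin d → K}
    {Z T : Matrix (Fin d) (Fin d) L} (h : Intertwines P (superSquare K par Z))
    (hZT : Z * T = 1) (hTZ : T * Z = 1) : Intertwines P (superSquareInv K par T) :=
  h.inverse (superSquare_mul_inv par hZT) (superSquareInv_mul par hTZ)

/-- The tensor of the operator on `V^* ⊗ V^*` dual to `P`. -/
def dualTensor (P : Fin d → Fin d → Fin d → Fin d → K) (k l i j : Fin d) : K := P j i l k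

/-- The tensor maps `x_i ⊗ x_j` into the span of `x_i ⊗ x_j` and `x_j ⊗ x_i`. -/
def PreservesPairs (P : Fin d → Fin d → Fin d → Fin d → K) : Prop :=
  ∀ k l i j, P k l i j ≠ 0 → (k = i ∧ l = j) ∨ (k = j ∧ l = i)

theorem PreservesPairs.dualTensor {P : Fin d → Fin d → Fin d → Fin d → K} (h : PreservesPairs P) :
    PreservesPairs (dualTensor P) := fun k l i j hne => by
  rcases h _ _ _ _ hne with ⟨rfl, rfl⟩ | ⟨rfl, rfl⟩ <;> simp

/-- The terms of a sum weighted with `P` may be changed where `P` vanishes. -/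
theorem PreservesPairs.smul_congr {P : Fin d → Fin d → Fin d → Fin d → K} (h : PreservesPairs P)
    {M : Type*} [AddCommGroup M] [Module K M] {k l i j : Fin d} {x y : M}
    (h₁ : k = i → l = j → x = y) (h₂ : k = j → l = i → x = y) :
    P k l i j • x = P k l i j • y := by
  by_cases h0 : P k l i j = 0
  · simp [h0]
  · rcases h _ _ _ _ h0 with ⟨a, b⟩ | ⟨a, b⟩
    · rw [h₁ a b]
    · rw [h₂ a b]

/-- The matrix `U` of the generators of the dual comodule is a quantum super matrix for the dual
operator. -/
theorem isQuantumSuperMatrix_dual {par : Fin d → ℕ} {P : Fin d → Fin d → Fin d → Fin d → K}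
    (hP : PreservesPairs P) {T : Matrix (Fin d) (Fin d) L}
    (h : Intertwines P (superSquareInv K par T)) :
    IsQuantumSuperMatrix par (dualTensor P)
      (Matrix.of fun j i => (-1 : K) ^ (par j * (par i + 1)) • T i j) := by
  rw [isQuantumSuperMatrix_iff]
  set U : Matrix (Fin d) (Fin d) L :=
    Matrix.of fun j i => (-1 : K) ^ (par j * (par i + 1)) • T i j with hU
  -- The correcting sign depends only on the unordered pairs of upper and lower indices. Since `P`
  -- preserves pairs, it can be carried through both sides of the relation.
  have key : ∀ k l i j, superSquare K par U k l i j =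
      (-1 : K) ^ ((par k + par l) * (par i + par j + 1)) •
        QSuper.superSquareInv K par T j i l k := fun k l i j => by
    simp only [superSquare, QSuper.superSquareInv, hU, Matrix.of_apply, smul_mul_smul_comm,
      smul_smul, ← pow_add]
    congr 1
    apply neg_one_pow_congr_zmod
    push_cast
    generalize (par k : ZMod 2) = x
    generalize (par l : ZMod 2) = y
    generalize (par i : ZMod 2) = z
    generalize (par j : ZMod 2) = w
    revert x y z w
    decide
  intro k l i j
  have hh := congrArg (fun x => (-1 : K) ^ ((par k + par l) * (par i + par j + 1)) • x)
    (h j i l k)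
  simp only [Finset.smul_sum, smul_comm _ (P _ _ _ _)] at hh
  simp only [key, dualTensor]
  rw [Finset.sum_comm]
  refine Eq.trans ?_ (hh.symm.trans ?_)
  · refine Finset.sum_congr rfl fun a _ => Finset.sum_congr rfl fun b _ => ?_
    refine hP.smul_congr ?_ ?_
    · rintro rfl rfl; rw [add_comm (par _) (par _)]
    · rintro rfl rfl; rw [add_comm (par b) (par a)]
  · rw [Finset.sum_comm]
    refine Finset.sum_congr rfl fun a _ => Finset.sum_congr rfl fun b _ => ?_
    refine hP.smul_congr ?_ ?_
    · rintro rfl rfl; rw [add_comm (par _) (par _)]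
    · rintro rfl rfl; rw [add_comm (par j) (par i)]

end Intertwining

/-! ### Ordered monomials in algebras of quantum affine type -/

section OrderedMonomials

variable {K : Type*} [Field K]

/-- The relations `y_i y_j = c_{ij} y_j y_i` for `i ≠ j`, and `y_i ^ 2 = 0` for the indices in
`nil`. -/
structure IsQAffine {𝓑 : Type*} [Ring 𝓑] [Algebra K 𝓑] {d : ℕ} (c : Fin d → Fin d → K)
    (nil : Fin d → Prop) (y : Fin d → 𝓑) : Prop where
  comm : ∀ i j, i ≠ j → y i * y j = c i j • (y j * y i)
  sq : ∀ i, nil i → y i * y i = 0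

/-- The ordered monomial `y_1^{a_1} ⋯ y_d^{a_d}`. -/
def omon {𝓑 : Type*} [Ring 𝓑] {d : ℕ} (y : Fin d → 𝓑) (a : Fin d → ℕ) : 𝓑 :=
  (List.ofFn fun i => y i ^ a i).prod

/-- The scalar that arises when `y_i` is moved to its place in an ordered monomial. -/
def lcoef {d : ℕ} (c : Fin d → Fin d → K) (i : Fin d) (a : Fin d → ℕ) : K :=
  ∏ j, if j < i then c i j ^ a j else 1

variable {𝓑 : Type*} [Ring 𝓑] [Algebra K 𝓑]

theorem omon_zero {d : ℕ} (y : Fin d → 𝓑) : omon y 0 = 1 := by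
  simp [omon]

theorem omon_succ {d : ℕ} (y : Fin (d + 1) → 𝓑) (a : Fin (d + 1) → ℕ) :
    omon y a = y 0 ^ a 0 * omon (fun i => y i.succ) (fun i => a i.succ) := by
  simp [omon, List.ofFn_succ]

theorem pow_mul_smul_comm {x z : 𝓑} {γ : K} (h : x * z = γ • (z * x)) (k : ℕ) :
    x ^ k * z = γ ^ k • (z * x ^ k) := by
  induction k with
  | zero => simp
  | succ k ih =>
    rw [pow_succ, mul_assoc, h, mul_smul_comm, ← mul_assoc, ih, smul_mul_assoc, smul_smul,
      mul_assoc, pow_succ, mul_comm γ]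

theorem mul_pow_smul_comm {x z : 𝓑} {γ : K} (h : z * x = γ • (x * z)) (k : ℕ) :
    z * x ^ k = γ ^ k • (x ^ k * z) := by
  induction k with
  | zero => simp
  | succ k ih =>
    rw [pow_succ, ← mul_assoc, ih, smul_mul_assoc, mul_assoc, h, mul_smul_comm, smul_smul,
      mul_assoc, pow_succ]

theorem omon_mul_comm {d : ℕ} (y : Fin d → 𝓑) (z : 𝓑) (γ : Fin d → K)
    (h : ∀ j, y j * z = γ j • (z * y j)) (a : Fin d → ℕ) :
    omon y a * z = (∏ j, γ j ^ a j) • (z * omon y a) := by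
  induction d with
  | zero => simp [omon]
  | succ d ih =>
    rw [omon_succ, mul_assoc, ih (fun i => y i.succ) (fun i => γ i.succ) (fun j => h _),
      mul_smul_comm, ← mul_assoc, pow_mul_smul_comm (h 0), smul_mul_assoc, smul_smul, mul_assoc,
      Fin.prod_univ_succ, mul_comm (∏ _, _)]

theorem IsQAffine.succ {d : ℕ} {c : Fin (d + 1) → Fin (d + 1) → K} {nil : Fin (d + 1) → Prop}
    {y : Fin (d + 1) → 𝓑} (h : IsQAffine c nil y) :
    IsQAffine (fun i j => c i.succ j.succ) (fun i => nil i.succ) (fun i => y i.succ) where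
  comm i j hij := h.comm _ _ (by simpa using hij)
  sq i hi := h.sq _ hi

theorem lcoef_zero_index {d : ℕ} (c : Fin (d + 1) → Fin (d + 1) → K) (a : Fin (d + 1) → ℕ) :
    lcoef c 0 a = 1 := by
  simp [lcoef]

theorem lcoef_succ_index {d : ℕ} (c : Fin (d + 1) → Fin (d + 1) → K) (i : Fin d)
    (a : Fin (d + 1) → ℕ) : lcoef c i.succ a =
      c i.succ 0 ^ a 0 * lcoef (fun i j => c i.succ j.succ) i (fun j => a j.succ) := by
  simp [lcoef, Fin.prod_univ_succ]

theorem IsQAffine.mul_omon {d : ℕ} {c : Fin d → Fin d → K} {nil : Fin d → Prop}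
    {y : Fin d → 𝓑} (h : IsQAffine c nil y) (i : Fin d) (a : Fin d → ℕ) :
    y i * omon y a = lcoef c i a • omon y (a + Pi.single i 1) := by
  induction d with
  | zero => exact i.elim0
  | succ d ih =>
    refine Fin.cases ?_ (fun i => ?_) i
    · rw [lcoef_zero_index, one_smul, omon_succ, omon_succ, ← mul_assoc, ← pow_succ']
      simp [Fin.succ_ne_zero]
    · have e : (fun j : Fin d => (a + Pi.single i.succ 1 : Fin (d + 1) → ℕ) j.succ) =
          (fun j => a j.succ) + Pi.single i 1 := by
        funext j; simp [Pi.single_apply]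
      have e0 : (a + Pi.single i.succ 1 : Fin (d + 1) → ℕ) 0 = a 0 := by
        simp [(Fin.succ_ne_zero i).symm]
      rw [omon_succ, omon_succ, e, e0, ← mul_assoc,
        mul_pow_smul_comm (h.comm i.succ 0 (Fin.succ_ne_zero i)), smul_mul_assoc, mul_assoc,
        ih h.succ, mul_smul_comm, smul_smul, lcoef_succ_index]

theorem IsQAffine.omon_eq_zero {d : ℕ} {c : Fin d → Fin d → K} {nil : Fin d → Prop}
    {y : Fin d → 𝓑} (h : IsQAffine c nil y) {i : Fin d} (hi : nil i) {a : Fin d → ℕ}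
    (ha : ¬ a i ≤ 1) : omon y a = 0 := by
  apply List.prod_eq_zero
  rw [List.mem_ofFn]
  refine ⟨i, ?_⟩
  exact pow_eq_zero_of_le (not_le.1 ha) (by rw [pow_two, h.sq i hi])

/-- The scalar that arises when `y_i` is moved from the right to its place in an ordered
monomial. -/
def rcoef {d : ℕ} (c : Fin d → Fin d → K) (i : Fin d) (a : Fin d → ℕ) : K :=
  (∏ j, (if j = i then 1 else c j i) ^ a j) * lcoef c i a

theorem IsQAffine.omon_mul {d : ℕ} {c : Fin d → Fin d → K} {nil : Fin d → Prop}
    {y : Fin d → 𝓑} (h : IsQAffine c nil y) (i : Fin d) (a : Fin d → ℕ) :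
    omon y a * y i = rcoef c i a • omon y (a + Pi.single i 1) := by
  rw [omon_mul_comm y (y i) (fun j => if j = i then 1 else c j i), h.mul_omon, smul_smul, rcoef]
  intro j
  split_ifs with hj
  · rw [hj, one_smul]
  · exact h.comm j i hj

variable {d : ℕ} {c : Fin d → Fin d → K}

theorem lcoef_ne_zero (hc : ∀ i j, i ≠ j → c i j * c j i = 1) (i : Fin d) (a : Fin d → ℕ) :
    lcoef c i a ≠ 0 := by
  refine Finset.prod_ne_zero_iff.2 fun j _ => ?_
  split_ifs with h
  · exact pow_ne_zero _ (left_ne_zero_of_mul_eq_one (hc i j h.ne'))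
  · exact one_ne_zero

theorem rcoef_ne_zero (hc : ∀ i j, i ≠ j → c i j * c j i = 1) (i : Fin d) (a : Fin d → ℕ) :
    rcoef c i a ≠ 0 := by
  refine mul_ne_zero (Finset.prod_ne_zero_iff.2 fun j _ => ?_) (lcoef_ne_zero hc i a)
  split_ifs with h
  · simp
  · exact pow_ne_zero _ (left_ne_zero_of_mul_eq_one (hc j i h))

theorem lcoef_add_single (i j : Fin d) (a : Fin d → ℕ) :
    lcoef c i (a + Pi.single j 1) = lcoef c i a * if j < i then c i j else 1 := by
  have : ∀ k, (if k < i then c i k ^ (a + Pi.single j 1 : Fin d → ℕ) k else 1) =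
      (if k < i then c i k ^ a k else 1) * if k = j then (if j < i then c i j else 1) else 1 := by
    intro k
    by_cases hk : k = j
    · subst hk; by_cases h : k < i <;> simp [h, pow_succ]
    · simp [hk]
  simp only [lcoef, this, Finset.prod_mul_distrib, Finset.prod_ite_eq', Finset.mem_univ, if_true]

/-- This is the consistency condition for two ways of inserting `y_i` and `y_j` into an ordered
monomial. Only the one of the two that jumps over the other picks up a factor, and `c_{ij} c_{ji} =
1` makes the two cases agree. -/
theorem lcoef_swap (hc : ∀ i j, i ≠ j → c i j * c j i = 1) {i j : Fin d} (hij : i ≠ j)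
    (a : Fin d → ℕ) : lcoef c j a * lcoef c i (a + Pi.single j 1) =
      c i j * (lcoef c i a * lcoef c j (a + Pi.single i 1)) := by
  rw [lcoef_add_single, lcoef_add_single]
  rcases lt_or_gt_of_ne hij with h | h
  · rw [if_neg h.not_gt, if_pos h, mul_one]
    linear_combination (-lcoef c j a * lcoef c i a) * hc i j hij
  · rw [if_neg h.not_gt, if_pos h]
    ring

/-- The right insertion scalar is a product of a character in the exponents and a left insertion
scalar; the first contributes `c_{ij}` against `c_{ji}`, the second is governed by `lcoef_swap`. -/
theorem rcoef_swap (hc : ∀ i j, i ≠ j → c i j * c j i = 1) {i j : Fin d} (hij : i ≠ j)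
    (a : Fin d → ℕ) : rcoef c i a * rcoef c j (a + Pi.single i 1) =
      c i j * (rcoef c j a * rcoef c i (a + Pi.single j 1)) := by
  have e : ∀ i j : Fin d, i ≠ j →
      ∏ k, (if k = j then 1 else c k j) ^ (a + Pi.single i 1 : Fin d → ℕ) k =
        (∏ k, (if k = j then 1 else c k j) ^ a k) * c i j := fun i j hij => by
    simp only [Pi.add_apply, pow_add, Finset.prod_mul_distrib]
    congr 1
    rw [Finset.prod_eq_single i]
    · simp [hij]
    · intro b _ hb; simp [hb]
    · simp
  simp only [rcoef]
  rw [e i j hij, e j i hij.symm]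
  linear_combination (c i j * (∏ k, (if k = j then 1 else c k j) ^ a k) *
    (∏ k, (if k = i then 1 else c k i) ^ a k)) * lcoef_swap hc hij.symm a

end OrderedMonomials

/-! ### The monomial basis of an algebra of quantum affine type -/

section MonomialBasis

variable {K : Type*} [Field K] {d : ℕ}

/-- The exponents of the nonzero monomials. -/
def Adm (nil : Fin d → Prop) (a : Fin d → ℕ) : Prop := ∀ i, nil i → a i ≤ 1

theorem Adm.of_le {nil : Fin d → Prop} {a b : Fin d → ℕ} (h : Adm nil b) (hab : a ≤ b) :
    Adm nil a := fun i hi => (hab i).trans (h i hi)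

open Classical in
/-- The operator of left multiplication by `y_i` in the monomial basis. -/
def ly (c : Fin d → Fin d → K) (nil : Fin d → Prop) (i : Fin d) :
    Module.End K ((Fin d → ℕ) →₀ K) :=
  Finsupp.linearCombination K fun a =>
    if Adm nil (a + Pi.single i 1) then Finsupp.single (a + Pi.single i 1) (lcoef c i a) else 0

theorem ly_single (c : Fin d → Fin d → K) (nil : Fin d → Prop) (i : Fin d) {a : Fin d → ℕ}
    (h : Adm nil (a + Pi.single i 1)) (x : K) :
    ly c nil i (Finsupp.single a x) =
      Finsupp.single (a + Pi.single i 1) (x * lcoef c i a) := by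
  simp [ly, h]

theorem ly_single_of_not (c : Fin d → Fin d → K) (nil : Fin d → Prop) (i : Fin d)
    {a : Fin d → ℕ} (h : ¬ Adm nil (a + Pi.single i 1)) (x : K) :
    ly c nil i (Finsupp.single a x) = 0 := by
  simp [ly, h]

theorem ly_ly_single (c : Fin d → Fin d → K) (nil : Fin d → Prop) (i j : Fin d) (a : Fin d → ℕ)
    (x : K) [Decidable (Adm nil (a + Pi.single j 1 + Pi.single i 1))] :
    ly c nil i (ly c nil j (Finsupp.single a x)) =
      if Adm nil (a + Pi.single j 1 + Pi.single i 1) then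
        Finsupp.single (a + Pi.single j 1 + Pi.single i 1)
          (x * lcoef c j a * lcoef c i (a + Pi.single j 1)) else 0 := by
  split_ifs with h
  · rw [ly_single c nil j (h.of_le le_self_add), ly_single c nil i h]
  · by_cases h' : Adm nil (a + Pi.single j 1)
    · rw [ly_single c nil j h', ly_single_of_not c nil i h]
    · rw [ly_single_of_not c nil j h', map_zero]

/-- Both orders of multiplication lead to the same exponent, so the commutation relation is the
identity `lcoef_swap` of scalars. Squares in `nil` vanish because an exponent at least two is not
admissible. -/
theorem isQAffine_ly {c : Fin d → Fin d → K} (hc : ∀ i j, i ≠ j → c i j * c j i = 1)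
    (nil : Fin d → Prop) : IsQAffine c nil (ly c nil) where
  comm i j hij := by
    classical
    refine Finsupp.lhom_ext fun a x => ?_
    rw [LinearMap.smul_apply, Module.End.mul_apply, Module.End.mul_apply, ly_ly_single,
      ly_ly_single, mul_assoc, lcoef_swap hc hij, add_right_comm a (Pi.single j 1)]
    split_ifs
    · rw [Finsupp.smul_single, smul_eq_mul]
      congr 1; ring
    · simp
  sq i hi := by
    classical
    refine Finsupp.lhom_ext fun a x => ?_
    rw [Module.End.mul_apply, ly_ly_single, if_neg, LinearMap.zero_apply]
    intro h
    have := h i hi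
    simp at this

/-- The generators satisfy the relations of quantum affine type, and these relations suffice to
define an action on the space with the monomials as a basis. -/
structure IsQAffinePresentation {𝒜 : Type*} [Ring 𝒜] [Algebra K 𝒜] (c : Fin d → Fin d → K)
    (nil : Fin d → Prop) (y : Fin d → 𝒜) : Prop extends IsQAffine c nil y where
  inv : ∀ i j, i ≠ j → c i j * c j i = 1
  gen : Algebra.adjoin K (Set.range y) = ⊤
  model : ∃ Φ : 𝒜 →ₐ[K] Module.End K ((Fin d → ℕ) →₀ K), ∀ i, Φ (y i) = ly c nil i

variable {𝒜 : Type*} [Ring 𝒜] [Algebra K 𝒜]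

/-- A subspace containing `1` and stable under the generators is a left ideal containing `1`. This
is how spanning sets are recognised below. -/
theorem submodule_eq_top_of_mul_left {y : Fin d → 𝒜}
    (gen : Algebra.adjoin K (Set.range y) = ⊤) (p : Submodule K 𝒜) (h1 : 1 ∈ p)
    (hmul : ∀ i, ∀ v ∈ p, y i * v ∈ p) : p = ⊤ := by
  have key : ∀ x : 𝒜, x ∈ Algebra.adjoin K (Set.range y) → ∀ v ∈ p, x * v ∈ p := by
    intro x hx
    induction hx using Algebra.adjoin_induction with
    | mem x hx => obtain ⟨i, rfl⟩ := hx; exact hmul i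
    | algebraMap r => intro v hv; rw [← Algebra.smul_def]; exact p.smul_mem _ hv
    | add x y _ _ hx hy => intro v hv; rw [add_mul]; exact p.add_mem (hx v hv) (hy v hv)
    | mul x y _ _ hx hy => intro v hv; rw [mul_assoc]; exact hx _ (hy v hv)
  rw [eq_top_iff]
  intro x _
  simpa using key x (by rw [gen]; trivial) 1 h1

variable {c : Fin d → Fin d → K} {nil : Fin d → Prop} {y : Fin d → 𝒜}

theorem exists_eq_add_single {a : Fin d → ℕ} (ha : a ≠ 0) :
    ∃ (i : Fin d) (b : Fin d → ℕ), a = b + Pi.single i 1 ∧ ∀ j < i, b j = 0 := by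
  classical
  have hne : ∃ i, a i ≠ 0 := by
    by_contra! h
    exact ha (funext h)
  obtain ⟨i, hi, hmin⟩ := WellFounded.has_min (wellFounded_lt (α := Fin d)) {i | a i ≠ 0} hne
  have hle : (Pi.single i 1 : Fin d → ℕ) ≤ a := by
    intro j
    by_cases hj : j = i
    · subst hj; simpa using Nat.one_le_iff_ne_zero.2 hi
    · simp [hj]
  refine ⟨i, a - Pi.single i 1, (tsub_add_cancel_of_le hle).symm, fun j hj => ?_⟩
  have : a j = 0 := by
    by_contra h
    exact hmin j h hj
  simp [this]

theorem lcoef_eq_one {i : Fin d} {a : Fin d → ℕ} (h : ∀ j < i, a j = 0) : lcoef c i a = 1 := by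
  refine Finset.prod_eq_one fun j _ => ?_
  split_ifs with hj
  · rw [h j hj, pow_zero]
  · rfl

/-- Peel off the first letter of the monomial: its index is minimal among those that occur, so it is
already in its place and no scalar arises. Thus an admissible monomial applied to the vacuum vector
gives exactly its basis vector. -/
theorem model_omon (h : IsQAffine c nil y)
    {Φ : 𝒜 →ₐ[K] Module.End K ((Fin d → ℕ) →₀ K)} (hΦ : ∀ i, Φ (y i) = ly c nil i)
    (a : Fin d → ℕ) (ha : Adm nil a) :
    Φ (omon y a) (Finsupp.single 0 1) = Finsupp.single a 1 := by
  by_cases h0 : a = 0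
  · rw [h0, omon_zero, map_one]; rfl
  · obtain ⟨i, b, hab, hb⟩ := exists_eq_add_single h0
    have hlt : ∑ j, b j < ∑ j, a j := by
      rw [hab]; simp [Finset.sum_add_distrib]
    have hadm : Adm nil b := ha.of_le (by rw [hab]; exact le_self_add)
    have e := h.mul_omon i b
    rw [lcoef_eq_one hb, one_smul, ← hab] at e
    rw [← e, map_mul, hΦ, Module.End.mul_apply, model_omon h hΦ b hadm, ly_single _ _ _ (hab ▸ ha),
      lcoef_eq_one hb, ← hab, mul_one]
termination_by ∑ j, a j

/-- Acting on the vacuum vector of the model sends the monomials to distinct basis vectors, so no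
rewriting argument is needed. -/
theorem IsQAffinePresentation.linearIndependent (h : IsQAffinePresentation c nil y) :
    LinearIndependent K fun a : {a // Adm nil a} => omon y a.1 := by
  obtain ⟨Φ, hΦ⟩ := h.model
  refine LinearIndependent.of_comp
    ((LinearMap.applyₗ (Finsupp.single 0 1)).comp Φ.toLinearMap) ?_
  have := (Finsupp.basisSingleOne (R := K) (ι := Fin d → ℕ)).linearIndependent.comp
    (fun a : {a // Adm nil a} => a.1) Subtype.val_injective
  convert this using 1
  funext a
  simpa using model_omon h.toIsQAffine hΦ a.1 a.2

theorem IsQAffinePresentation.span_eq_top (h : IsQAffinePresentation c nil y) :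
    Submodule.span K (Set.range fun a : {a // Adm nil a} => omon y a.1) = ⊤ := by
  have hmem : ∀ a, omon y a ∈
      Submodule.span K (Set.range fun a : {a // Adm nil a} => omon y a.1) := by
    intro a
    by_cases ha : Adm nil a
    · exact Submodule.subset_span ⟨⟨a, ha⟩, rfl⟩
    · simp only [Adm, not_forall] at ha
      obtain ⟨i, hi, hai⟩ := ha
      rw [h.omon_eq_zero hi hai]
      exact Submodule.zero_mem _
  refine submodule_eq_top_of_mul_left h.gen _ (by simpa [omon_zero] using hmem 0) ?_
  intro i v hv
  induction hv using Submodule.span_induction with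
  | mem v hv =>
    obtain ⟨a, rfl⟩ := hv
    simp only [h.mul_omon]
    exact Submodule.smul_mem _ _ (hmem _)
  | zero => simp
  | add v w _ _ hv hw => rw [mul_add]; exact Submodule.add_mem _ hv hw
  | smul r v _ hv => rw [mul_smul_comm]; exact Submodule.smul_mem _ _ hv

/-- The basis of ordered monomials. -/
def IsQAffinePresentation.basis (h : IsQAffinePresentation c nil y) :
    Module.Basis {a // Adm nil a} K 𝒜 :=
  Module.Basis.mk h.linearIndependent h.span_eq_top.ge

@[simp]
theorem IsQAffinePresentation.basis_apply (h : IsQAffinePresentation c nil y)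
    (a : {a // Adm nil a}) : h.basis a = omon y a.1 := by
  simp [IsQAffinePresentation.basis]

/-- The coefficient of an ordered monomial. -/
def IsQAffinePresentation.coeff (h : IsQAffinePresentation c nil y) (a : {a // Adm nil a}) :
    𝒜 →ₗ[K] K := h.basis.coord a

open Classical in
theorem IsQAffinePresentation.coeff_omon (h : IsQAffinePresentation c nil y)
    (a : {a // Adm nil a}) (b : Fin d → ℕ) :
    h.coeff a (omon y b) = if b = a.1 then 1 else 0 := by
  by_cases hb : Adm nil b
  · have := h.basis.repr_self_apply ⟨b, hb⟩ a
    rw [h.basis_apply] at this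
    simpa [IsQAffinePresentation.coeff, Subtype.ext_iff] using this
  · rw [if_neg (fun e => hb (by rw [e]; exact a.2))]
    simp only [Adm, not_forall] at hb
    obtain ⟨i, hi, hai⟩ := hb
    rw [h.omon_eq_zero hi hai, map_zero]

/-! ### Products of generators along words -/

/-- The number of occurrences of the letters in a word. -/
def wordCount {k : ℕ} (f : Fin k → Fin d) : Fin d → ℕ := ∑ u, Pi.single (f u) 1

/-- The product of `c_{f u, f v}` over the inversions `u < v`, `f v < f u` of a word. -/
def wordCoef (c : Fin d → Fin d → K) {k : ℕ} (f : Fin k → Fin d) : K :=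
  ∏ u, ∏ v, if u < v ∧ f v < f u then c (f u) (f v) else 1

theorem lcoef_wordCount (c : Fin d → Fin d → K) (i : Fin d) {k : ℕ} (f : Fin k → Fin d) :
    lcoef c i (wordCount f) = ∏ v, if f v < i then c i (f v) else 1 := by
  induction k with
  | zero => simp [wordCount, lcoef]
  | succ k ih =>
    have := ih (fun v => f v.succ)
    rw [wordCount, Fin.sum_univ_succ, add_comm, lcoef_add_single, Fin.prod_univ_succ, mul_comm]
    congr 1

theorem wordCoef_succ (c : Fin d → Fin d → K) {k : ℕ} (f : Fin (k + 1) → Fin d) :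
    wordCoef c f = (∏ v : Fin k, if f v.succ < f 0 then c (f 0) (f v.succ) else 1) *
      wordCoef c (fun v => f v.succ) := by
  simp [wordCoef, Fin.prod_univ_succ]

/-- Sorting a word costs one factor `c` for each inversion; insert the first letter into the sorted
tail. -/
theorem IsQAffine.prod_word {𝓑 : Type*} [Ring 𝓑] [Algebra K 𝓑] {y : Fin d → 𝓑}
    (h : IsQAffine c nil y) {k : ℕ} (f : Fin k → Fin d) :
    (List.ofFn fun u => y (f u)).prod = wordCoef c f • omon y (wordCount f) := by
  induction k with
  | zero => simp [wordCoef, wordCount, omon_zero]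
  | succ k ih =>
    rw [List.ofFn_succ, List.prod_cons, ih (fun u => f u.succ), mul_smul_comm, h.mul_omon,
      smul_smul, wordCoef_succ, lcoef_wordCount, mul_comm, wordCount, wordCount,
      Fin.sum_univ_succ, add_comm (Pi.single _ _)]

end MonomialBasis

/-! ### The cohomology of the Koszul complex -/

section KoszulCohomology

variable {K : Type*} [Field K] {d : ℕ} {𝒜 𝒮 : Type*} [Ring 𝒜] [Algebra K 𝒜] [Ring 𝒮]
  [Algebra K 𝒮] {c c' : Fin d → Fin d → K} {nil : Fin d → Prop} {x : Fin d → 𝒜} {ξ : Fin d → 𝒮}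

/-- The Koszul differential `a ⊗ b ↦ ∑ i, a x_i ⊗ ξ_i b`. -/
def diffl (K : Type*) [Field K] [Algebra K 𝒜] [Algebra K 𝒮] (x : Fin d → 𝒜) (ξ : Fin d → 𝒮) :
    𝒜 ⊗[K] 𝒮 →ₗ[K] 𝒜 ⊗[K] 𝒮 :=
  ∑ i, TensorProduct.map (LinearMap.mulRight K (x i)) (LinearMap.mulLeft K (ξ i))

theorem diffl_tmul (a : 𝒜) (b : 𝒮) :
    diffl K x ξ (a ⊗ₜ b) = ∑ i, (a * x i) ⊗ₜ[K] (ξ i * b) := by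
  simp [diffl, LinearMap.sum_apply]

/-- The tensor product of two ordered monomials. -/
def bimon (K : Type*) [Field K] [Algebra K 𝒜] [Algebra K 𝒮] (x : Fin d → 𝒜) (ξ : Fin d → 𝒮)
    (a b : Fin d → ℕ) : 𝒜 ⊗[K] 𝒮 := omon x a ⊗ₜ omon ξ b

/-- The coefficients of the Koszul differential in the monomial basis. -/
def dcoef (c c' : Fin d → Fin d → K) (i : Fin d) (a b : Fin d → ℕ) : K :=
  rcoef c i a * lcoef c' i b

theorem diffl_bimon (hx : IsQAffine c nil x) (hξ : IsQAffine c' (fun i => ¬ nil i) ξ)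
    (a b : Fin d → ℕ) : diffl K x ξ (bimon K x ξ a b) =
      ∑ i, dcoef c c' i a b • bimon K x ξ (a + Pi.single i 1) (b + Pi.single i 1) := by
  simp only [bimon, diffl_tmul, hx.omon_mul, hξ.mul_omon, dcoef, TensorProduct.smul_tmul_smul]

theorem dcoef_ne_zero (hc : ∀ i j, i ≠ j → c i j * c j i = 1)
    (hc' : ∀ i j, i ≠ j → c' i j * c' j i = 1) (i : Fin d) (a b : Fin d → ℕ) :
    dcoef c c' i a b ≠ 0 :=
  mul_ne_zero (rcoef_ne_zero hc i a) (lcoef_ne_zero hc' i b)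

/-- The squares of the exponent lattice anticommute: exchanging the directions costs `c_{ij}` in the
first factor and `c'_{ji}` in the second, and their product is `-1`. This gives `D² = 0` off the
diagonal and the cancellation in the homotopy formula. -/
theorem dcoef_swap (hc : ∀ i j, i ≠ j → c i j * c j i = 1)
    (hc' : ∀ i j, i ≠ j → c' i j * c' j i = 1) (hcc' : ∀ i j, i ≠ j → c i j * c' j i = -1)
    {i j : Fin d} (hij : i ≠ j) (a b : Fin d → ℕ) :
    dcoef c c' i a b * dcoef c c' j (a + Pi.single i 1) (b + Pi.single i 1) =
      -(dcoef c c' j a b * dcoef c c' i (a + Pi.single j 1) (b + Pi.single j 1)) := by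
  have h1 := rcoef_swap hc hij a
  have h2 := lcoef_swap hc' hij.symm b
  simp only [dcoef]
  calc _ = (rcoef c i a * rcoef c j (a + Pi.single i 1)) *
        (lcoef c' i b * lcoef c' j (b + Pi.single i 1)) := by ring
    _ = (c i j * c' j i) * ((rcoef c j a * rcoef c i (a + Pi.single j 1)) *
        (lcoef c' j b * lcoef c' i (b + Pi.single j 1))) := by rw [h1, h2]; ring
    _ = _ := by rw [hcc' i j hij]; ring

/-- The exponents of the product of the generators in `nil`. -/
def topExp (nil : Fin d → Prop) : Fin d → ℕ :=
  open Classical in fun i => if nil i then 1 else 0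

theorem adm_topExp (nil : Fin d → Prop) : Adm nil (topExp nil) := fun i _ => by
  unfold topExp; split_ifs; all_goals simp

/-- The coordinate `i` of the pair of exponents differs from that of the generator of the
cohomology, even up to a multiple of `(1, 1)`. -/
def Free (nil : Fin d → Prop) (a b : Fin d → ℕ) (i : Fin d) : Prop :=
  ¬ ((nil i ∧ a i = b i + 1) ∨ (¬ nil i ∧ b i = a i + 1))

/-- Being free depends only on `a - b`, which the differential preserves. Hence the direction of
contraction can be chosen once for all monomials joined by the differential. -/
theorem free_add (nil : Fin d → Prop) (a b e : Fin d → ℕ) :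
    Free nil (a + e) (b + e) = Free nil a b := by
  funext i
  simp only [Free, Pi.add_apply, eq_iff_iff]
  have h1 : a i + e i = b i + e i + 1 ↔ a i = b i + 1 := by omega
  have h2 : b i + e i = a i + e i + 1 ↔ b i = a i + 1 := by omega
  rw [h1, h2]

/-- An admissible pair is forced coordinatewise: where `i` is in `nil`, `a i ≤ 1` and `a i = b i +
1` leave only `a i = 1`, `b i = 0`, and symmetrically elsewhere. -/
theorem not_free_iff (nil : Fin d → Prop) {a b : Fin d → ℕ} (ha : Adm nil a)
    (hb : Adm (fun i => ¬ nil i) b) :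
    (¬ ∃ i, Free nil a b i) ↔ a = topExp nil ∧ b = topExp fun i => ¬ nil i := by
  simp only [not_exists, Free, not_not]
  constructor
  · intro h
    constructor
    all_goals
      funext i
      by_cases hi : nil i
      · have h1 := h i
        have h2 := ha i hi
        simp only [hi, true_and, not_true_eq_false, false_and, or_false] at h1
        simp only [topExp, hi, if_true, not_true_eq_false, if_false]
        omega
      · have h1 := h i
        have h2 := hb i hi
        simp only [hi, not_false_eq_true, true_and, false_and, false_or] at h1
        simp only [topExp, hi, if_true, not_false_eq_true, if_false]
        omega
  · rintro ⟨rfl, rfl⟩ i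
    by_cases hi : nil i <;> simp [topExp, hi]

open Classical in
/-- The values of the contracting homotopy on the monomial basis. -/
def htpyFun (c c' : Fin d → Fin d → K) (nil : Fin d → Prop) (x : Fin d → 𝒜) (ξ : Fin d → 𝒮)
    (a b : Fin d → ℕ) : 𝒜 ⊗[K] 𝒮 :=
  if h : ∃ i, Free nil a b i then
    if 1 ≤ a h.choose ∧ 1 ≤ b h.choose then
      (dcoef c c' h.choose (a - Pi.single h.choose 1) (b - Pi.single h.choose 1))⁻¹ •
        bimon K x ξ (a - Pi.single h.choose 1) (b - Pi.single h.choose 1)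
    else 0
  else 0

/-- A contracting homotopy of the Koszul complex, away from the class of the generator of the
cohomology. -/
def htpy (hx : IsQAffinePresentation c nil x)
    (hξ : IsQAffinePresentation c' (fun i => ¬ nil i) ξ) : 𝒜 ⊗[K] 𝒮 →ₗ[K] 𝒜 ⊗[K] 𝒮 :=
  (hx.basis.tensorProduct hξ.basis).constr K fun ab => htpyFun c c' nil x ξ ab.1.1 ab.2.1

/-- The functional that reads off the coefficient of the generator of the cohomology. -/
def topCoeff (hx : IsQAffinePresentation c nil x)
    (hξ : IsQAffinePresentation c' (fun i => ¬ nil i) ξ) : 𝒜 ⊗[K] 𝒮 →ₗ[K] K :=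
  LinearMap.mul' K K ∘ₗ TensorProduct.map (hx.coeff ⟨_, adm_topExp _⟩) (hξ.coeff ⟨_, adm_topExp _⟩)

theorem htpy_bimon (hx : IsQAffinePresentation c nil x)
    (hξ : IsQAffinePresentation c' (fun i => ¬ nil i) ξ)
    {a b : Fin d → ℕ} (ha : Adm nil a) (hb : Adm (fun i => ¬ nil i) b) :
    htpy hx hξ (bimon K x ξ a b) = htpyFun c c' nil x ξ a b := by
  have := (hx.basis.tensorProduct hξ.basis).constr_basis K
    (fun ab => htpyFun c c' nil x ξ ab.1.1 ab.2.1) (⟨a, ha⟩, ⟨b, hb⟩)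
  rw [Module.Basis.tensorProduct_apply] at this
  simpa [htpy, bimon] using this

theorem bimon_eq_zero (hx : IsQAffinePresentation c nil x)
    (hξ : IsQAffinePresentation c' (fun i => ¬ nil i) ξ)
    {a b : Fin d → ℕ} (h : ¬ (Adm nil a ∧ Adm (fun i => ¬ nil i) b)) :
    bimon K x ξ a b = 0 := by
  rw [not_and_or] at h
  rcases h with h | h
  · simp only [Adm, not_forall] at h
    obtain ⟨i, hi, hai⟩ := h
    rw [bimon, hx.omon_eq_zero hi hai, TensorProduct.zero_tmul]
  · simp only [Adm, not_forall] at h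
    obtain ⟨i, hi, hai⟩ := h
    rw [bimon, hξ.omon_eq_zero hi hai, TensorProduct.tmul_zero]

open Classical in
theorem topCoeff_bimon (hx : IsQAffinePresentation c nil x)
    (hξ : IsQAffinePresentation c' (fun i => ¬ nil i) ξ)
    (a b : Fin d → ℕ) : topCoeff hx hξ (bimon K x ξ a b) =
    if a = topExp nil ∧ b = topExp (fun i => ¬ nil i) then 1 else 0 := by
  simp only [topCoeff, bimon, LinearMap.comp_apply, TensorProduct.map_tmul, LinearMap.mul'_apply,
    IsQAffinePresentation.coeff_omon]
  split_ifs <;> simp_all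

theorem diffl_top (hx : IsQAffinePresentation c nil x)
    (hξ : IsQAffinePresentation c' (fun i => ¬ nil i) ξ) :
    diffl K x ξ (bimon K x ξ (topExp nil) (topExp fun i => ¬ nil i)) = 0 := by
  rw [diffl_bimon hx.toIsQAffine hξ.toIsQAffine]
  refine Finset.sum_eq_zero fun i _ => ?_
  rw [bimon_eq_zero hx hξ, smul_zero]
  rintro ⟨h1, h2⟩
  by_cases hi : nil i
  · have := h1 i hi; simp [topExp, hi] at this
  · have := h2 i hi; simp [topExp, hi] at this

theorem hom_ext_bimon (hx : IsQAffinePresentation c nil x)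
    (hξ : IsQAffinePresentation c' (fun i => ¬ nil i) ξ)
    {M : Type*} [AddCommGroup M] [Module K M] {f g : 𝒜 ⊗[K] 𝒮 →ₗ[K] M}
    (h : ∀ a b, Adm nil a → Adm (fun i => ¬ nil i) b →
      f (bimon K x ξ a b) = g (bimon K x ξ a b)) : f = g := by
  refine (hx.basis.tensorProduct hξ.basis).ext fun ab => ?_
  rw [Module.Basis.tensorProduct_apply]
  simpa [bimon] using h _ _ ab.1.2 ab.2.2

/-- Each term of the differential raises `a` and `b` in the same coordinate, whereas in the
generator exactly one of them is positive there. -/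
theorem topCoeff_diffl (hx : IsQAffinePresentation c nil x)
    (hξ : IsQAffinePresentation c' (fun i => ¬ nil i) ξ)
    : topCoeff hx hξ ∘ₗ diffl K x ξ = 0 := by
  classical
  refine hom_ext_bimon hx hξ fun a b ha hb => ?_
  rw [LinearMap.comp_apply, diffl_bimon hx.toIsQAffine hξ.toIsQAffine, map_sum,
    LinearMap.zero_apply]
  refine Finset.sum_eq_zero fun i _ => ?_
  rw [map_smul, topCoeff_bimon, if_neg, smul_zero]
  rintro ⟨h1, h2⟩
  have h1 := congrFun h1 i
  have h2 := congrFun h2 i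
  by_cases hi : nil i <;> simp [topExp, hi] at h1 h2

theorem htpyFun_of_not_free {a b : Fin d → ℕ} (h : ¬ ∃ i, Free nil a b i) :
    htpyFun (𝒜 := 𝒜) (𝒮 := 𝒮) c c' nil x ξ a b = 0 := by
  rw [htpyFun, dif_neg h]

/-- The predicate `Free` is literally the same at shifted exponents, so the choice function returns
the same direction. The homotopy would fail if neighbouring monomials were contracted in different
directions. -/
theorem htpyFun_add {a b a' b' : Fin d → ℕ} (h : ∃ i, Free nil a b i) (e : Fin d → ℕ)
    (ha : a' = a + e) (hb : b' = b + e) :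
    htpyFun (𝒜 := 𝒜) (𝒮 := 𝒮) c c' nil x ξ a' b' =
      open Classical in if 1 ≤ a' h.choose ∧ 1 ≤ b' h.choose then
        (dcoef c c' h.choose (a' - Pi.single h.choose 1) (b' - Pi.single h.choose 1))⁻¹ •
          bimon K x ξ (a' - Pi.single h.choose 1) (b' - Pi.single h.choose 1)
      else 0 := by
  subst ha hb
  have hf : Free nil (a + e) (b + e) = Free nil a b := free_add nil a b e
  have h' : ∃ i, Free nil (a + e) (b + e) i := by rw [hf]; exact h
  have hch : h'.choose = h.choose := by congr!
  rw [htpyFun, dif_pos h', hch]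

/-- Fix the chosen free direction `i`. Its edges are disjoint and pair off all admissible exponents
with the given difference: if both coordinates are positive, the element is an upper end, otherwise
a lower end. The terms in direction `i` yield the identity, and those in the other directions cancel
by anticommutativity. Without a free direction only the generator is left. -/
theorem diffl_htpy_add_htpy_diffl (hx : IsQAffinePresentation c nil x)
    (hξ : IsQAffinePresentation c' (fun i => ¬ nil i) ξ)
    (hcc' : ∀ i j, i ≠ j → c i j * c' j i = -1) (w : 𝒜 ⊗[K] 𝒮) :
    diffl K x ξ (htpy hx hξ w) + htpy hx hξ (diffl K x ξ w) =
      w - topCoeff hx hξ w • bimon K x ξ (topExp nil) (topExp fun i => ¬ nil i) := by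
  classical
  suffices h : diffl K x ξ ∘ₗ htpy hx hξ + htpy hx hξ ∘ₗ diffl K x ξ =
      LinearMap.id - (topCoeff hx hξ).smulRight
        (bimon K x ξ (topExp nil) (topExp fun i => ¬ nil i)) by
    simpa using LinearMap.congr_fun h w
  refine hom_ext_bimon hx hξ fun a b ha hb => ?_
  simp only [LinearMap.add_apply, LinearMap.sub_apply, LinearMap.comp_apply, LinearMap.id_apply,
    LinearMap.smulRight_apply, topCoeff_bimon, ← not_free_iff nil ha hb]
  have hD := diffl_bimon hx.toIsQAffine hξ.toIsQAffine
  have hval : ∀ i, htpy hx hξ (bimon K x ξ (a + Pi.single i 1) (b + Pi.single i 1)) =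
      if Adm nil (a + Pi.single i 1) ∧ Adm (fun i => ¬ nil i) (b + Pi.single i 1) then
        htpyFun c c' nil x ξ (a + Pi.single i 1) (b + Pi.single i 1) else 0 := fun i => by
    split_ifs with h
    · exact htpy_bimon hx hξ h.1 h.2
    · rw [bimon_eq_zero hx hξ h, map_zero]
  rw [htpy_bimon hx hξ ha hb, hD]
  by_cases h : ∃ i, Free nil a b i
  swap
  · obtain ⟨rfl, rfl⟩ := (not_free_iff nil ha hb).1 h
    rw [htpyFun_of_not_free h, if_pos h, ← hD, diffl_top hx hξ]
    simp
  rw [if_neg (not_not.2 h), zero_smul, sub_zero]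
  have hbase := htpyFun_add (𝒜 := 𝒜) (𝒮 := 𝒮) (c := c) (c' := c') (x := x) (ξ := ξ) h 0
    (add_zero a).symm (add_zero b).symm
  have hshift := fun j => htpyFun_add (𝒜 := 𝒜) (𝒮 := 𝒮) (c := c) (c' := c') (x := x) (ξ := ξ) h
    (Pi.single j 1) (a' := a + Pi.single j 1) (b' := b + Pi.single j 1) rfl rfl
  have hi : Free nil a b h.choose := h.choose_spec
  generalize h.choose = i at hbase hshift hi
  rw [hbase, map_sum]
  simp only [map_smul, hval, hshift]
  by_cases hup : 1 ≤ a i ∧ 1 ≤ b i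
  · -- the upper end of an edge in direction `i`
    obtain ⟨a', rfl⟩ : ∃ a', a = a' + Pi.single i 1 := ⟨a - Pi.single i 1, by
      rw [tsub_add_cancel_of_le]
      intro j
      by_cases hj : j = i
      · subst hj; simpa using hup.1
      · simp [hj]⟩
    obtain ⟨b', rfl⟩ : ∃ b', b = b' + Pi.single i 1 := ⟨b - Pi.single i 1, by
      rw [tsub_add_cancel_of_le]
      intro j
      by_cases hj : j = i
      · subst hj; simpa using hup.2
      · simp [hj]⟩
    rw [if_pos hup]
    simp only [add_tsub_cancel_right, map_smul, hD, Finset.smul_sum]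
    rw [← Finset.sum_add_distrib]
    refine (Finset.sum_eq_single i ?_ (by simp)).trans ?_
    · intro j _ hj
      have hcond : (1 ≤ (a' + Pi.single i 1 + Pi.single j 1 : Fin d → ℕ) i ∧
          1 ≤ (b' + Pi.single i 1 + Pi.single j 1 : Fin d → ℕ) i) := by
        simp only [Pi.add_apply, Pi.single_eq_same]
        omega
      rw [if_pos hcond]
      have ea : a' + Pi.single i 1 + Pi.single j 1 - Pi.single i 1 = a' + Pi.single j 1 := by
        rw [add_right_comm, add_tsub_cancel_right]
      have eb : b' + Pi.single i 1 + Pi.single j 1 - Pi.single i 1 = b' + Pi.single j 1 := by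
        rw [add_right_comm, add_tsub_cancel_right]
      rw [ea, eb]
      -- Admissibility in coordinate `j` is not affected by the step in direction `i`, so
      -- corresponding terms of the two sums vanish simultaneously.
      have hadm : (Adm nil (a' + Pi.single i 1 + Pi.single j 1) ∧
          Adm (fun i => ¬ nil i) (b' + Pi.single i 1 + Pi.single j 1)) ↔
          (Adm nil (a' + Pi.single j 1) ∧ Adm (fun i => ¬ nil i) (b' + Pi.single j 1)) := by
        constructor
        · rintro ⟨h1, h2⟩
          exact ⟨h1.of_le (by rw [add_right_comm]; exact le_self_add),
            h2.of_le (by rw [add_right_comm]; exact le_self_add)⟩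
        · rintro ⟨h1, h2⟩
          constructor
          · intro k hk
            by_cases hkj : k = j
            · subst hkj; simpa [hj] using h1 k hk
            · simpa [hkj] using ha k hk
          · intro k hk
            by_cases hkj : k = j
            · subst hkj; simpa [hj] using h2 k hk
            · simpa [hkj] using hb k hk
      by_cases hA : Adm nil (a' + Pi.single j 1) ∧ Adm (fun i => ¬ nil i) (b' + Pi.single j 1)
      · rw [if_pos (hadm.2 hA), smul_smul, smul_smul, ← add_smul]
        have hs := dcoef_swap hx.inv hξ.inv hcc' (Ne.symm hj) a' b'
        have n1 := dcoef_ne_zero hx.inv hξ.inv i a' b'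
        have n2 := dcoef_ne_zero hx.inv hξ.inv i (a' + Pi.single j 1) (b' + Pi.single j 1)
        convert zero_smul K _
        field_simp
        linear_combination hs
      · rw [if_neg (fun h => hA (hadm.1 h)), bimon_eq_zero hx hξ hA]
        simp
    · rw [if_neg, smul_zero, add_zero, smul_smul,
        inv_mul_cancel₀ (dcoef_ne_zero hx.inv hξ.inv i a' b'), one_smul]
      rintro ⟨h1, h2⟩
      by_cases hn : nil i
      · have := h1 i hn; simp at this
      · have := h2 i hn; simp at this
  · rw [if_neg hup, map_zero, zero_add]
    refine (Finset.sum_eq_single i ?_ (by simp)).trans ?_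
    · intro j _ hj
      rw [if_neg (c := 1 ≤ (a + Pi.single j 1 : Fin d → ℕ) i ∧
        1 ≤ (b + Pi.single j 1 : Fin d → ℕ) i)]
      · simp
      · simpa [Ne.symm hj] using hup
    -- A lower end does have an upper neighbour: the only obstruction would be exponents `1` and `0`
    -- in coordinate `i`, as in the generator, and freeness of `i` excludes this.
    · have hA : Adm nil (a + Pi.single i 1) ∧ Adm (fun i => ¬ nil i) (b + Pi.single i 1) := by
        constructor
        · intro k hk
          by_cases hki : k = i
          · have h1 := ha k hk
            rw [hki] at hk h1 ⊢
            simp only [Free, hk, true_and, not_true_eq_false, false_and, or_false] at hi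
            simp only [Pi.add_apply, Pi.single_eq_same]
            omega
          · simpa [hki] using ha k hk
        · intro k hk
          by_cases hki : k = i
          · have h1 := hb k hk
            rw [hki] at hk h1 ⊢
            simp only [Free, hk, true_and, not_false_eq_true, false_and, false_or] at hi
            simp only [Pi.add_apply, Pi.single_eq_same]
            omega
          · simpa [hki] using hb k hk
      rw [if_pos hA, if_pos (by simp)]
      simp only [add_tsub_cancel_right]
      rw [smul_smul, mul_inv_cancel₀ (dcoef_ne_zero hx.inv hξ.inv i a b), one_smul]

end KoszulCohomology

/-! ### Super coactions on quadratic algebras -/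

section Coaction

variable {K : Type*} [Field K] {d : ℕ}

/-- The quadratic relations `∑ P^{kl}_{ij} y_k y_l = μ y_i y_j`. -/
def QuadraticRel {𝓑 : Type*} [Ring 𝓑] [Algebra K 𝓑] (P : Fin d → Fin d → Fin d → Fin d → K)
    (μ : K) (y : Fin d → 𝓑) : Prop :=
  ∀ i j, ∑ k, ∑ l, P k l i j • (y k * y l) = μ • (y i * y j)

variable {𝒜 : Type*} [Ring 𝒜] [Algebra K 𝒜]

/-- `𝒜` is presented by the generators `y_i` and the quadratic relations given by `P` and `μ`, as
far as homomorphisms to algebras in a fixed universe are concerned. -/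
structure IsQuadraticAlgebra.{w} (P : Fin d → Fin d → Fin d → Fin d → K) (μ : K)
    (y : Fin d → 𝒜) : Prop where
  rel : QuadraticRel P μ y
  gen : Algebra.adjoin K (Set.range y) = ⊤
  lift : ∀ {𝓑 : Type w} [Ring 𝓑] [Algebra K 𝓑] (y' : Fin d → 𝓑), QuadraticRel P μ y' →
    ∃ f : 𝒜 →ₐ[K] 𝓑, ∀ i, f (y i) = y' i

/-- The parity automorphism of a super algebra with homogeneous generators. -/
structure IsParityAut (par : Fin d → ℕ) (y : Fin d → 𝒜) (σ : 𝒜 →ₐ[K] 𝒜) : Prop where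
  apply_gen : ∀ i, σ (y i) = (-1 : K) ^ par i • y i
  sq : σ * σ = 1

variable {P : Fin d → Fin d → Fin d → Fin d → K} {μ : K} {y : Fin d → 𝒜} {par : Fin d → ℕ}
  {σ : 𝒜 →ₐ[K] 𝒜}

/-- The quadratic relations are homogeneous for parity because `P` preserves pairs, so the signed
generators satisfy them again. -/
theorem IsQuadraticAlgebra.exists_parityAut.{w} {𝒜 : Type w} [Ring 𝒜] [Algebra K 𝒜]
    {y : Fin d → 𝒜} (h : IsQuadraticAlgebra.{_, w, w} P μ y) (hP : PreservesPairs P)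
    (par : Fin d → ℕ) :
    ∃ σ : 𝒜 →ₐ[K] 𝒜, IsParityAut par y σ := by
  have hrel : QuadraticRel P μ fun i => (-1 : K) ^ par i • y i := by
    intro i j
    have := congrArg (fun v => (-1 : K) ^ (par i + par j) • v) (h.rel i j)
    simp only [Finset.smul_sum, smul_comm _ (P _ _ _ _)] at this
    simp only [smul_mul_smul_comm, ← pow_add]
    rw [smul_comm, ← this]
    refine Finset.sum_congr rfl fun k _ => Finset.sum_congr rfl fun l _ => ?_
    refine hP.smul_congr ?_ ?_
    · rintro rfl rfl; rfl
    · rintro rfl rfl; rw [add_comm]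
  obtain ⟨σ, hσ⟩ := h.lift _ hrel
  refine ⟨σ, hσ, AlgHom.ext_of_adjoin_eq_top h.gen ?_⟩
  rintro _ ⟨i, rfl⟩
  simp [hσ, smul_smul, ← mul_pow]

theorem IsParityAut.pow_apply_gen (hσ : IsParityAut par y σ) (k : ℕ) (i : Fin d) :
    (σ ^ k) (y i) = (-1 : K) ^ (k * par i) • y i := by
  induction k with
  | zero => simp
  | succ k ih =>
    rw [pow_succ, AlgHom.mul_apply, hσ.apply_gen, map_smul, ih, smul_smul, ← pow_add]
    congr 2; ring

theorem IsParityAut.pow_congr (hσ : IsParityAut par y σ) {a b : ℕ} (h : (a : ZMod 2) = b) :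
    σ ^ a = σ ^ b := by
  rw [ZMod.natCast_eq_natCast_iff] at h
  have key : ∀ n, σ ^ n = σ ^ (n % 2) := fun n => by
    conv_lhs => rw [← Nat.div_add_mod n 2]
    rw [pow_add, pow_mul, pow_two, hσ.sq, one_pow, one_mul]
  rw [key a, key b, h]

theorem IsParityAut.pow_word (hσ : IsParityAut par y σ) (k : ℕ) {n : ℕ} (f : Fin n → Fin d) :
    (σ ^ k) (List.ofFn fun u => y (f u)).prod =
      (-1 : K) ^ (k * ∑ u, par (f u)) • (List.ofFn fun u => y (f u)).prod := by
  induction n with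
  | zero => simp
  | succ n ih =>
    rw [List.ofFn_succ, List.prod_cons, map_mul, ih (fun u => f u.succ), hσ.pow_apply_gen,
      smul_mul_smul_comm, ← pow_add, Fin.sum_univ_succ, mul_add]

variable {N : Type*} [AddCommGroup N] [Module K N]

/-- The operator `∑ j, y_j ⊗ u_{ji}` on `𝒜 ⊗ N`, with the super sign rule. -/
def coactGen (par : Fin d → ℕ) (y : Fin d → 𝒜) (σ : 𝒜 →ₐ[K] 𝒜)
    (u : Matrix (Fin d) (Fin d) (Module.End K N)) (i : Fin d) : Module.End K (𝒜 ⊗[K] N) :=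
  ∑ j, TensorProduct.map (LinearMap.mulLeft K (y j) ∘ₗ (σ ^ (par i + par j)).toLinearMap) (u j i)

theorem coactGen_tmul (u : Matrix (Fin d) (Fin d) (Module.End K N)) (i : Fin d) (v : 𝒜) (n : N) :
    coactGen par y σ u i (v ⊗ₜ n) =
      ∑ j, (y j * (σ ^ (par i + par j)) v) ⊗ₜ[K] (u j i n) := by
  simp [coactGen, LinearMap.sum_apply]

theorem coactGen_coactGen_tmul (hσ : IsParityAut par y σ)
    (u : Matrix (Fin d) (Fin d) (Module.End K N)) (i j : Fin d) (v : 𝒜) (n : N) :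
    coactGen par y σ u i (coactGen par y σ u j (v ⊗ₜ n)) =
      ∑ a, ∑ b, (y a * y b * (σ ^ (par i + par j + (par a + par b))) v) ⊗ₜ[K]
        (superSquare K par u a b i j n) := by
  rw [coactGen_tmul, map_sum]
  simp only [coactGen_tmul]
  rw [Finset.sum_comm]
  refine Finset.sum_congr rfl fun a _ => Finset.sum_congr rfl fun b _ => ?_
  rw [map_mul, hσ.pow_apply_gen, ← AlgHom.mul_apply, ← pow_add, superSquare, LinearMap.smul_apply,
    smul_mul_assoc, mul_smul_comm, TensorProduct.smul_tmul, mul_assoc, Module.End.mul_apply]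
  congr 3
  · rw [add_add_add_comm]
  · rw [mul_comm]

/-- Moving `P` through the products `u u` by the intertwining relation turns it into `P` acting on
the products `y y`, where the relation of `𝒜` applies. The powers of `σ` are not disturbed, since
`P` preserves total parity. By the universal property of `𝒜` the coaction is then an algebra
homomorphism into operators on `𝒜 ⊗ N`, which avoids super tensor products of algebras. -/
theorem quadraticRel_coactGen (hP : PreservesPairs P) (h : QuadraticRel P μ y)
    (hσ : IsParityAut par y σ) {u : Matrix (Fin d) (Fin d) (Module.End K N)}
    (hu : IsQuantumSuperMatrix par P u) : QuadraticRel P μ (coactGen par y σ u) := by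
  rw [isQuantumSuperMatrix_iff] at hu
  intro i j
  refine TensorProduct.ext' fun v n => ?_
  simp only [LinearMap.sum_apply, LinearMap.smul_apply, Module.End.mul_apply,
    coactGen_coactGen_tmul hσ, Finset.smul_sum]
  have e1 : ∀ k l, (∑ a, ∑ b, P k l i j •
      ((y a * y b * (σ ^ (par k + par l + (par a + par b))) v) ⊗ₜ[K]
        (superSquare K par u a b k l n))) =
      ∑ a, ∑ b, (y a * y b * (σ ^ (par i + par j + (par a + par b))) v) ⊗ₜ[K]
        ((P k l i j • superSquare K par u a b k l) n) := fun k l => by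
    refine Finset.sum_congr rfl fun a _ => Finset.sum_congr rfl fun b _ => ?_
    rw [LinearMap.smul_apply, TensorProduct.tmul_smul]
    refine hP.smul_congr (M := 𝒜 ⊗[K] N) ?_ ?_
    · rintro rfl rfl; rfl
    · rintro rfl rfl; rw [add_comm (par k)]
  have e2 : ∀ a b, (∑ k, ∑ l, (y a * y b * (σ ^ (par i + par j + (par a + par b))) v) ⊗ₜ[K]
        ((P k l i j • superSquare K par u a b k l) n)) =
      ∑ k, ∑ l, ((P a b k l • (y a * y b)) * (σ ^ (par i + par j + (par k + par l))) v) ⊗ₜ[K]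
        (superSquare K par u k l i j n) := fun a b => by
    simp only [← TensorProduct.tmul_sum, ← LinearMap.sum_apply]
    rw [← hu a b i j]
    simp only [LinearMap.sum_apply, TensorProduct.tmul_sum]
    refine Finset.sum_congr rfl fun k _ => Finset.sum_congr rfl fun l _ => ?_
    rw [LinearMap.smul_apply, TensorProduct.tmul_smul, smul_mul_assoc, ← TensorProduct.smul_tmul']
    refine hP.smul_congr (M := 𝒜 ⊗[K] N) ?_ ?_
    · rintro rfl rfl; rfl
    · rintro rfl rfl; rw [add_comm (par a)]
  simp only [e1]
  have swap : ∀ F : Fin d → Fin d → Fin d → Fin d → 𝒜 ⊗[K] N,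
      ∑ k, ∑ l, ∑ a, ∑ b, F k l a b = ∑ a, ∑ b, ∑ k, ∑ l, F k l a b := fun F => by
    simpa only [Fintype.sum_prod_type] using Finset.sum_comm (s := Finset.univ)
      (t := Finset.univ) (f := fun x z : Fin d × Fin d => F x.1 x.2 z.1 z.2)
  rw [swap]
  simp only [e2]
  rw [swap (fun a b k l => _)]
  simp only [← TensorProduct.sum_tmul, ← Finset.sum_mul, h _ _]
  simp only [smul_mul_assoc, TensorProduct.smul_tmul']

theorem sum_fin_cons {X M : Type*} [Fintype X] [AddCommMonoid M] {k : ℕ}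
    (F : (Fin (k + 1) → X) → M) :
    ∑ c, F c = ∑ j, ∑ c : Fin k → X, F (Fin.cons j c) := by
  rw [← (Fin.consEquiv fun _ : Fin (k + 1) => X).sum_comp, Fintype.sum_prod_type]
  rfl

/-- The sign exponent of a product of generators of a comodule algebra. -/
def wordSign (par : Fin d → ℕ) {k : ℕ} (c a : Fin k → Fin d) : ℕ :=
  ∑ u, ∑ v, if u < v then (par (a u) + par (c u)) * par (c v) else 0

theorem wordSign_cons (par : Fin d → ℕ) {k : ℕ} (j : Fin d) (c : Fin k → Fin d)
    (a : Fin (k + 1) → Fin d) : wordSign par (Fin.cons j c) a =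
      (par (a 0) + par j) * ∑ u, par (c u) + wordSign par c (fun u => a u.succ) := by
  simp [wordSign, Fin.sum_univ_succ, Finset.mul_sum]

/-- The coaction on `𝒜 ⊗ N` that is determined by its values on the generators. -/
def coact (f : 𝒜 →ₐ[K] Module.End K (𝒜 ⊗[K] N)) : 𝒜 ⊗[K] N →ₗ[K] 𝒜 ⊗[K] N :=
  TensorProduct.lift (LinearMap.lcomp K _ (TensorProduct.mk K 𝒜 N 1) ∘ₗ f.toLinearMap)

theorem coact_tmul (f : 𝒜 →ₐ[K] Module.End K (𝒜 ⊗[K] N)) (v : 𝒜) (n : N) :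
    coact f (v ⊗ₜ n) = f v (1 ⊗ₜ n) := rfl

theorem coact_word (hσ : IsParityAut par y σ) {u : Matrix (Fin d) (Fin d) (Module.End K N)}
    {f : 𝒜 →ₐ[K] Module.End K (𝒜 ⊗[K] N)} (hf : ∀ i, f (y i) = coactGen par y σ u i) {k : ℕ}
    (a : Fin k → Fin d) (n : N) :
    coact f ((List.ofFn fun s => y (a s)).prod ⊗ₜ n) =
      ∑ c : Fin k → Fin d, (-1 : K) ^ wordSign par c a •
        ((List.ofFn fun s => y (c s)).prod ⊗ₜ[K] (List.ofFn fun s => u (c s) (a s)).prod n) := by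
  simp only [coact_tmul]
  induction k with
  | zero => simp [wordSign]
  | succ k ih =>
    rw [List.ofFn_succ, List.prod_cons, map_mul, Module.End.mul_apply, ih (fun s => a s.succ), hf,
      map_sum, sum_fin_cons, Finset.sum_comm]
    refine Finset.sum_congr rfl fun c _ => ?_
    rw [map_smul, coactGen_tmul, Finset.smul_sum]
    refine Finset.sum_congr rfl fun j _ => ?_
    rw [hσ.pow_word, wordSign_cons, List.ofFn_succ, List.ofFn_succ]
    simp only [Fin.cons_zero, Fin.cons_succ, List.prod_cons, Module.End.mul_apply]
    rw [mul_smul_comm, ← TensorProduct.smul_tmul', smul_smul, ← pow_add, add_comm]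

end Coaction

/-! ### The coaction on the Koszul complex -/

section KoszulCoaction

variable {K : Type*} [Field K] {d : ℕ} {L : Type*} [Ring L] [Algebra K L]

theorem IsQuantumSuperMatrix.map {L' : Type*} [Ring L'] [Algebra K L'] {par : Fin d → ℕ}
    {P : Fin d → Fin d → Fin d → Fin d → K} {Z : Matrix (Fin d) (Fin d) L}
    (h : IsQuantumSuperMatrix par P Z) (φ : L →ₐ[K] L') :
    IsQuantumSuperMatrix par P (Z.map φ) := fun k l i j => by
  simpa using congrArg φ (h k l i j)

variable {𝒜 𝒮 : Type*} [Ring 𝒜] [Algebra K 𝒜] [Ring 𝒮] [Algebra K 𝒮]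
  {P : Fin d → Fin d → Fin d → Fin d → K} {par : Fin d → ℕ}
  {x : Fin d → 𝒜} {ξ : Fin d → 𝒮} {σ : 𝒜 →ₐ[K] 𝒜} {τ : 𝒮 →ₐ[K] 𝒮}

/-- The entries of a matrix over `L` acting on `L` by left multiplication. -/
def leftMatrix (K : Type*) [Field K] [Algebra K L] (U : Matrix (Fin d) (Fin d) L) :
    Matrix (Fin d) (Fin d) (Module.End K L) := U.map (Algebra.lmul K L)

/-- The entries of a super matrix over `L` acting on `𝒮 ⊗ L`, with the super sign rule. -/
def twistedMatrix (par : Fin d → ℕ) (τ : 𝒮 →ₐ[K] 𝒮) (Z : Matrix (Fin d) (Fin d) L) :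
    Matrix (Fin d) (Fin d) (Module.End K (𝒮 ⊗[K] L)) :=
  Matrix.of fun j i =>
    TensorProduct.map (τ ^ (par i + par j)).toLinearMap (Algebra.lmul K L (Z j i))

theorem twistedMatrix_tmul (Z : Matrix (Fin d) (Fin d) L) (j i : Fin d) (s : 𝒮) (h : L) :
    twistedMatrix par τ Z j i (s ⊗ₜ h) = ((τ ^ (par i + par j)) s) ⊗ₜ[K] (Z j i * h) := rfl

theorem leftMatrix_word (U : Matrix (Fin d) (Fin d) L) {k : ℕ} (c a : Fin k → Fin d) (h : L) :
    (List.ofFn fun s => leftMatrix K U (c s) (a s)).prod h =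
      (List.ofFn fun s => U (c s) (a s)).prod * h := by
  have : (List.ofFn fun s => leftMatrix K U (c s) (a s)).prod =
      Algebra.lmul K L (List.ofFn fun s => U (c s) (a s)).prod := by
    rw [map_list_prod, List.map_ofFn]; rfl
  rw [this]; rfl

theorem twistedMatrix_word (Z : Matrix (Fin d) (Fin d) L) {k : ℕ} (c a : Fin k → Fin d) (s : 𝒮)
    (h : L) : (List.ofFn fun u => twistedMatrix par τ Z (c u) (a u)).prod (s ⊗ₜ h) =
      ((τ ^ (∑ u, (par (a u) + par (c u)))) s) ⊗ₜ[K]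
        ((List.ofFn fun u => Z (c u) (a u)).prod * h) := by
  induction k with
  | zero => simp
  | succ k ih =>
    rw [List.ofFn_succ, List.prod_cons, Module.End.mul_apply, ih (fun u => c u.succ),
      twistedMatrix_tmul, ← AlgHom.mul_apply, ← pow_add, List.ofFn_succ, List.prod_cons,
      mul_assoc, Fin.sum_univ_succ]

/-- The powers of `τ` in a product of two entries add up to the total parity of the four indices, so
on the terms occurring in the relations they are constant and only the relations for `Z` remain. -/
theorem isQuantumSuperMatrix_twistedMatrix (hP : PreservesPairs P)
    {Z : Matrix (Fin d) (Fin d) L} (hZ : IsQuantumSuperMatrix par P Z) :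
    IsQuantumSuperMatrix par P (twistedMatrix par τ Z) := by
  rw [isQuantumSuperMatrix_iff] at hZ ⊢
  have key : ∀ k l i j (s : 𝒮) (h : L),
      superSquare K par (twistedMatrix par τ Z) k l i j (s ⊗ₜ h) =
      ((τ ^ (par i + par j + (par k + par l))) s) ⊗ₜ[K] (superSquare K par Z k l i j * h) := by
    intro k l i j s h
    rw [superSquare, LinearMap.smul_apply, Module.End.mul_apply, twistedMatrix_tmul,
      twistedMatrix_tmul, ← AlgHom.mul_apply, ← pow_add, superSquare, smul_mul_assoc,
      TensorProduct.tmul_smul, mul_assoc, add_add_add_comm]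
  intro k l i j
  refine TensorProduct.ext' fun s h => ?_
  simp only [LinearMap.sum_apply, LinearMap.smul_apply, key]
  have := congrArg (fun g => ((τ ^ (par i + par j + (par k + par l))) s) ⊗ₜ[K] (g * h))
    (hZ k l i j)
  simp only [Finset.sum_mul, TensorProduct.tmul_sum, smul_mul_assoc,
    TensorProduct.tmul_smul] at this
  refine Eq.trans ?_ (this.trans ?_)
  · refine Finset.sum_congr rfl fun a _ => Finset.sum_congr rfl fun b _ => ?_
    refine hP.smul_congr (M := 𝒮 ⊗[K] L) ?_ ?_
    · rintro rfl rfl; rfl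
    · rintro rfl rfl; rw [add_comm (par k)]
  · refine Finset.sum_congr rfl fun a _ => Finset.sum_congr rfl fun b _ => ?_
    refine hP.smul_congr (M := 𝒮 ⊗[K] L) ?_ ?_
    · rintro rfl rfl; rfl
    · rintro rfl rfl; rw [add_comm (par a)]

/-- The homomorphisms that define the coaction of a super matrix `Z` on `𝒜`, and of a super matrix
`t` of the dual type on `𝒮`. -/
structure IsKoszulCoaction (par : Fin d → ℕ) (x : Fin d → 𝒜) (ξ : Fin d → 𝒮) (σ : 𝒜 →ₐ[K] 𝒜)
    (τ : 𝒮 →ₐ[K] 𝒮) (Z t : Matrix (Fin d) (Fin d) L)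
    (f : 𝒜 →ₐ[K] Module.End K (𝒜 ⊗[K] (𝒮 ⊗[K] L))) (g : 𝒮 →ₐ[K] Module.End K (𝒮 ⊗[K] L)) :
    Prop where
  left : ∀ i, f (x i) = coactGen par x σ (twistedMatrix par τ Z) i
  right : ∀ i, g (ξ i) = coactGen par ξ τ (leftMatrix K t.transpose) i

/-- The coaction on the Koszul complex. -/
def koszulG (f : 𝒜 →ₐ[K] Module.End K (𝒜 ⊗[K] (𝒮 ⊗[K] L)))
    (g : 𝒮 →ₐ[K] Module.End K (𝒮 ⊗[K] L)) :
    𝒜 ⊗[K] (𝒮 ⊗[K] L) →ₗ[K] 𝒜 ⊗[K] (𝒮 ⊗[K] L) :=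
  coact f ∘ₗ (coact g).lTensor 𝒜

variable {Z t : Matrix (Fin d) (Fin d) L} {f : 𝒜 →ₐ[K] Module.End K (𝒜 ⊗[K] (𝒮 ⊗[K] L))}
  {g : 𝒮 →ₐ[K] Module.End K (𝒮 ⊗[K] L)}

/-- The signs gathered from `σ`, from `τ` and within the two words add up to exactly `signExponent`;
this identifies the operator with the coaction prescribed on words. -/
theorem koszulG_word (hσ : IsParityAut par x σ) (hτ : IsParityAut par ξ τ)
    (H : IsKoszulCoaction par x ξ σ τ Z t f g) {k l : ℕ} (a : Fin k → Fin d) (b : Fin l → Fin d)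
    (h : L) : koszulG f g ((List.ofFn fun u => x (a u)).prod ⊗ₜ
        ((List.ofFn fun v => ξ (b v)).prod ⊗ₜ h)) =
      ∑ w' : Word d k l, (-1 : K) ^ signExponent par w' (a, b) •
        ((List.ofFn fun u => x (w'.1 u)).prod ⊗ₜ[K] ((List.ofFn fun v => ξ (w'.2 v)).prod ⊗ₜ[K]
          ((List.ofFn fun u => Z (w'.1 u) (a u)).prod *
            ((List.ofFn fun v => t (b v) (w'.2 v)).prod * h)))) := by
  rw [koszulG, LinearMap.comp_apply, LinearMap.lTensor_tmul, coact_word hτ H.right,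
    TensorProduct.tmul_sum, map_sum, Fintype.sum_prod_type, Finset.sum_comm]
  refine Finset.sum_congr rfl fun e _ => ?_
  rw [TensorProduct.tmul_smul, map_smul, coact_word hσ H.left, Finset.smul_sum]
  refine Finset.sum_congr rfl fun c _ => ?_
  rw [leftMatrix_word, twistedMatrix_word, hτ.pow_word, ← TensorProduct.smul_tmul',
    TensorProduct.tmul_smul, smul_smul, smul_smul, ← pow_add, ← pow_add]
  congr 2
  rw [signExponent, Finset.sum_mul]
  simp only [Finset.mul_sum, wordSign]
  ring

/-- The Koszul differential on `𝒜 ⊗ (𝒮 ⊗ L)`. -/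
def diffl' (L : Type*) [Ring L] [Algebra K L] (x : Fin d → 𝒜) (ξ : Fin d → 𝒮) :
    𝒜 ⊗[K] (𝒮 ⊗[K] L) →ₗ[K] 𝒜 ⊗[K] (𝒮 ⊗[K] L) :=
  ∑ i, TensorProduct.map (LinearMap.mulRight K (x i))
    ((LinearMap.mulLeft K (ξ i)).rTensor L)

theorem diffl'_tmul (v : 𝒜) (s : 𝒮) (h : L) : diffl' L x ξ (v ⊗ₜ (s ⊗ₜ h)) =
    ∑ i, (v * x i) ⊗ₜ[K] ((ξ i * s) ⊗ₜ[K] h) := by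
  simp [diffl', LinearMap.sum_apply]

/-- The differential multiplies on the inner sides, by `x_k` on the right and `ξ^k` on the left.
Passing an entry of `Z` across them gives the same sign twice, once through `σ` and once through
`τ`. -/
theorem diffl'_comp_coactGen (hσ : IsParityAut par x σ) (hτ : IsParityAut par ξ τ) (i : Fin d)
    (w : 𝒜 ⊗[K] (𝒮 ⊗[K] L)) :
    diffl' L x ξ (coactGen par x σ (twistedMatrix par τ Z) i w) =
      coactGen par x σ (twistedMatrix par τ Z) i (diffl' L x ξ w) := by
  have : diffl' L x ξ ∘ₗ coactGen par x σ (twistedMatrix par τ Z) i =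
      coactGen par x σ (twistedMatrix par τ Z) i ∘ₗ diffl' L x ξ := by
    refine TensorProduct.ext' fun v n => ?_
    induction n with
    | zero => simp
    | add n n' hn hn' => rw [TensorProduct.tmul_add, map_add, map_add, hn, hn']
    | tmul s h =>
      simp only [LinearMap.comp_apply, coactGen_tmul, map_sum, twistedMatrix_tmul, diffl'_tmul]
      rw [Finset.sum_comm]
      refine Finset.sum_congr rfl fun k _ => Finset.sum_congr rfl fun j _ => ?_
      rw [map_mul, map_mul, hσ.pow_apply_gen, hτ.pow_apply_gen, mul_smul_comm, smul_mul_assoc,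
        mul_smul_comm, ← TensorProduct.smul_tmul', ← TensorProduct.smul_tmul',
        TensorProduct.tmul_smul, smul_smul, ← mul_pow]
      simp [mul_assoc]
  exact LinearMap.congr_fun this w

/-- This is the invariance of the canonical element `∑ x_i ⊗ ξ^i`: after the signs are separated,
the sum over `i` is an entry of the product of `Z` with its inverse. -/
theorem sum_coactGen_one (hτ : IsParityAut par ξ τ)
    (hZt : ∀ i j, ∑ k, (-1 : K) ^ (par i * (par k + 1)) • (Z j k * t k i) =
      if i = j then 1 else 0) (n : 𝒮 ⊗[K] L) :
    ∑ i, coactGen par x σ (twistedMatrix par τ Z) i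
      (1 ⊗ₜ coactGen par ξ τ (leftMatrix K t.transpose) i n) = diffl' L x ξ (1 ⊗ₜ n) := by
  induction n with
  | zero => simp
  | add n n' hn hn' => simp only [TensorProduct.tmul_add, map_add, Finset.sum_add_distrib, hn, hn']
  | tmul s h =>
    have e : ∀ i, coactGen par x σ (twistedMatrix par τ Z) i
        (1 ⊗ₜ coactGen par ξ τ (leftMatrix K t.transpose) i (s ⊗ₜ h)) =
        ∑ k, ∑ j, x j ⊗ₜ[K] ((ξ k * (τ ^ (par j + par k)) s) ⊗ₜ[K]
          (((-1 : K) ^ (par k * (par j + 1)) • (-1 : K) ^ (par k * (par i + 1)) •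
            (Z j i * t i k)) * h)) := by
      intro i
      rw [coactGen_tmul (leftMatrix K t.transpose) i s h, TensorProduct.tmul_sum, map_sum]
      refine Finset.sum_congr rfl fun k _ => ?_
      rw [coactGen_tmul]
      refine Finset.sum_congr rfl fun j _ => ?_
      rw [map_one, mul_one, twistedMatrix_tmul, map_mul, hτ.pow_apply_gen, ← AlgHom.mul_apply,
        ← pow_add, smul_mul_assoc, smul_smul, ← pow_add, smul_mul_assoc, TensorProduct.tmul_smul,
        TensorProduct.smul_tmul', mul_assoc]
      have h1 : τ ^ (par i + par j + (par i + par k)) = τ ^ (par j + par k) := by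
        apply hτ.pow_congr
        push_cast
        generalize (par i : ZMod 2) = a
        generalize (par j : ZMod 2) = b
        generalize (par k : ZMod 2) = c
        revert a b c
        decide
      have h2 : (-1 : K) ^ ((par i + par j) * par k) =
          (-1 : K) ^ (par k * (par j + 1) + par k * (par i + 1)) := by
        apply neg_one_pow_congr_zmod
        push_cast
        generalize (par i : ZMod 2) = a
        generalize (par j : ZMod 2) = b
        generalize (par k : ZMod 2) = c
        revert a b c
        decide
      rw [h1, h2]
      rfl
    simp only [e]
    rw [Finset.sum_comm, diffl'_tmul]
    refine Finset.sum_congr rfl fun k _ => ?_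
    rw [Finset.sum_comm]
    simp only [← TensorProduct.tmul_sum, ← Finset.sum_mul, ← Finset.smul_sum, hZt]
    rw [Finset.sum_eq_single k]
    · rw [if_pos rfl, one_mul, neg_one_pow_congr_zmod (b := 0), pow_zero, one_smul, one_mul,
        hτ.pow_congr (b := 0), pow_zero]
      · rfl
      · push_cast
        generalize (par k : ZMod 2) = c
        revert c
        decide
      · push_cast
        generalize (par k : ZMod 2) = c
        revert c
        decide
    · intro j _ hj
      rw [if_neg (Ne.symm hj)]
      simp
    · simp

/-- The operators `f v` commute with the differential, since those of the generators do. This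
reduces the claim to `v = 1`, where it is the invariance of the canonical element. -/
theorem koszulG_diffl' (hσ : IsParityAut par x σ) (hτ : IsParityAut par ξ τ)
    (hx : Algebra.adjoin K (Set.range x) = ⊤)
    (H : IsKoszulCoaction par x ξ σ τ Z t f g)
    (hZt : ∀ i j, ∑ k, (-1 : K) ^ (par i * (par k + 1)) • (Z j k * t k i) =
      if i = j then 1 else 0) (w : 𝒜 ⊗[K] (𝒮 ⊗[K] L)) :
    koszulG f g (diffl' L x ξ w) = diffl' L x ξ (koszulG f g w) := by
  have hcomm : ∀ v w, diffl' L x ξ (f v w) = f v (diffl' L x ξ w) := by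
    intro v w
    have hv : v ∈ Algebra.adjoin K (Set.range x) := by rw [hx]; trivial
    induction hv using Algebra.adjoin_induction generalizing w with
    | mem v hv => obtain ⟨i, rfl⟩ := hv; rw [H.left, diffl'_comp_coactGen hσ hτ]
    | algebraMap r => simp [Algebra.algebraMap_eq_smul_one]
    | add v v' _ _ hv hv' => simp [hv, hv']
    | mul v v' _ _ hv hv' => simp [hv, hv']
  suffices h : koszulG f g ∘ₗ diffl' L x ξ = diffl' L x ξ ∘ₗ koszulG f g from
    LinearMap.congr_fun h w
  refine TensorProduct.ext' fun v n => ?_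
  induction n with
  | zero => simp
  | add n n' hn hn' => rw [TensorProduct.tmul_add, map_add, map_add, hn, hn']
  | tmul s h =>
    simp only [LinearMap.comp_apply, koszulG, LinearMap.lTensor_tmul, coact_tmul]
    rw [hcomm, ← sum_coactGen_one (σ := σ) hτ hZt, diffl'_tmul]
    simp only [map_sum, LinearMap.lTensor_tmul, coact_tmul, map_mul, Module.End.mul_apply,
      H.left, H.right]

end KoszulCoaction

/-! ### The coefficient of the coaction at the generator of the cohomology -/

section TopCoefficient

variable {K : Type*} [Field K] {d : ℕ} {nil : Fin d → Prop} {c c' : Fin d → Fin d → K}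

theorem wordCount_apply {k : ℕ} (f : Fin k → Fin d) (i : Fin d) :
    wordCount f i = (Finset.univ.filter fun u => f u = i).card := by
  simp [wordCount, Finset.sum_apply, Pi.single_apply, eq_comm]

theorem wordCount_comp_perm {k : ℕ} (f : Fin k → Fin d) (s : Equiv.Perm (Fin k)) :
    wordCount (fun u => f (s u)) = wordCount f :=
  Equiv.sum_comp s fun u => (Pi.single (f u) 1 : Fin d → ℕ)

theorem wordCount_orderEmbedding {k : ℕ} (ι : Fin k ↪o Fin d)
    (hι : ∀ i, nil i ↔ i ∈ Set.range ι) : wordCount ι = topExp nil := by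
  funext i
  rw [wordCount_apply]
  by_cases hi : nil i
  · obtain ⟨u, rfl⟩ := (hι i).1 hi
    simp only [topExp, hi, if_true, ι.injective.eq_iff, Finset.filter_eq', Finset.mem_univ,
      Finset.card_singleton]
  · have : ∀ u, ι u ≠ i := fun u hu => hi ((hι i).2 ⟨u, hu⟩)
    simp [topExp, hi, this]

theorem wordCoef_orderEmbedding {k : ℕ} (ι : Fin k ↪o Fin d) : wordCoef c ι = 1 := by
  refine Finset.prod_eq_one fun u _ => Finset.prod_eq_one fun v _ => if_neg ?_
  rintro ⟨h1, h2⟩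
  exact absurd (ι.lt_iff_lt.1 h2) h1.not_gt

theorem nil_of_wordCount {k : ℕ} {f : Fin k → Fin d} (h : wordCount f = topExp nil) (u : Fin k) :
    nil (f u) := by
  by_contra hn
  have := congrFun h (f u)
  rw [wordCount_apply, topExp, if_neg hn, Finset.card_eq_zero] at this
  exact (Finset.ext_iff.1 this u).1 (by simp) |> Finset.notMem_empty _ |>.elim

theorem injective_of_wordCount {k : ℕ} {f : Fin k → Fin d} (h : wordCount f = topExp nil) :
    Function.Injective f := by
  intro u v huv
  have := congrFun h (f u)
  rw [wordCount_apply, topExp, if_pos (nil_of_wordCount h u), Finset.card_eq_one] at this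
  obtain ⟨w, hw⟩ := this
  have h1 : u = w := by
    have : u ∈ ({w} : Finset (Fin k)) := hw ▸ by simp
    simpa using this
  have h2 : v = w := by
    have : v ∈ ({w} : Finset (Fin k)) := hw ▸ by simp [huv]
    simpa using this
  rw [h1, h2]

open Classical in
/-- A sum over words in which only the rearrangements of a strictly increasing word occur. -/
theorem sum_topWords {M : Type*} [AddCommGroup M] [Module K M] {k : ℕ} (ι : Fin k ↪o Fin d)
    (hι : ∀ i, nil i ↔ i ∈ Set.range ι) (F : (Fin k → Fin d) → M) :
    ∑ f : Fin k → Fin d, (if wordCount f = topExp nil then wordCoef c f else 0) • F f =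
      ∑ s : Equiv.Perm (Fin k),
        (∏ i, ∏ j, if i < j ∧ s j < s i then c (ι (s i)) (ι (s j)) else 1) •
          F fun u => ι (s u) := by
  symm
  refine Finset.sum_of_injOn (fun s u => ι (s u)) ?_ ?_ ?_ ?_
  · intro s _ s' _ h
    ext u
    exact congrArg Fin.val (ι.injective (congrFun h u))
  · intro s _; simp
  · intro f _ hf
    rw [if_neg, zero_smul]
    intro h
    apply hf
    have : ∀ u, ∃ v, ι v = f u := fun u => (hι _).1 (nil_of_wordCount h u)
    choose s hs using this
    have hinj : Function.Injective s := fun u v huv =>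
      injective_of_wordCount h (by rw [← hs, ← hs, huv])
    refine ⟨Equiv.ofBijective s (Finite.injective_iff_bijective.1 hinj), by simp, ?_⟩
    funext u
    exact hs u
  · intro s _
    rw [if_pos]
    · simp only [wordCoef, ι.lt_iff_lt]
    · rw [← wordCount_orderEmbedding ι hι]
      exact wordCount_comp_perm ι s

variable {𝒜 𝒮 : Type*} [Ring 𝒜] [Algebra K 𝒜] [Ring 𝒮] [Algebra K 𝒮]
  {x : Fin d → 𝒜} {ξ : Fin d → 𝒮} {L : Type*} [Ring L] [Algebra K L]

open Classical in
theorem IsQAffinePresentation.coeff_word (h : IsQAffinePresentation c nil x) {k : ℕ}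
    (f : Fin k → Fin d) : h.coeff ⟨_, adm_topExp nil⟩ (List.ofFn fun u => x (f u)).prod =
      if wordCount f = topExp nil then wordCoef c f else 0 := by
  rw [h.prod_word, map_smul, h.coeff_omon, smul_eq_mul, mul_ite, mul_one, mul_zero]

theorem IsQAffine.prod_orderEmbedding (h : IsQAffine c nil x) {k : ℕ} (ι : Fin k ↪o Fin d)
    (hι : ∀ i, nil i ↔ i ∈ Set.range ι) :
    (List.ofFn fun u => x (ι u)).prod = omon x (topExp nil) := by
  rw [h.prod_word, wordCoef_orderEmbedding, wordCount_orderEmbedding ι hι, one_smul]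

/-- The functional `topCoeff` with coefficients in `L`. -/
def topCoeffL (L : Type*) [Ring L] [Algebra K L] (hx : IsQAffinePresentation c nil x)
    (hξ : IsQAffinePresentation c' (fun i => ¬ nil i) ξ) : (𝒜 ⊗[K] 𝒮) ⊗[K] L →ₗ[K] L :=
  (TensorProduct.lid K L).toLinearMap ∘ₗ (topCoeff hx hξ).rTensor L

theorem topCoeffL_tmul (hx : IsQAffinePresentation c nil x)
    (hξ : IsQAffinePresentation c' (fun i => ¬ nil i) ξ) (w : 𝒜 ⊗[K] 𝒮) (h : L) :
    topCoeffL L hx hξ (w ⊗ₜ h) = topCoeff hx hξ w • h := by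
  simp [topCoeffL]

theorem topCoeffL_assoc_symm (hx : IsQAffinePresentation c nil x)
    (hξ : IsQAffinePresentation c' (fun i => ¬ nil i) ξ) (v : 𝒜) (s : 𝒮) (h : L) :
    topCoeffL L hx hξ ((TensorProduct.assoc K 𝒜 𝒮 L).symm (v ⊗ₜ (s ⊗ₜ h))) =
      hx.coeff ⟨_, adm_topExp nil⟩ v • hξ.coeff ⟨_, adm_topExp _⟩ s • h := by
  rw [TensorProduct.assoc_symm_tmul, topCoeffL_tmul, topCoeff, smul_smul]
  rfl

theorem topCoeffL_diffl (hx : IsQAffinePresentation c nil x)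
    (hξ : IsQAffinePresentation c' (fun i => ¬ nil i) ξ) (w : (𝒜 ⊗[K] 𝒮) ⊗[K] L) :
    topCoeffL L hx hξ ((diffl K x ξ).rTensor L w) = 0 := by
  have : topCoeffL L hx hξ ∘ₗ (diffl K x ξ).rTensor L = 0 := by
    rw [topCoeffL, LinearMap.comp_assoc, ← LinearMap.rTensor_comp, topCoeff_diffl,
      LinearMap.rTensor_zero, LinearMap.comp_zero]
  exact LinearMap.congr_fun this w

/-- Cocycles with coefficients in `L` are, up to coboundaries, multiples of the generator of the
cohomology. -/
theorem sub_topCoeffL_mem_range (hx : IsQAffinePresentation c nil x)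
    (hξ : IsQAffinePresentation c' (fun i => ¬ nil i) ξ)
    (hcc' : ∀ i j, i ≠ j → c i j * c' j i = -1) {w : (𝒜 ⊗[K] 𝒮) ⊗[K] L}
    (hw : (diffl K x ξ).rTensor L w = 0) :
    w - bimon K x ξ (topExp nil) (topExp fun i => ¬ nil i) ⊗ₜ topCoeffL L hx hξ w ∈
      LinearMap.range ((diffl K x ξ).rTensor L) := by
  refine ⟨(htpy hx hξ).rTensor L w, ?_⟩
  have key : ∀ w : (𝒜 ⊗[K] 𝒮) ⊗[K] L, (diffl K x ξ).rTensor L ((htpy hx hξ).rTensor L w) +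
      (htpy hx hξ).rTensor L ((diffl K x ξ).rTensor L w) =
      w - bimon K x ξ (topExp nil) (topExp fun i => ¬ nil i) ⊗ₜ topCoeffL L hx hξ w := by
    intro w
    induction w with
    | zero => simp
    | add w w' h h' =>
      simp only [map_add, TensorProduct.tmul_add]
      rw [add_add_add_comm, h, h']
      abel
    | tmul w l =>
      simp only [LinearMap.rTensor_tmul]
      rw [← TensorProduct.add_tmul, diffl_htpy_add_htpy_diffl hx hξ hcc', topCoeffL_tmul,
        TensorProduct.sub_tmul, TensorProduct.tmul_smul, TensorProduct.smul_tmul']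
  rw [← key w, hw, map_zero, add_zero]

variable {par : Fin d → ℕ} {σ : 𝒜 →ₐ[K] 𝒜} {τ : 𝒮 →ₐ[K] 𝒮} {Z t : Matrix (Fin d) (Fin d) L}
  {f : 𝒜 →ₐ[K] Module.End K (𝒜 ⊗[K] (𝒮 ⊗[K] L))} {g : 𝒮 →ₐ[K] Module.End K (𝒮 ⊗[K] L)}
  {m n : ℕ}

/-- Only rearrangements of the two extremal words contribute to the coefficient of the generator,
and these keep all parities, so no super sign survives there. -/
theorem neg_one_pow_signExponent {k l : ℕ} {w' w : Word d k l}
    (h1 : ∀ u, par (w'.1 u) = par (w.1 u)) (h2 : ∀ v, par (w'.2 v) = par (w.2 v)) :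
    (-1 : K) ^ signExponent par w' w = 1 := by
  apply Even.neg_one_pow
  refine Even.add (Even.add ?_ ?_) ?_
  all_goals
    refine Finset.even_sum _ fun u _ => Finset.even_sum _ fun v _ => ?_
  · split_ifs
    · rw [h1 u]; exact Even.mul_right ⟨_, rfl⟩ _
    · simp
  · rw [h1 u]; exact Even.mul_right ⟨_, rfl⟩ _
  · split_ifs
    · rw [h2 u]; exact Even.mul_right ⟨_, rfl⟩ _
    · simp

/-- The coefficient of the coaction at the generator of the cohomology is a product of two quantum
determinants. -/
theorem topCoeffL_koszulG (hx : IsQAffinePresentation c nil x)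
    (hξ : IsQAffinePresentation c' (fun i => ¬ nil i) ξ)
    (hσ : IsParityAut par x σ) (hτ : IsParityAut par ξ τ)
    (hpar : ∀ i j, (nil i ↔ nil j) → par i = par j)
    (H : IsKoszulCoaction par x ξ σ τ Z t f g) (ι : Fin m ↪o Fin d)
    (hι : ∀ i, nil i ↔ i ∈ Set.range ι) (κ : Fin n ↪o Fin d)
    (hκ : ∀ i, ¬ nil i ↔ i ∈ Set.range κ) (h : L) :
    topCoeffL L hx hξ ((TensorProduct.assoc K 𝒜 𝒮 L).symm (koszulG f g
      (omon x (topExp nil) ⊗ₜ (omon ξ (topExp fun i => ¬ nil i) ⊗ₜ h)))) =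
      qdet (fun i j => c (ι i) (ι j)) (Z.submatrix ι ι) *
        qdet (fun i j => c' (κ i) (κ j)) (t.submatrix κ κ).transpose * h := by
  classical
  rw [← hx.prod_orderEmbedding ι hι, ← hξ.prod_orderEmbedding κ hκ, koszulG_word hσ hτ H, map_sum,
    map_sum]
  have e : ∀ w' : Word d m n, topCoeffL L hx hξ ((TensorProduct.assoc K 𝒜 𝒮 L).symm
      ((-1 : K) ^ signExponent par w' (ι, κ) •
        ((List.ofFn fun u => x (w'.1 u)).prod ⊗ₜ[K] ((List.ofFn fun v => ξ (w'.2 v)).prod ⊗ₜ[K]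
          ((List.ofFn fun u => Z (w'.1 u) (ι u)).prod *
            ((List.ofFn fun v => t (κ v) (w'.2 v)).prod * h)))))) =
      (if wordCount w'.1 = topExp nil then wordCoef c w'.1 else 0) •
        (if wordCount w'.2 = topExp (fun i => ¬ nil i) then wordCoef c' w'.2 else 0) •
          ((List.ofFn fun u => Z (w'.1 u) (ι u)).prod *
            ((List.ofFn fun v => t (κ v) (w'.2 v)).prod * h)) := by
    intro w'
    rw [map_smul, map_smul, topCoeffL_assoc_symm, hx.coeff_word, hξ.coeff_word]
    by_cases h1 : wordCount w'.1 = topExp nil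
    swap
    · simp [h1]
    by_cases h2 : wordCount w'.2 = topExp (fun i => ¬ nil i)
    swap
    · simp [h2]
    rw [neg_one_pow_signExponent, one_smul]
    · intro u
      exact hpar _ _ (iff_of_true (nil_of_wordCount h1 u) ((hι _).2 ⟨u, rfl⟩))
    · intro v
      exact hpar _ _ (iff_of_false (nil_of_wordCount h2 v) ((hκ _).2 ⟨v, rfl⟩))
  have e' := fun w' : Word d m n => e w'
  rw [Finset.sum_congr rfl fun w' _ => e' w', Fintype.sum_prod_type]
  simp only [← Finset.smul_sum]
  rw [sum_topWords ι hι fun w => ∑ w' : Fin n → Fin d,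
    (if wordCount w' = topExp (fun i => ¬ nil i) then wordCoef c' w' else 0) •
      ((List.ofFn fun u => Z (w u) (ι u)).prod *
        ((List.ofFn fun v => t (κ v) (w' v)).prod * h))]
  simp only [sum_topWords κ hκ, qdet, Finset.sum_mul, Finset.smul_sum, Finset.mul_sum,
    smul_mul_assoc, mul_smul_comm, mul_assoc, Matrix.submatrix_apply, Matrix.transpose_apply]
  rw [Finset.sum_comm]
  simp only [smul_comm (∏ _, ∏ _, ite (_ < _ ∧ _) (c _ _) 1)]

end TopCoefficient

/-! ### The relations given by the multiparameter `R`-matrix -/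

section Relations

variable {K : Type*} [Field K] {d : ℕ}

/-- The coefficient of `x_i ⊗ x_j` in `R (x_i ⊗ x_j)`, for `i ≠ j`. -/
def rDiag (q : K) (p r : Fin d → Fin d → K) (i j : Fin d) : K :=
  (q - p i j * r i j) / (1 + p i j * r i j)

/-- The coefficient of `x_j ⊗ x_i` in `R (x_i ⊗ x_j)`, for `i ≠ j`. -/
def rFlip (par : Fin d → ℕ) (q : K) (p r : Fin d → Fin d → K) (i j : Fin d) : K :=
  (-1) ^ (par i * par j) * (p i j * (q + 1) / (1 + p i j * r i j))

theorem rMatrix_eq (par : Fin d → ℕ) (q : K) (p r : Fin d → Fin d → K) (k l i j : Fin d) :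
    rMatrix par q p r k l i j = rDiag q p r i j * (if k = i ∧ l = j then 1 else 0) +
      rFlip par q p r i j * (if k = j ∧ l = i then 1 else 0) := rfl

theorem dualTensor_rMatrix_eq (par : Fin d → ℕ) (q : K) (p r : Fin d → Fin d → K)
    (k l i j : Fin d) : dualTensor (rMatrix par q p r) k l i j =
      rDiag q p r j i * (if k = i ∧ l = j then 1 else 0) +
        rFlip par q p r i j * (if k = j ∧ l = i then 1 else 0) := by
  rw [dualTensor, rMatrix_eq]
  by_cases h1 : l = j
  · by_cases h2 : k = i
    · subst h1 h2
      simp only [and_self, if_true, mul_one]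
      by_cases h : k = l
      · subst h; rfl
      · simp [h, Ne.symm h]
    · subst h1; simp [h2, Ne.symm h2]; grind
  · by_cases h2 : k = j ∧ l = i
    · obtain ⟨rfl, rfl⟩ := h2; simp [h1, Ne.symm h1]
    · have : ¬ (j = k ∧ i = l) := fun h => h2 ⟨h.1.symm, h.2.symm⟩
      simp [h1, Ne.symm h1, h2, this]

theorem preservesPairs_rMatrix (par : Fin d → ℕ) (q : K) (p r : Fin d → Fin d → K) :
    PreservesPairs (rMatrix par q p r) := by
  intro k l i j h
  by_contra hn
  rw [not_or] at hn
  exact h (by rw [rMatrix_eq, if_neg hn.1, if_neg hn.2]; ring)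

/-- For such a tensor the relation indexed by `(i, j)` reads `(μ - dg) y_i y_j = fl y_j y_i`. Off
the diagonal it can be divided by `μ - dg`; on the diagonal it says that the square vanishes, or
nothing at all. -/
theorem quadraticRel_iff_isQAffine {𝓑 : Type*} [Ring 𝓑] [Algebra K 𝓑]
    {P : Fin d → Fin d → Fin d → Fin d → K} {dg fl c : Fin d → Fin d → K} {μ : K}
    {nil : Fin d → Prop} (hP : ∀ k l i j, P k l i j = dg i j * (if k = i ∧ l = j then 1 else 0) +
      fl i j * (if k = j ∧ l = i then 1 else 0))
    (hc : ∀ i j, i ≠ j → c i j * (μ - dg i j) = fl i j) (hne : ∀ i j, i ≠ j → μ - dg i j ≠ 0)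
    (hnil : ∀ i, nil i ↔ μ - dg i i - fl i i ≠ 0) (y : Fin d → 𝓑) :
    QuadraticRel P μ y ↔ IsQAffine c nil y := by
  have hsum : ∀ i j, ∑ k, ∑ l, P k l i j • (y k * y l) =
      dg i j • (y i * y j) + fl i j • (y j * y i) := by
    intro i j
    have : ∀ k l, P k l i j • (y k * y l) =
        (if k = i then if l = j then dg i j • (y i * y j) else 0 else 0) +
        (if k = j then if l = i then fl i j • (y j * y i) else 0 else 0) := by
      intro k l
      rw [hP, add_smul]
      congr 1
      · by_cases hk : k = i <;> by_cases hl : l = j <;> simp [hk, hl]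
      · by_cases hk : k = j <;> by_cases hl : l = i <;> simp [hk, hl]
    simp [this, Finset.sum_add_distrib]
  have h1 : ∀ i j, (∑ k, ∑ l, P k l i j • (y k * y l) = μ • (y i * y j)) ↔
      (μ - dg i j) • (y i * y j) = fl i j • (y j * y i) := by
    intro i j
    rw [hsum, sub_smul, sub_eq_iff_eq_add, eq_comm, add_comm]
  simp only [QuadraticRel, h1]
  constructor
  · intro h
    refine ⟨fun i j hij => ?_, fun i hi => ?_⟩
    · have := h i j
      rw [← hc i j hij, mul_comm, mul_smul] at this
      exact smul_right_injective 𝓑 (hne i j hij) this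
    · have := h i i
      rw [← sub_eq_zero, ← sub_smul] at this
      exact (smul_eq_zero.1 this).resolve_left ((hnil i).1 hi)
  · intro h i j
    by_cases hij : i = j
    · subst hij
      rw [← sub_eq_zero, ← sub_smul]
      by_cases hi : nil i
      · rw [h.sq i hi, smul_zero]
      · rw [not_not.1 (mt (hnil i).2 hi), zero_smul]
    · rw [h.comm i j hij, smul_smul, ← hc i j hij, mul_comm]

namespace IsParameterSystem

variable {q : K} {p r : Fin d → Fin d → K}

/-- In characteristic zero `-1` is a root of unity different from `1`. -/
theorem one_add_q_ne_zero [CharZero K] (h : IsParameterSystem q p r) :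
    1 + q ≠ 0 := by
  intro hq
  have hq1 : q = -1 := by linear_combination hq
  have := h.q_root 2 (by norm_num) (by rw [hq1]; norm_num)
  rw [hq1] at this
  norm_num at this

/-- The order of the indices determined by the signs `ε_{ij}`. -/
theorem exists_rank (h : IsParameterSystem q p r) :
    ∃ rk : Fin d → ℤ, Function.Injective rk ∧
      ∀ i j, i ≠ j → p i j * r i j = if rk i < rk j then q else q⁻¹ := by
  classical
  obtain ⟨ε, hε, htr⟩ := h.epsilon
  -- `i` precedes `j`
  let lt : Fin d → Fin d → Prop := fun i j => (i < j ∧ ε i j = 1) ∨ (j < i ∧ ε j i = -1)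
  have htot : ∀ i j, i ≠ j → (lt i j ↔ ¬ lt j i) := by
    intro i j hij
    simp only [lt]
    rcases lt_or_gt_of_ne hij with hlt | hlt
    · rcases (hε i j hij).1 with h1 | h1 <;> simp [hlt, hlt.not_gt, h1]
    · rcases (hε j i hij.symm).1 with h1 | h1 <;> simp [hlt, hlt.not_gt, h1]
  have hirr : ∀ i, ¬ lt i i := fun i => by simp [lt]
  have htrans : ∀ i j k, lt i j → lt j k → lt i k := by
    intro i j k hij hjk
    have nij : i ≠ j := by rintro rfl; exact hirr _ hij
    have njk : j ≠ k := by rintro rfl; exact hirr _ hjk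
    have nik : i ≠ k := by
      rintro rfl
      exact (htot _ _ nij).1 hij hjk
    simp only [lt] at hij hjk ⊢
    -- The hypothesis on the signs forbids cyclic triangles in the tournament `lt`, which makes it a
    -- linear order; the number of predecessors is then a rank.
    have key : ∀ a b c, a < b → b < c → (ε a c = ε a b ∨ ε b c = ε a c) := by
      intro a b c hab hbc
      rcases mul_eq_zero.1 (htr a b c hab hbc) with h0 | h0
      · left; linarith
      · right; linarith
    have v := fun a b hab => (hε a b hab).1
    rcases lt_or_gt_of_ne nij with a | a <;> rcases lt_or_gt_of_ne njk with b | b <;>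
      rcases lt_or_gt_of_ne nik with e | e <;>
      simp only [a, b, e, a.not_gt, b.not_gt, e.not_gt, true_and, false_and, or_false,
        false_or] at hij hjk ⊢
    · have := key i j k a b; omega
    · exact absurd (a.trans b) e.not_gt
    · have := key i k j e b; have := v i k nik; omega
    · have := key k i j e a; have := v k i nik.symm; omega
    · have := key j i k a e; have := v i k nik; omega
    · have := key j k i b e; have := v k i nik.symm; omega
    · exact absurd (b.trans a) e.not_gt
    · have := key k j i b a; have := v k i nik.symm; omega
  let rk : Fin d → ℤ := fun i => ((Finset.univ.filter fun j => lt j i).card : ℤ)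
  have hmono : ∀ i j, lt i j → rk i < rk j := by
    intro i j hij
    simp only [rk, Nat.cast_lt]
    apply Finset.card_lt_card
    rw [Finset.ssubset_iff_of_subset]
    · exact ⟨i, by simp [hij], by simp [hirr]⟩
    · intro k hk
      simp only [Finset.mem_filter, Finset.mem_univ, true_and] at hk ⊢
      exact htrans _ _ _ hk hij
  have hiff : ∀ i j, i ≠ j → (rk i < rk j ↔ lt i j) := by
    intro i j hij
    refine ⟨fun hlt => ?_, hmono i j⟩
    by_contra hn
    exact (hmono j i ((htot j i hij.symm).2 hn)).not_gt hlt
  refine ⟨rk, fun i j hij => ?_, fun i j hij => ?_⟩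
  · by_contra hne
    by_cases hl : lt i j
    · exact (hmono i j hl).ne hij
    · exact (hmono j i ((htot j i (Ne.symm hne)).2 hl)).ne hij.symm
  · simp only [hiff i j hij, lt]
    rcases lt_or_gt_of_ne hij with hlt | hlt
    · rcases (hε i j hij).1 with h1 | h1
      · simp [hlt, hlt.not_gt, h1, (hε i j hij).2]
      · simp [hlt, hlt.not_gt, h1, (hε i j hij).2]
    · have e : p i j * r i j = (q ^ ε j i)⁻¹ := by
        rw [← (hε j i hij.symm).2, h.p_symm j i, h.r_symm j i, mul_inv]
      rcases (hε j i hij.symm).1 with h1 | h1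
      · simp [hlt, hlt.not_gt, h1, e]
      · simp [hlt, hlt.not_gt, h1, e]

theorem one_add_ne_zero [CharZero K] (h : IsParameterSystem q p r)
    (i j : Fin d) : 1 + p i j * r i j ≠ 0 := by
  by_cases hij : i = j
  · subst hij
    rw [h.p_diag, h.r_diag]; norm_num
  · obtain ⟨rk, -, hrk⟩ := h.exists_rank
    rw [hrk i j hij]
    split_ifs
    · exact h.one_add_q_ne_zero
    · intro h0
      apply h.one_add_q_ne_zero
      have := h.q_ne_zero
      field_simp at h0
      linear_combination h0

theorem mul_swap (h : IsParameterSystem q p r) (i j : Fin d) :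
    p j i * r j i = (p i j * r i j)⁻¹ := by
  rw [h.p_symm i j, h.r_symm i j, mul_inv]

/-- The structure constants of the relations `R = -1`. -/
def cMinus (par : Fin d → ℕ) (p : Fin d → Fin d → K) (i j : Fin d) : K :=
  -((-1) ^ (par i * par j) * p i j)

/-- The structure constants of the relations `R^* = q`. -/
def cPlus (par : Fin d → ℕ) (p : Fin d → Fin d → K) (i j : Fin d) : K :=
  (-1) ^ (par i * par j) * p i j

theorem cPlus_inv (h : IsParameterSystem q p r)
    (par : Fin d → ℕ) (i j : Fin d) : cPlus par p i j * cPlus par p j i = 1 := by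
  have h1 := h.p_ne_zero i j
  rw [cPlus, cPlus, h.p_symm i j, mul_comm (par j)]
  calc _ = ((-1 : K) ^ (par i * par j) * (-1) ^ (par i * par j)) * (p i j * (p i j)⁻¹) := by ring
    _ = 1 := by rw [← mul_pow, mul_inv_cancel₀ h1]; simp

theorem cMinus_inv (h : IsParameterSystem q p r)
    (par : Fin d → ℕ) (i j : Fin d) : cMinus par p i j * cMinus par p j i = 1 := by
  rw [cMinus, cMinus, neg_mul_neg]; exact h.cPlus_inv par i j

theorem cMinus_mul_cPlus (h : IsParameterSystem q p r)
    (par : Fin d → ℕ) (i j : Fin d) : cMinus par p i j * cPlus par p j i = -1 := by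
  rw [cMinus, neg_mul]; exact congrArg Neg.neg (h.cPlus_inv par i j)

/-- The parameters with `p` and `r` replaced by the inverses of `r` and `p`. -/
theorem swap (h : IsParameterSystem q p r) :
    IsParameterSystem q (fun i j => (r i j)⁻¹) (fun i j => (p i j)⁻¹) where
  q_ne_zero := h.q_ne_zero
  q_root := h.q_root
  p_ne_zero i j := inv_ne_zero (h.r_ne_zero i j)
  r_ne_zero i j := inv_ne_zero (h.p_ne_zero i j)
  p_diag i := by rw [h.r_diag, inv_one]
  r_diag i := by rw [h.p_diag, inv_one]
  p_symm i j := by rw [h.r_symm i j]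
  r_symm i j := by rw [h.p_symm i j]
  epsilon := by
    obtain ⟨ε, h1, h2⟩ := h.epsilon
    refine ⟨fun i j => -ε i j, fun i j hij => ⟨?_, ?_⟩, fun i j k hij hjk => ?_⟩
    · rcases (h1 i j hij).1 with h | h <;> simp [h]
    · rw [zpow_neg, ← (h1 i j hij).2, mul_inv, mul_comm]
    · have := h2 i j k hij hjk
      linear_combination this

theorem comp {e : ℕ} (h : IsParameterSystem q p r)
    (ι : Fin e ↪o Fin d) :
    IsParameterSystem q (fun i j => p (ι i) (ι j)) (fun i j => r (ι i) (ι j)) where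
  q_ne_zero := h.q_ne_zero
  q_root := h.q_root
  p_ne_zero i j := h.p_ne_zero _ _
  r_ne_zero i j := h.r_ne_zero _ _
  p_diag i := h.p_diag _
  r_diag i := h.r_diag _
  p_symm i j := h.p_symm _ _
  r_symm i j := h.r_symm _ _
  epsilon := by
    obtain ⟨ε, h1, h2⟩ := h.epsilon
    exact ⟨fun i j => ε (ι i) (ι j), fun i j hij => h1 _ _ (ι.injective.ne hij),
      fun i j k hij hjk => h2 _ _ _ (ι.strictMono hij) (ι.strictMono hjk)⟩

variable {𝓑 : Type*} [Ring 𝓑] [Algebra K 𝓑] {par : Fin d → ℕ}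

theorem diag_add_flip [CharZero K] (h : IsParameterSystem q p r)
    (hpar : ∀ i, par i = 0 ∨ par i = 1) (i : Fin d) :
    rDiag q p r i i + rFlip par q p r i i = if par i = 0 then q else -1 := by
  rw [rDiag, rFlip, h.p_diag, h.r_diag]
  rcases hpar i with h0 | h0
  · rw [h0, if_pos rfl]; norm_num; ring
  · rw [h0, if_neg one_ne_zero]; norm_num; ring

theorem quadraticRel_neg_one_iff [CharZero K] (h : IsParameterSystem q p r)
    (hpar : ∀ i, par i = 0 ∨ par i = 1) (y : Fin d → 𝓑) :
    QuadraticRel (rMatrix par q p r) (-1) y ↔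
      IsQAffine (cMinus par p) (fun i => par i = 0) y := by
  have h1 := h.one_add_ne_zero
  have h2 := h.one_add_q_ne_zero
  refine quadraticRel_iff_isQAffine (rMatrix_eq par q p r) ?_ ?_ ?_ y
  · intro i j _
    have := h1 i j
    rw [cMinus, rDiag, rFlip]
    field_simp
    ring
  · intro i j _
    have := h1 i j
    have e : -1 - rDiag q p r i j = -(1 + q) / (1 + p i j * r i j) := by
      rw [rDiag]; field_simp; ring
    rw [e]
    exact div_ne_zero (neg_ne_zero.2 h2) this
  · intro i
    rw [sub_sub, h.diag_add_flip hpar]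
    split_ifs with h0
    · simp only [h0, true_iff]
      intro h3; apply h2; linear_combination -h3
    · simp [h0]

theorem quadraticRel_q_iff [CharZero K] (h : IsParameterSystem q p r)
    (hpar : ∀ i, par i = 0 ∨ par i = 1) (y : Fin d → 𝓑) :
    QuadraticRel (rMatrix par q p r) q y ↔
      IsQAffine (cPlus par fun i j => (r i j)⁻¹) (fun i => ¬ par i = 0) y := by
  have h1 := h.one_add_ne_zero
  have h2 := h.one_add_q_ne_zero
  have e : ∀ i j, q - rDiag q p r i j = (p i j * r i j) * (1 + q) / (1 + p i j * r i j) := by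
    intro i j
    have := h1 i j
    rw [rDiag]; field_simp; ring
  refine quadraticRel_iff_isQAffine (rMatrix_eq par q p r) ?_ ?_ ?_ y
  · intro i j _
    have := h1 i j
    have := h.r_ne_zero i j
    rw [cPlus, e, rFlip]
    field_simp
    ring
  · intro i j _
    rw [e]
    exact div_ne_zero (mul_ne_zero (mul_ne_zero (h.p_ne_zero i j) (h.r_ne_zero i j)) h2) (h1 i j)
  · intro i
    rw [sub_sub, h.diag_add_flip hpar]
    split_ifs with h0
    · simp [h0]
    · simp only [h0, not_false_eq_true, true_iff]
      intro h3; apply h2; linear_combination h3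

theorem quadraticRel_dual_q_iff [CharZero K] (h : IsParameterSystem q p r)
    (hpar : ∀ i, par i = 0 ∨ par i = 1) (y : Fin d → 𝓑) :
    QuadraticRel (dualTensor (rMatrix par q p r)) q y ↔
      IsQAffine (cPlus par p) (fun i => ¬ par i = 0) y := by
  have h1 := h.one_add_ne_zero
  have h2 := h.one_add_q_ne_zero
  have e : ∀ i j, q - rDiag q p r j i = (1 + q) / (1 + p i j * r i j) := by
    intro i j
    have h3 := h1 i j
    have h4 := h1 j i
    have h5 := mul_ne_zero (h.p_ne_zero i j) (h.r_ne_zero i j)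
    rw [rDiag, h.mul_swap i j] at *
    generalize p i j * r i j = t at *
    field_simp
    have : t + 1 ≠ 0 := by rwa [add_comm]
    field_simp
    ring
  refine quadraticRel_iff_isQAffine (dg := fun i j => rDiag q p r j i)
    (dualTensor_rMatrix_eq par q p r) ?_ ?_ ?_ y
  · intro i j _
    have := h1 i j
    rw [cPlus, e, rFlip]
    field_simp
    ring
  · intro i j _
    rw [e]
    exact div_ne_zero h2 (h1 i j)
  · intro i
    rw [sub_sub, h.diag_add_flip hpar]
    split_ifs with h0
    · simp [h0]
    · simp only [h0, not_false_eq_true, true_iff]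
      intro h3; apply h2; linear_combination h3

theorem quadraticRel_dual_neg_one_iff [CharZero K] (h : IsParameterSystem q p r)
    (hpar : ∀ i, par i = 0 ∨ par i = 1) (y : Fin d → 𝓑) :
    QuadraticRel (dualTensor (rMatrix par q p r)) (-1) y ↔
      IsQAffine (cMinus par fun i j => (r i j)⁻¹) (fun i => par i = 0) y := by
  have h1 := h.one_add_ne_zero
  have h2 := h.one_add_q_ne_zero
  have e : ∀ i j, -1 - rDiag q p r j i =
      -((p i j * r i j) * (1 + q)) / (1 + p i j * r i j) := by
    intro i j
    have h3 := h1 i j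
    have h4 := h1 j i
    have h5 := mul_ne_zero (h.p_ne_zero i j) (h.r_ne_zero i j)
    rw [rDiag, h.mul_swap i j] at *
    generalize p i j * r i j = t at *
    field_simp
    have : t + 1 ≠ 0 := by rwa [add_comm]
    field_simp
    ring
  refine quadraticRel_iff_isQAffine (dg := fun i j => rDiag q p r j i)
    (dualTensor_rMatrix_eq par q p r) ?_ ?_ ?_ y
  · intro i j _
    have := h1 i j
    have := h.r_ne_zero i j
    rw [cMinus, e, rFlip]
    field_simp
    ring
  · intro i j _
    rw [e]
    exact div_ne_zero (neg_ne_zero.2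
      (mul_ne_zero (mul_ne_zero (h.p_ne_zero i j) (h.r_ne_zero i j)) h2)) (h1 i j)
  · intro i
    rw [sub_sub, h.diag_add_flip hpar]
    split_ifs with h0
    · simp only [h0, true_iff]
      intro h3; apply h2; linear_combination -h3
    · simp [h0]

end IsParameterSystem

end Relations

/-! ### The quantum Berezinian -/

/-! ### Presentations and monomial bases of `Λ` and `S^∨` -/

section Presentations

theorem adjoin_range_eq_top_of_surjective {K : Type*} [Field K] {X 𝓑 : Type*} [Ring 𝓑]
    [Algebra K 𝓑] (φ : FreeAlgebra K X →ₐ[K] 𝓑) (hφ : Function.Surjective φ) :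
    Algebra.adjoin K (Set.range fun i => φ (FreeAlgebra.ι K i)) = ⊤ := by
  have : (Set.range fun i => φ (FreeAlgebra.ι K i)) = φ '' Set.range (FreeAlgebra.ι K) := by
    rw [← Set.range_comp]; rfl
  rw [this, ← AlgHom.map_adjoin, FreeAlgebra.adjoin_range_ι, Algebra.map_top]
  exact AlgHom.range_eq_top φ |>.2 hφ

theorem isQuadraticAlgebra_lambda.{u, w} {K : Type u} [Field K] {d : ℕ}
    (R : Fin d → Fin d → Fin d → Fin d → K) : IsQuadraticAlgebra.{u, u, w} R (-1) (lx R) where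
  rel i j := by
    have := RingQuot.mkAlgHom_rel K (LambdaRel.mk (R := R) i j)
    simp only [map_sum, map_smul, map_mul, map_neg] at this
    rw [neg_one_smul]
    exact this
  gen := adjoin_range_eq_top_of_surjective (RingQuot.mkAlgHom K (LambdaRel R))
    (RingQuot.mkAlgHom_surjective K _)
  lift y' hy' := by
    have hrel : ∀ ⦃a b⦄, LambdaRel R a b → FreeAlgebra.lift K y' a = FreeAlgebra.lift K y' b := by
      rintro _ _ ⟨i, j⟩
      simpa using hy' i j
    refine ⟨(RingQuot.liftAlgHom K ⟨FreeAlgebra.lift K y', hrel⟩ :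
      RingQuot (LambdaRel R) →ₐ[K] _), fun i => ?_⟩
    exact (RingQuot.liftAlgHom_mkAlgHom_apply K _ hrel _).trans (FreeAlgebra.lift_ι_apply _ _)

theorem isQuadraticAlgebra_sDual.{u, w} {K : Type u} [Field K] {d : ℕ} (q : K)
    (R : Fin d → Fin d → Fin d → Fin d → K) :
    IsQuadraticAlgebra.{u, u, w} (dualTensor R) q (sxi q R) where
  rel i j := by
    have := RingQuot.mkAlgHom_rel K (SDualRel.mk (q := q) (R := R) i j)
    simp only [map_sum, map_smul, map_mul] at this
    exact this
  gen := adjoin_range_eq_top_of_surjective (RingQuot.mkAlgHom K (SDualRel q R))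
    (RingQuot.mkAlgHom_surjective K _)
  lift y' hy' := by
    have hrel : ∀ ⦃a b⦄, SDualRel q R a b →
        FreeAlgebra.lift K y' a = FreeAlgebra.lift K y' b := by
      rintro _ _ ⟨i, j⟩
      simpa [dualTensor] using hy' i j
    refine ⟨(RingQuot.liftAlgHom K ⟨FreeAlgebra.lift K y', hrel⟩ :
      RingQuot (SDualRel q R) →ₐ[K] _), fun i => ?_⟩
    exact (RingQuot.liftAlgHom_mkAlgHom_apply K _ hrel _).trans (FreeAlgebra.lift_ι_apply _ _)

/-- The monomial model is an algebra in which the relations hold, so the universal property supplies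
the action required for the basis. -/
theorem IsQuadraticAlgebra.isQAffinePresentation.{u} {K 𝒜 : Type u} [Field K] [Ring 𝒜]
    [Algebra K 𝒜] {d : ℕ} {P : Fin d → Fin d → Fin d → Fin d → K} {μ : K} {y : Fin d → 𝒜}
    (h : IsQuadraticAlgebra.{u, u, u} P μ y) {c : Fin d → Fin d → K} {nil : Fin d → Prop}
    (hrel : ∀ {𝓑 : Type u} [Ring 𝓑] [Algebra K 𝓑] (y' : Fin d → 𝓑),
      QuadraticRel P μ y' ↔ IsQAffine c nil y')
    (hinv : ∀ i j, i ≠ j → c i j * c j i = 1) : IsQAffinePresentation c nil y where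
  toIsQAffine := (hrel y).1 h.rel
  inv := hinv
  gen := h.gen
  model := h.lift _ ((hrel _).2 (isQAffine_ly hinv nil))

end Presentations

/-! ### The generic quantum super matrix and its inverse -/

section HopfEnvelope

variable {K : Type*} [Field K] {d : ℕ} (par : Fin d → ℕ) (R : Fin d → Fin d → Fin d → Fin d → K)

/-- The generic quantum super matrix. -/
def hzMatrix : Matrix (Fin d) (Fin d) (HopfEnvelope par R) := Matrix.of (hz par R)

/-- The matrix of the generators `t^j_i`. -/
def htMatrix : Matrix (Fin d) (Fin d) (HopfEnvelope par R) := Matrix.of (ht par R)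

theorem isQuantumSuperMatrix_hzMatrix : IsQuantumSuperMatrix par R (hzMatrix par R) := by
  intro k l i j
  have := RingQuot.mkAlgHom_rel K (HopfRel.zz (par := par) (R := R) k l i j)
  simp only [map_sum, map_smul, map_mul] at this
  exact this

theorem sum_hz_mul_ht (i j : Fin d) :
    ∑ k, (-1 : K) ^ (par i * (par k + 1)) • (hz par R j k * ht par R k i) =
      if i = j then 1 else 0 := by
  have := RingQuot.mkAlgHom_rel K (HopfRel.zt (par := par) (R := R) i j)
  rw [apply_ite (RingQuot.mkAlgHom K (HopfRel par R)), map_one, map_zero] at this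
  simp only [map_sum, map_smul, map_mul] at this
  exact this

theorem sum_ht_mul_hz (i j : Fin d) :
    ∑ k, (-1 : K) ^ (par k * (par j + 1)) • (ht par R j k * hz par R k i) =
      if i = j then 1 else 0 := by
  have := RingQuot.mkAlgHom_rel K (HopfRel.tz (par := par) (R := R) i j)
  rw [apply_ite (RingQuot.mkAlgHom K (HopfRel par R)), map_one, map_zero] at this
  simp only [map_sum, map_smul, map_mul] at this
  exact this

/-- The inverse of the generic quantum super matrix. -/
def hzInv : Matrix (Fin d) (Fin d) (HopfEnvelope par R) :=
  Matrix.of fun j i => (-1 : K) ^ (par i * (par j + 1)) • ht par R j i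

theorem hzMatrix_mul_hzInv : hzMatrix par R * hzInv par R = 1 := by
  ext j i
  rw [Matrix.mul_apply, Matrix.one_apply]
  simp only [hzMatrix, hzInv, Matrix.of_apply, mul_smul_comm]
  rw [sum_hz_mul_ht]
  simp only [eq_comm]

theorem hzInv_mul_hzMatrix : hzInv par R * hzMatrix par R = 1 := by
  ext j i
  rw [Matrix.mul_apply, Matrix.one_apply]
  simp only [hzMatrix, hzInv, Matrix.of_apply, smul_mul_assoc]
  rw [sum_ht_mul_hz]
  simp only [eq_comm]

theorem isQuantumSuperMatrix_htMatrix {R : Fin d → Fin d → Fin d → Fin d → K}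
    (hR : PreservesPairs R) :
    IsQuantumSuperMatrix par (dualTensor R) (htMatrix par R).transpose := by
  have h := isQuantumSuperMatrix_dual hR ((isQuantumSuperMatrix_iff.1
    (isQuantumSuperMatrix_hzMatrix par R)).superSquareInv (hzMatrix_mul_hzInv par R)
      (hzInv_mul_hzMatrix par R))
  convert h using 1
  ext j i
  simp [htMatrix, hzInv, smul_smul, ← mul_pow]

end HopfEnvelope

/-! ### Existence and uniqueness of the Berezinian -/

section Berezinian

theorem assoc_rTensor_diffl {K : Type*} [Field K] {d : ℕ} {𝒜 𝒮 L : Type*} [Ring 𝒜] [Algebra K 𝒜]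
    [Ring 𝒮] [Algebra K 𝒮] [Ring L] [Algebra K L] (x : Fin d → 𝒜) (ξ : Fin d → 𝒮)
    (w : (𝒜 ⊗[K] 𝒮) ⊗[K] L) :
    TensorProduct.assoc K 𝒜 𝒮 L ((diffl K x ξ).rTensor L w) =
      diffl' L x ξ (TensorProduct.assoc K 𝒜 𝒮 L w) := by
  have : (TensorProduct.assoc K 𝒜 𝒮 L).toLinearMap ∘ₗ (diffl K x ξ).rTensor L =
      diffl' L x ξ ∘ₗ (TensorProduct.assoc K 𝒜 𝒮 L).toLinearMap := by
    refine TensorProduct.ext_threefold fun v s h => ?_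
    simp [diffl_tmul, diffl'_tmul, TensorProduct.sum_tmul]
  exact LinearMap.congr_fun this w

open IsParameterSystem in
/-- The quantum Berezinian, as the product of the quantum determinants of the even block of `Z`
and of the odd block of the inverse matrix. -/
def berezinian {K : Type*} [Field K] {d m n : ℕ} (par : Fin d → ℕ)
    (R : Fin d → Fin d → Fin d → Fin d → K) (p : Fin d → Fin d → K) (ι : Fin m ↪o Fin d)
    (κ : Fin n ↪o Fin d) : HopfEnvelope par R :=
  qdet (fun i j => cMinus par p (ι i) (ι j)) ((hzMatrix par R).submatrix ι ι) *
    qdet (fun i j => cPlus par p (κ i) (κ j)) ((htMatrix par R).submatrix κ κ).transpose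

open IsParameterSystem in
-- The coaction extends to an operator `G` commuting with the differential, so `G (c ⊗ 1)` is a
-- cocycle and hence cohomologous to `c ⊗ b` for its top coefficient `b`. Conversely, the functional
-- `φ` kills coboundaries and recovers `b` from the class of `c ⊗ b`, which forces uniqueness.
theorem isBerezinian_iff {K : Type*} [Field K] [CharZero K] {d m n : ℕ} {q : K}
    {p r : Fin d → Fin d → K} (h : IsParameterSystem q p r) {par : Fin d → ℕ}
    (hpar : ∀ i, par i = 0 ∨ par i = 1) (ι : Fin m ↪o Fin d)
    (hι : ∀ i, par i = 0 ↔ i ∈ Set.range ι) (κ : Fin n ↪o Fin d)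
    (hκ : ∀ i, ¬ par i = 0 ↔ i ∈ Set.range κ) (b : HopfEnvelope par (rMatrix par q p r)) :
    IsBerezinian m n par q (rMatrix par q p r) b ↔ b = berezinian par _ p ι κ := by
  set R := rMatrix par q p r with hR
  have hP : PreservesPairs R := preservesPairs_rMatrix par q p r
  have hx : IsQAffinePresentation (cMinus par p) (fun i => par i = 0) (lx R) :=
    (isQuadraticAlgebra_lambda R).isQAffinePresentation
      (fun y => h.quadraticRel_neg_one_iff hpar y) fun i j _ => h.cMinus_inv par i j
  have hξ : IsQAffinePresentation (cPlus par p) (fun i => ¬ par i = 0) (sxi q R) :=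
    (isQuadraticAlgebra_sDual q R).isQAffinePresentation
      (fun y => h.quadraticRel_dual_q_iff hpar y) fun i j _ => h.cPlus_inv par i j
  have hcc' : ∀ i j, i ≠ j → cMinus par p i j * cPlus par p j i = -1 :=
    fun i j _ => h.cMinus_mul_cPlus par i j
  obtain ⟨σ, hσ⟩ := (isQuadraticAlgebra_lambda R).exists_parityAut hP par
  obtain ⟨τ, hτ⟩ := (isQuadraticAlgebra_sDual q R).exists_parityAut hP.dualTensor par
  obtain ⟨f, hf⟩ := (isQuadraticAlgebra_lambda R).lift _ (quadraticRel_coactGen hP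
    (isQuadraticAlgebra_lambda.{_, 0} R).rel hσ
    (isQuantumSuperMatrix_twistedMatrix (τ := τ) hP (isQuantumSuperMatrix_hzMatrix par R)))
  obtain ⟨g, hg⟩ := (isQuadraticAlgebra_sDual q R).lift _ (quadraticRel_coactGen hP.dualTensor
    (isQuadraticAlgebra_sDual.{_, 0} q R).rel hτ
    ((isQuantumSuperMatrix_htMatrix par hP).map (Algebra.lmul K (HopfEnvelope par R))))
  have H : IsKoszulCoaction par (lx R) (sxi q R) σ τ (hzMatrix par R) (htMatrix par R) f g :=
    ⟨hf, hg⟩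
  set G : Koszul q R ⊗[K] HopfEnvelope par R →ₗ[K] Koszul q R ⊗[K] HopfEnvelope par R :=
    (TensorProduct.assoc K _ _ _).symm.toLinearMap ∘ₗ koszulG f g ∘ₗ
      (TensorProduct.assoc K _ _ _).toLinearMap with hG
  have hGD : ∀ w, G ((koszulD q R).rTensor _ w) = (koszulD q R).rTensor _ (G w) := by
    intro w
    apply (TensorProduct.assoc K _ _ _).injective
    change TensorProduct.assoc K _ _ _ (G ((diffl K (lx R) (sxi q R)).rTensor _ w)) =
      TensorProduct.assoc K _ _ _ ((diffl K (lx R) (sxi q R)).rTensor _ (G w))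
    rw [assoc_rTensor_diffl]
    simp only [hG, LinearMap.comp_apply, LinearEquiv.coe_coe, LinearEquiv.apply_symm_apply,
      assoc_rTensor_diffl]
    exact koszulG_diffl' hσ hτ hx.gen H (sum_hz_mul_ht par R) _
  have hcoact : ∀ u, koszulCoaction par q R m n u = G (koszulProj q R m n u ⊗ₜ 1) := by
    intro u
    induction u using Finsupp.induction_linear with
    | zero => simp
    | add u v hu hv => rw [map_add, map_add, TensorProduct.add_tmul, map_add, hu, hv]
    | single w a =>
      simp only [koszulCoaction, koszulProj, Finsupp.linearCombination_single]
      rw [← TensorProduct.smul_tmul', map_smul]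
      congr 1
      simp only [hG, LinearMap.comp_apply, LinearEquiv.coe_coe, monomial,
        TensorProduct.assoc_tmul]
      rw [koszulG_word hσ hτ H, map_sum]
      refine Finset.sum_congr rfl fun w' _ => ?_
      rw [map_smul, TensorProduct.assoc_symm_tmul, coactionCoeff, TensorProduct.tmul_smul, mul_one]
      rfl
  set c := bimon K (lx R) (sxi q R) (topExp fun i => par i = 0) (topExp fun i => ¬ par i = 0)
    with hc
  have hc0 : koszulD q R c = 0 := diffl_top hx hξ
  set φ := topCoeffL (HopfEnvelope par R) hx hξ with hφ
  have hφc : φ (G (c ⊗ₜ 1)) = berezinian par R p ι κ := by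
    have := topCoeffL_koszulG hx hξ hσ hτ (fun i j hij => ?_) H ι hι κ hκ 1
    · rw [mul_one] at this
      exact this
    · have h0 := hpar i
      have h1 := hpar j
      clear_value G φ c
      clear * - h0 h1 hij
      grind
  have htop : ∀ b, φ (c ⊗ₜ b) = b := fun b => by
    rw [hφ, topCoeffL_tmul, hc, topCoeff_bimon, if_pos ⟨rfl, rfl⟩, one_smul]
  have hGc : G (c ⊗ₜ 1) - c ⊗ₜ berezinian par R p ι κ ∈
      LinearMap.range ((koszulD q R).rTensor (HopfEnvelope par R)) := by
    rw [← hφc]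
    refine sub_topCoeffL_mem_range hx hξ hcc' ?_
    change (koszulD q R).rTensor _ (G (c ⊗ₜ 1)) = 0
    rw [← hGD, LinearMap.rTensor_tmul, hc0, TensorProduct.zero_tmul, map_zero]
  constructor
  · intro hb
    -- Test the defining property on the generator of the cohomology, represented by the increasing
    -- words.
    have := hb (Finsupp.single (ι, κ) 1)
    have hproj : koszulProj q R m n (Finsupp.single (ι, κ) 1) = c := by
      rw [koszulProj, Finsupp.linearCombination_single, one_smul, monomial,
        hx.prod_orderEmbedding ι hι, hξ.prod_orderEmbedding κ hκ]
      rfl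
    rw [hcoact, hproj] at this
    obtain ⟨w, hw⟩ := this hc0
    have h2 := congrArg φ hw
    rw [map_sub, hφc, htop] at h2
    have h3 : φ ((koszulD q R).rTensor _ w) = 0 := topCoeffL_diffl hx hξ w
    rw [h3] at h2
    exact (sub_eq_zero.1 h2.symm).symm
  · rintro rfl u hu
    rw [hcoact]
    have key := diffl_htpy_add_htpy_diffl hx hξ hcc' (koszulProj q R m n u)
    change koszulD q R _ + htpy hx hξ (koszulD q R _) = _ at key
    rw [hu, map_zero, add_zero, eq_sub_iff_add_eq'] at key
    -- Every cocycle is a multiple of `c` plus the differential of its homotopy image; both parts of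
    -- the difference are then coboundaries.
    have e : G (koszulProj q R m n u ⊗ₜ 1) - koszulProj q R m n u ⊗ₜ berezinian par R p ι κ =
        topCoeff hx hξ (koszulProj q R m n u) • (G (c ⊗ₜ 1) - c ⊗ₜ berezinian par R p ι κ) +
          (G (koszulD q R (htpy hx hξ (koszulProj q R m n u)) ⊗ₜ 1) -
            koszulD q R (htpy hx hξ (koszulProj q R m n u)) ⊗ₜ berezinian par R p ι κ) := by
      conv_lhs => rw [← key]
      simp only [TensorProduct.add_tmul, map_add, ← TensorProduct.smul_tmul', map_smul, smul_sub]
      abel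
    rw [e]
    refine Submodule.add_mem _ (Submodule.smul_mem _ _ hGc) (Submodule.sub_mem _ ?_ ?_)
    · exact ⟨G (_ ⊗ₜ 1), by rw [← hGD, LinearMap.rTensor_tmul]⟩
    · exact ⟨_ ⊗ₜ _, LinearMap.rTensor_tmul _ _ _ _⟩

end Berezinian

/-! ### The inverse of the coaction of an ordinary quantum matrix -/

section OppositeCoaction

variable {K : Type*} [Field K] {d : ℕ} {𝒜 : Type*} [Ring 𝒜] [Algebra K 𝒜]
  {P : Fin d → Fin d → Fin d → Fin d → K} {μ : K} {y : Fin d → 𝒜}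
  {N : Type*} [AddCommGroup N] [Module K N]

theorem isParityAut_one (y : Fin d → 𝒜) : IsParityAut (K := K) (fun _ => 0) y 1 where
  apply_gen i := by simp
  sq := one_mul 1

/-- The operator `∑ j, (· y_j) ⊗ u_{ji}` on `𝒜 ⊗ N`. -/
def coactOpGen (y : Fin d → 𝒜) (u : Matrix (Fin d) (Fin d) (Module.End K N)) (i : Fin d) :
    Module.End K (𝒜 ⊗[K] N) :=
  ∑ j, TensorProduct.map (LinearMap.mulRight K (y j)) (u j i)

theorem coactOpGen_tmul (u : Matrix (Fin d) (Fin d) (Module.End K N)) (i : Fin d) (v : 𝒜) (n : N) :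
    coactOpGen y u i (v ⊗ₜ n) = ∑ j, (v * y j) ⊗ₜ[K] (u j i n) := by
  simp [coactOpGen, LinearMap.sum_apply]

/-- Multiplying from the right reverses the order of composition, so it is the tensor with reversed
products that must intertwine `P`, and the operators satisfy the relations in the opposite algebra.
-/
theorem quadraticRel_coactOpGen (h : QuadraticRel P μ y)
    {u : Matrix (Fin d) (Fin d) (Module.End K N)}
    (hu : Intertwines P (superSquareInv K (fun _ => 0) u)) :
    QuadraticRel P μ fun i => MulOpposite.op (coactOpGen y u i) := by
  intro i j
  have key : ∀ k l (v : 𝒜) (n : N), coactOpGen y u l (coactOpGen y u k (v ⊗ₜ n)) =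
      ∑ a, ∑ b, (v * (y a * y b)) ⊗ₜ[K] (superSquareInv K (fun _ => 0) u a b k l n) := by
    intro k l v n
    rw [coactOpGen_tmul, map_sum]
    refine Finset.sum_congr rfl fun a _ => ?_
    rw [coactOpGen_tmul]
    refine Finset.sum_congr rfl fun b _ => ?_
    rw [mul_assoc]
    simp [superSquareInv]
  apply MulOpposite.unop_injective
  simp only [← MulOpposite.op_mul, ← MulOpposite.op_smul, MulOpposite.unop_op,
    Finset.unop_sum]
  refine TensorProduct.ext' fun v n => ?_
  simp only [LinearMap.sum_apply, LinearMap.smul_apply, Module.End.mul_apply, key,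
    Finset.smul_sum, ← TensorProduct.tmul_smul]
  have swap : ∀ F : Fin d → Fin d → Fin d → Fin d → 𝒜 ⊗[K] N,
      ∑ k, ∑ l, ∑ a, ∑ b, F k l a b = ∑ a, ∑ b, ∑ k, ∑ l, F k l a b := fun F => by
    simpa only [Fintype.sum_prod_type] using Finset.sum_comm (s := Finset.univ)
      (t := Finset.univ) (f := fun x z : Fin d × Fin d => F x.1 x.2 z.1 z.2)
  rw [swap]
  have e : ∀ a b, ∑ k, ∑ l, (v * (y a * y b)) ⊗ₜ[K]
      (P k l i j • superSquareInv K (fun _ => 0) u a b k l n) =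
      ∑ k, ∑ l, (v * (P a b k l • (y a * y b))) ⊗ₜ[K]
        (superSquareInv K (fun _ => 0) u k l i j n) := by
    intro a b
    simp only [← LinearMap.smul_apply, ← TensorProduct.tmul_sum, ← LinearMap.sum_apply]
    rw [← hu a b i j]
    simp only [LinearMap.sum_apply, LinearMap.smul_apply, TensorProduct.tmul_sum, mul_smul_comm,
      TensorProduct.tmul_smul, TensorProduct.smul_tmul']
  simp only [e]
  rw [swap fun a b k l => (v * (P a b k l • (y a * y b))) ⊗ₜ[K]
    (superSquareInv K (fun _ => 0) u k l i j n)]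
  simp only [← TensorProduct.sum_tmul, ← Finset.mul_sum, h _ _]
  simp only [mul_smul_comm, TensorProduct.smul_tmul, TensorProduct.tmul_smul]

/-- The coaction on `𝒜 ⊗ N` that is determined by its values on the generators, built up from the
right. -/
def coactOp (f : 𝒜 →ₐ[K] (Module.End K (𝒜 ⊗[K] N))ᵐᵒᵖ) : 𝒜 ⊗[K] N →ₗ[K] 𝒜 ⊗[K] N :=
  TensorProduct.lift (LinearMap.lcomp K _ (TensorProduct.mk K 𝒜 N 1) ∘ₗ
    (MulOpposite.opLinearEquiv K).symm.toLinearMap ∘ₗ f.toLinearMap)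

theorem coactOp_tmul (f : 𝒜 →ₐ[K] (Module.End K (𝒜 ⊗[K] N))ᵐᵒᵖ) (v : 𝒜) (n : N) :
    coactOp f (v ⊗ₜ n) = (f v).unop (1 ⊗ₜ n) := rfl

theorem coactOp_word {u : Matrix (Fin d) (Fin d) (Module.End K N)}
    {f : 𝒜 →ₐ[K] (Module.End K (𝒜 ⊗[K] N))ᵐᵒᵖ}
    (hf : ∀ i, f (y i) = MulOpposite.op (coactOpGen y u i)) {k : ℕ} (a : Fin k → Fin d) (n : N) :
    coactOp f ((List.ofFn fun s => y (a s)).prod ⊗ₜ n) = ∑ c : Fin k → Fin d,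
      (List.ofFn fun s => y (c s)).prod ⊗ₜ[K]
        (List.ofFn fun s => u (c s) (a s)).reverse.prod n := by
  suffices h : ∀ v : 𝒜, (f (List.ofFn fun s => y (a s)).prod).unop (v ⊗ₜ n) =
      ∑ c : Fin k → Fin d, (v * (List.ofFn fun s => y (c s)).prod) ⊗ₜ[K]
        (List.ofFn fun s => u (c s) (a s)).reverse.prod n by
    rw [coactOp_tmul, h]
    simp only [one_mul]
  induction k generalizing n with
  | zero => simp
  | succ k ih =>
    intro v
    rw [List.ofFn_succ, List.prod_cons, map_mul, hf, MulOpposite.unop_mul, MulOpposite.unop_op,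
      Module.End.mul_apply, coactOpGen_tmul, map_sum, sum_fin_cons]
    refine Finset.sum_congr rfl fun j _ => ?_
    rw [ih (fun s => a s.succ)]
    refine Finset.sum_congr rfl fun c _ => ?_
    rw [List.ofFn_succ, List.ofFn_succ]
    simp only [Fin.cons_zero, Fin.cons_succ, List.prod_cons, List.reverse_cons, List.prod_append,
      List.prod_nil, mul_one, Module.End.mul_apply, mul_assoc]

theorem coact_word_of_par_eq_zero {u : Matrix (Fin d) (Fin d) (Module.End K N)}
    {f : 𝒜 →ₐ[K] Module.End K (𝒜 ⊗[K] N)}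
    (hf : ∀ i, f (y i) = coactGen (fun _ => 0) y 1 u i) {k : ℕ} (a : Fin k → Fin d) (n : N) :
    coact f ((List.ofFn fun s => y (a s)).prod ⊗ₜ n) = ∑ c : Fin k → Fin d,
      (List.ofFn fun s => y (c s)).prod ⊗ₜ[K] (List.ofFn fun s => u (c s) (a s)).prod n := by
  rw [coact_word (isParityAut_one y) hf]
  refine Finset.sum_congr rfl fun c _ => ?_
  simp [wordSign]

theorem fin_cons_ite {X M : Type*} [DecidableEq X] [MonoidWithZero M] {k : ℕ}
    (e a : Fin (k + 1) → X) :
    (if e = a then (1 : M) else 0) =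
      (if e 0 = a 0 then 1 else 0) *
        if (fun s => e (Fin.succ s)) = fun s => a s.succ then 1 else 0 := by
  have : e = a ↔ e 0 = a 0 ∧ (fun s => e (Fin.succ s)) = fun s => a s.succ := by
    refine ⟨by rintro rfl; exact ⟨rfl, rfl⟩, fun h => funext fun s => ?_⟩
    refine Fin.cases h.1 (fun s => congrFun h.2 s) s
  by_cases h0 : e 0 = a 0 <;> simp [this, h0]

/-- The product telescopes from the inside: the innermost sum is an entry of `u v = 1`. This works
over a noncommutative ring only because the second word is reversed. -/
theorem sum_prod_mul_reverse_prod {𝓡 : Type*} [Ring 𝓡] {u v : Matrix (Fin d) (Fin d) 𝓡}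
    (huv : u * v = 1) {k : ℕ} (e a : Fin k → Fin d) :
    ∑ c : Fin k → Fin d, (List.ofFn fun s => u (e s) (c s)).prod *
      (List.ofFn fun s => v (c s) (a s)).reverse.prod = if e = a then 1 else 0 := by
  have h : ∀ i j, ∑ b, u i b * v b j = if i = j then 1 else 0 := fun i j => by
    rw [← Matrix.mul_apply, huv, Matrix.one_apply]
  induction k with
  | zero => simp [Subsingleton.elim e a]
  | succ k ih =>
    rw [sum_fin_cons]
    have e1 : ∀ (j : Fin d) (c : Fin k → Fin d),
        (List.ofFn fun s => u (e s) (Fin.cons (α := fun _ => Fin d) j c s)).prod *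
        (List.ofFn fun s => v (Fin.cons (α := fun _ => Fin d) j c s) (a s)).reverse.prod =
        u (e 0) j * ((List.ofFn fun s => u (e (Fin.succ s)) (c s)).prod *
          (List.ofFn fun s => v (c s) (a (Fin.succ s))).reverse.prod) * v j (a 0) := by
      intro j c
      rw [List.ofFn_succ, List.ofFn_succ]
      simp [mul_assoc]
    simp only [e1, ← Finset.mul_sum, ← Finset.sum_mul, ih (fun s => e (Fin.succ s))]
    rw [fin_cons_ite e a, ← h]
    by_cases h' : (fun s => e (Fin.succ s)) = fun s => a s.succ <;> simp [h']

theorem sum_reverse_prod_mul_prod {𝓡 : Type*} [Ring 𝓡] {u v : Matrix (Fin d) (Fin d) 𝓡}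
    (hvu : v * u = 1) {k : ℕ} (e a : Fin k → Fin d) :
    ∑ c : Fin k → Fin d, (List.ofFn fun s => v (e s) (c s)).reverse.prod *
      (List.ofFn fun s => u (c s) (a s)).prod = if e = a then 1 else 0 := by
  have h : ∀ i j, ∑ b, v i b * u b j = if i = j then 1 else 0 := fun i j => by
    rw [← Matrix.mul_apply, hvu, Matrix.one_apply]
  induction k with
  | zero => simp [Subsingleton.elim e a]
  | succ k ih =>
    rw [sum_fin_cons, Finset.sum_comm]
    have e1 : ∀ (j : Fin d) (c : Fin k → Fin d),
        (List.ofFn fun s => v (e s) (Fin.cons (α := fun _ => Fin d) j c s)).reverse.prod *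
        (List.ofFn fun s => u (Fin.cons (α := fun _ => Fin d) j c s) (a s)).prod =
        (List.ofFn fun s => v (e (Fin.succ s)) (c s)).reverse.prod *
          (v (e 0) j * u j (a 0)) * (List.ofFn fun s => u (c s) (a (Fin.succ s))).prod := by
      intro j c
      rw [List.ofFn_succ, List.ofFn_succ]
      simp [mul_assoc]
    simp only [e1, ← Finset.mul_sum, ← Finset.sum_mul, h]
    rw [fin_cons_ite e a, ← ih (fun s => e (Fin.succ s))]
    by_cases h' : e 0 = a 0 <;> simp [h']

theorem hom_ext_word {M : Type*} [AddCommGroup M] [Module K M]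
    (gen : Algebra.adjoin K (Set.range y) = ⊤) {φ ψ : 𝒜 ⊗[K] N →ₗ[K] M}
    (h : ∀ (k : ℕ) (a : Fin k → Fin d) (n : N), φ ((List.ofFn fun s => y (a s)).prod ⊗ₜ n) =
      ψ ((List.ofFn fun s => y (a s)).prod ⊗ₜ n)) : φ = ψ := by
  have hspan : Submodule.span K {v : 𝒜 | ∃ (k : ℕ) (a : Fin k → Fin d),
      v = (List.ofFn fun s => y (a s)).prod} = ⊤ := by
    refine submodule_eq_top_of_mul_left gen _
      (Submodule.subset_span ⟨0, Fin.elim0, by simp⟩) fun i v hv => ?_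
    induction hv using Submodule.span_induction with
    | zero => simp
    | add v w _ _ hv hw => rw [mul_add]; exact Submodule.add_mem _ hv hw
    | smul t v _ hv => rw [mul_smul_comm]; exact Submodule.smul_mem _ _ hv
    | mem v hv =>
      obtain ⟨k, a, rfl⟩ := hv
      refine Submodule.subset_span ⟨k + 1, Fin.cons i a, ?_⟩
      rw [List.ofFn_succ]
      simp
  refine TensorProduct.ext' fun v n => ?_
  have hv : v ∈ Submodule.span K {v : 𝒜 | ∃ (k : ℕ) (a : Fin k → Fin d),
      v = (List.ofFn fun s => y (a s)).prod} := by rw [hspan]; trivial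
  induction hv using Submodule.span_induction with
  | zero => simp
  | add v w _ _ hv hw => rw [TensorProduct.add_tmul, map_add, map_add, hv, hw]
  | smul t v _ hv => rw [← TensorProduct.smul_tmul', map_smul, map_smul, hv]
  | mem v hv => obtain ⟨k, a, rfl⟩ := hv; exact h k a n

section Inverse

variable {u v : Matrix (Fin d) (Fin d) (Module.End K N)} {f : 𝒜 →ₐ[K] Module.End K (𝒜 ⊗[K] N)}
  {f' : 𝒜 →ₐ[K] (Module.End K (𝒜 ⊗[K] N))ᵐᵒᵖ}

/-- It suffices to compare values on words, where the composite is the telescoping sum for `u v =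
1`. -/
theorem coact_coactOp (gen : Algebra.adjoin K (Set.range y) = ⊤)
    (hf : ∀ i, f (y i) = coactGen (fun _ => 0) y 1 u i)
    (hf' : ∀ i, f' (y i) = MulOpposite.op (coactOpGen y v i)) (huv : u * v = 1) :
    coact f ∘ₗ coactOp f' = LinearMap.id := by
  refine hom_ext_word gen fun k a n => ?_
  rw [LinearMap.comp_apply, coactOp_word hf', map_sum]
  simp only [coact_word_of_par_eq_zero hf, ← Module.End.mul_apply]
  rw [Finset.sum_comm]
  simp only [← TensorProduct.tmul_sum, ← LinearMap.sum_apply, sum_prod_mul_reverse_prod huv]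
  rw [Finset.sum_eq_single a] <;> simp +contextual

theorem coactOp_coact (gen : Algebra.adjoin K (Set.range y) = ⊤)
    (hf : ∀ i, f (y i) = coactGen (fun _ => 0) y 1 u i)
    (hf' : ∀ i, f' (y i) = MulOpposite.op (coactOpGen y v i)) (hvu : v * u = 1) :
    coactOp f' ∘ₗ coact f = LinearMap.id := by
  refine hom_ext_word gen fun k a n => ?_
  rw [LinearMap.comp_apply, coact_word_of_par_eq_zero hf, map_sum]
  simp only [coactOp_word hf', ← Module.End.mul_apply]
  rw [Finset.sum_comm]
  simp only [← TensorProduct.tmul_sum, ← LinearMap.sum_apply, sum_reverse_prod_mul_prod hvu]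
  rw [Finset.sum_eq_single a] <;> simp +contextual

end Inverse

end OppositeCoaction

/-! ### The inverse coaction on the Koszul complex -/

section InverseKoszul

variable {K : Type*} [Field K] {d : ℕ} {L : Type*} [Ring L] [Algebra K L]

/-- The quantum determinant with the factors in the reversed order. -/
def qdetRev (c : Fin d → Fin d → K) (Z : Matrix (Fin d) (Fin d) L) : L :=
  ∑ σ : Equiv.Perm (Fin d),
    (∏ i, ∏ j, if i < j ∧ σ j < σ i then c (σ i) (σ j) else 1) •
      (List.ofFn fun i => Z (σ i) i).reverse.prod

variable {𝒜 𝒮 : Type*} [Ring 𝒜] [Algebra K 𝒜] [Ring 𝒮] [Algebra K 𝒮]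
  {x : Fin d → 𝒜} {ξ : Fin d → 𝒮} {nil : Fin d → Prop} {c c' : Fin d → Fin d → K} {m n : ℕ}
  {Z T V : Matrix (Fin d) (Fin d) L}

theorem leftMatrix_mul_eq_one {U V : Matrix (Fin d) (Fin d) L} (h : U * V = 1) :
    leftMatrix K U * leftMatrix K V = 1 := by
  change (Algebra.lmul K L).mapMatrix U * (Algebra.lmul K L).mapMatrix V = 1
  rw [← map_mul, h, map_one]

theorem twistedMatrix_mul_eq_one {Z T : Matrix (Fin d) (Fin d) L} (h : Z * T = 1) :
    twistedMatrix (K := K) (fun _ => 0) (1 : 𝒮 →ₐ[K] 𝒮) Z *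
      twistedMatrix (fun _ => 0) (1 : 𝒮 →ₐ[K] 𝒮) T = 1 := by
  have h' : ∀ i j, ∑ a, Z i a * T a j = if i = j then 1 else 0 := fun i j => by
    rw [← Matrix.mul_apply, h, Matrix.one_apply]
  refine Matrix.ext fun i j => TensorProduct.ext' fun s l => ?_
  rw [Matrix.mul_apply, LinearMap.sum_apply]
  simp only [Module.End.mul_apply, twistedMatrix_tmul, one_pow, AlgHom.one_apply, ← mul_assoc]
  rw [← TensorProduct.tmul_sum, ← Finset.sum_mul, h', Matrix.one_apply]
  split_ifs <;> simp

theorem reverse_leftMatrix_word (U : Matrix (Fin d) (Fin d) L) {k : ℕ} (c a : Fin k → Fin d)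
    (h : L) : (List.ofFn fun s => leftMatrix K U (c s) (a s)).reverse.prod h =
      (List.ofFn fun s => U (c s) (a s)).reverse.prod * h := by
  have : (List.ofFn fun s => leftMatrix K U (c s) (a s)).reverse.prod =
      Algebra.lmul K L (List.ofFn fun s => U (c s) (a s)).reverse.prod := by
    rw [map_list_prod, List.map_reverse, List.map_ofFn]; rfl
  rw [this]; rfl

theorem reverse_twistedMatrix_word (Z : Matrix (Fin d) (Fin d) L) {k : ℕ} (c a : Fin k → Fin d)
    (s : 𝒮) (h : L) :
    (List.ofFn fun u => twistedMatrix (K := K) (fun _ => 0) (1 : 𝒮 →ₐ[K] 𝒮) Z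
      (c u) (a u)).reverse.prod (s ⊗ₜ h) =
      s ⊗ₜ[K] ((List.ofFn fun u => Z (c u) (a u)).reverse.prod * h) := by
  induction k generalizing h with
  | zero => simp
  | succ k ih =>
    rw [List.ofFn_succ, List.reverse_cons, List.prod_append, List.prod_singleton,
      Module.End.mul_apply, twistedMatrix_tmul, one_pow, AlgHom.one_apply,
      ih (fun u => c u.succ) (fun u => a u.succ), List.ofFn_succ,
      List.reverse_cons, List.prod_append, List.prod_singleton, mul_assoc]

/-- The coefficient of the inverse coaction at the generator of the cohomology. -/
theorem topCoeffL_coactOp (hx : IsQAffinePresentation c nil x)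
    (hξ : IsQAffinePresentation c' (fun i => ¬ nil i) ξ)
    {f' : 𝒜 →ₐ[K] (Module.End K (𝒜 ⊗[K] (𝒮 ⊗[K] L)))ᵐᵒᵖ}
    {g' : 𝒮 →ₐ[K] (Module.End K (𝒮 ⊗[K] L))ᵐᵒᵖ}
    (hf' : ∀ i, f' (x i) = MulOpposite.op (coactOpGen x (twistedMatrix (fun _ => 0) 1 T) i))
    (hg' : ∀ i, g' (ξ i) = MulOpposite.op (coactOpGen ξ (leftMatrix K V) i))
    (ι : Fin m ↪o Fin d) (hι : ∀ i, nil i ↔ i ∈ Set.range ι) (κ : Fin n ↪o Fin d)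
    (hκ : ∀ i, ¬ nil i ↔ i ∈ Set.range κ) (h : L) :
    topCoeffL L hx hξ ((TensorProduct.assoc K 𝒜 𝒮 L).symm ((coactOp g').lTensor 𝒜 (coactOp f'
      (omon x (topExp nil) ⊗ₜ (omon ξ (topExp fun i => ¬ nil i) ⊗ₜ h))))) =
      qdetRev (fun i j => c' (κ i) (κ j)) (V.submatrix κ κ) *
        qdetRev (fun i j => c (ι i) (ι j)) (T.submatrix ι ι) * h := by
  classical
  rw [← hx.prod_orderEmbedding ι hι, ← hξ.prod_orderEmbedding κ hκ, coactOp_word hf', map_sum,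
    map_sum, map_sum]
  simp only [reverse_twistedMatrix_word, LinearMap.lTensor_tmul, coactOp_word hg',
    reverse_leftMatrix_word, TensorProduct.tmul_sum, map_sum, topCoeffL_assoc_symm, hx.coeff_word,
    hξ.coeff_word]
  simp only [← Finset.smul_sum]
  rw [sum_topWords ι hι fun w => ∑ w' : Fin n → Fin d,
    (if wordCount w' = topExp (fun i => ¬ nil i) then wordCoef c' w' else 0) •
      ((List.ofFn fun v => V (w' v) (κ v)).reverse.prod *
        ((List.ofFn fun u => T (w u) (ι u)).reverse.prod * h))]
  simp only [sum_topWords κ hκ, qdetRev, Finset.sum_mul, Finset.smul_sum, Finset.mul_sum,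
    smul_mul_assoc, mul_smul_comm, mul_assoc, Matrix.submatrix_apply]

/-- For an ordinary quantum matrix `Z` with inverse `T`, such that the transpose of `T` has an
inverse as well, the coaction on the cohomology is invertible. -/
theorem qdet_mul_qdet_mul_qdetRev_mul_qdetRev.{u₁, u₂, u₃, u₄} {K : Type u₁} [Field K] {d m n : ℕ}
    {L : Type u₂} [Ring L] [Algebra K L] {𝒜 : Type u₃} {𝒮 : Type u₄} [Ring 𝒜] [Algebra K 𝒜]
    [Ring 𝒮] [Algebra K 𝒮] {x : Fin d → 𝒜} {ξ : Fin d → 𝒮} {nil : Fin d → Prop}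
    {c c' : Fin d → Fin d → K} {Z T V : Matrix (Fin d) (Fin d) L}
    {P : Fin d → Fin d → Fin d → Fin d → K} {μ μ' : K}
    (hP : PreservesPairs P)
    (h𝒜 : IsQuadraticAlgebra.{u₁, u₃, max u₂ u₃ u₄} P μ x)
    (h𝒮 : IsQuadraticAlgebra.{u₁, u₄, max u₂ u₄} (dualTensor P) μ' ξ)
    (hx : IsQAffinePresentation c nil x)
    (hξ : IsQAffinePresentation c' (fun i => ¬ nil i) ξ)
    (hcc' : ∀ i j, i ≠ j → c i j * c' j i = -1)
    (ι : Fin m ↪o Fin d) (hι : ∀ i, nil i ↔ i ∈ Set.range ι) (κ : Fin n ↪o Fin d)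
    (hκ : ∀ i, ¬ nil i ↔ i ∈ Set.range κ)
    (hZ : IsQuantumMatrix P Z) (hZT : Z * T = 1) (hTZ : T * Z = 1)
    (hTV : T.transpose * V = 1) (hVT : V * T.transpose = 1) :
    (qdet (fun i j => c (ι i) (ι j)) (Z.submatrix ι ι) *
        qdet (fun i j => c' (κ i) (κ j)) (T.submatrix κ κ).transpose) *
      (qdetRev (fun i j => c' (κ i) (κ j)) (V.submatrix κ κ) *
        qdetRev (fun i j => c (ι i) (ι j)) (T.submatrix ι ι)) = 1 ∧
    (qdetRev (fun i j => c' (κ i) (κ j)) (V.submatrix κ κ) *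
        qdetRev (fun i j => c (ι i) (ι j)) (T.submatrix ι ι)) *
      (qdet (fun i j => c (ι i) (ι j)) (Z.submatrix ι ι) *
        qdet (fun i j => c' (κ i) (κ j)) (T.submatrix κ κ).transpose) = 1 := by
  have hZ' : IsQuantumSuperMatrix (fun _ => 0) P Z := hZ
  have hT : IsQuantumSuperMatrix (fun _ => 0) (dualTensor P) T.transpose := by
    convert isQuantumSuperMatrix_dual hP
      ((isQuantumSuperMatrix_iff.1 hZ').superSquareInv hZT hTZ) using 1
    ext j i; simp
  have hu := isQuantumSuperMatrix_twistedMatrix (τ := (1 : 𝒮 →ₐ[K] 𝒮)) hP hZ'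
  have hw : IsQuantumSuperMatrix (fun _ => 0) (dualTensor P) (leftMatrix K T.transpose) :=
    hT.map (Algebra.lmul K L)
  have hu1 := twistedMatrix_mul_eq_one (K := K) (𝒮 := 𝒮) hZT
  have hu2 := twistedMatrix_mul_eq_one (K := K) (𝒮 := 𝒮) hTZ
  have hw1 := leftMatrix_mul_eq_one (K := K) hTV
  have hw2 := leftMatrix_mul_eq_one (K := K) hVT
  obtain ⟨f, hf⟩ := h𝒜.lift _ (quadraticRel_coactGen hP h𝒜.rel (isParityAut_one x) hu)
  obtain ⟨g, hg⟩ := h𝒮.lift _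
    (quadraticRel_coactGen hP.dualTensor h𝒮.rel (isParityAut_one ξ) hw)
  obtain ⟨f', hf'⟩ := h𝒜.lift _ (quadraticRel_coactOpGen h𝒜.rel
    ((isQuantumSuperMatrix_iff.1 hu).superSquareInv hu1 hu2))
  obtain ⟨g', hg'⟩ := h𝒮.lift _ (quadraticRel_coactOpGen h𝒮.rel
    ((isQuantumSuperMatrix_iff.1 hw).superSquareInv hw1 hw2))
  have H : IsKoszulCoaction (fun _ => 0) x ξ 1 1 Z T f g := ⟨hf, hg⟩
  set G : (𝒜 ⊗[K] 𝒮) ⊗[K] L →ₗ[K] (𝒜 ⊗[K] 𝒮) ⊗[K] L :=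
    (TensorProduct.assoc K _ _ _).symm.toLinearMap ∘ₗ koszulG f g ∘ₗ
      (TensorProduct.assoc K _ _ _).toLinearMap with hG
  set G' : (𝒜 ⊗[K] 𝒮) ⊗[K] L →ₗ[K] (𝒜 ⊗[K] 𝒮) ⊗[K] L :=
    (TensorProduct.assoc K _ _ _).symm.toLinearMap ∘ₗ ((coactOp g').lTensor 𝒜 ∘ₗ coactOp f') ∘ₗ
      (TensorProduct.assoc K _ _ _).toLinearMap with hG'
  have hg1 : ∀ w, (coact g).lTensor 𝒜 ((coactOp g').lTensor 𝒜 w) = w := fun w => by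
    rw [← LinearMap.comp_apply, ← LinearMap.lTensor_comp, coact_coactOp h𝒮.gen hg hg' hw1,
      LinearMap.lTensor_id, LinearMap.id_apply]
  have hg2 : ∀ w, (coactOp g').lTensor 𝒜 ((coact g).lTensor 𝒜 w) = w := fun w => by
    rw [← LinearMap.comp_apply, ← LinearMap.lTensor_comp, coactOp_coact h𝒮.gen hg hg' hw2,
      LinearMap.lTensor_id, LinearMap.id_apply]
  have hf1 : ∀ w, coact f (coactOp f' w) = w :=
    LinearMap.congr_fun (coact_coactOp h𝒜.gen hf hf' hu1)
  have hf2 : ∀ w, coactOp f' (coact f w) = w :=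
    LinearMap.congr_fun (coactOp_coact h𝒜.gen hf hf' hu2)
  have hGG' : ∀ w, G (G' w) = w := fun w => by
    simp [hG, hG', koszulG, hg1, hf1]
  have hG'G : ∀ w, G' (G w) = w := fun w => by
    simp [hG, hG', koszulG, hg2, hf2]
  set D := (diffl K x ξ).rTensor L with hD
  have hGD : ∀ w, G (D w) = D (G w) := by
    intro w
    apply (TensorProduct.assoc K _ _ _).injective
    simp only [hG, hD, LinearMap.comp_apply, LinearEquiv.coe_coe, LinearEquiv.apply_symm_apply,
      assoc_rTensor_diffl]
    refine koszulG_diffl' (isParityAut_one x) (isParityAut_one ξ) hx.gen H (fun i j => ?_) _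
    have := congrFun (congrFun hZT j) i
    rw [Matrix.mul_apply, Matrix.one_apply] at this
    simpa [eq_comm] using this
  have hG'D : ∀ w, G' (D w) = D (G' w) := fun w => by
    rw [← hG'G (D (G' w)), hGD, hGG']
  set e := bimon K x ξ (topExp nil) (topExp fun i => ¬ nil i) with he
  have he0 : ∀ h : L, D (e ⊗ₜ h) = 0 := fun h => by
    rw [hD, LinearMap.rTensor_tmul, he, diffl_top hx hξ, TensorProduct.zero_tmul]
  set φ := topCoeffL L hx hξ with hφ
  have hφD : ∀ w, φ (D w) = 0 := topCoeffL_diffl hx hξ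
  have hφe : ∀ h, φ (e ⊗ₜ h) = h := fun b => by
    rw [hφ, topCoeffL_tmul, he, topCoeff_bimon, if_pos ⟨rfl, rfl⟩, one_smul]
  have hG1 := fun h => topCoeffL_koszulG hx hξ (isParityAut_one x) (isParityAut_one ξ)
    (fun _ _ _ => rfl) H ι hι κ hκ h
  have hG'1 := topCoeffL_coactOp hx hξ hf' hg' ι hι κ hκ
  change ∀ h, φ (G (e ⊗ₜ h)) = _ at hG1
  change ∀ h, φ (G' (e ⊗ₜ h)) = _ at hG'1
  -- Modulo coboundaries `F' (e ⊗ 1)` is `e ⊗ φ (F' (e ⊗ 1))`. Applying `F` returns `e ⊗ 1`, and `φ`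
  -- does not see the coboundary. Both orders of `G` and `G'` are used, giving a two-sided inverse.
  have key : ∀ F F' : (𝒜 ⊗[K] 𝒮) ⊗[K] L →ₗ[K] (𝒜 ⊗[K] 𝒮) ⊗[K] L, (∀ w, F (D w) = D (F w)) →
      (∀ w, F' (D w) = D (F' w)) → (∀ w, F (F' w) = w) → φ (F (e ⊗ₜ φ (F' (e ⊗ₜ 1)))) = 1 := by
    intro F F' h1 h2 h3
    obtain ⟨w, hw⟩ := sub_topCoeffL_mem_range hx hξ hcc' (w := F' (e ⊗ₜ 1))
      (by change D _ = 0; rw [← h2, he0, map_zero])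
    have h4 := congrArg (fun v => φ (F v)) hw
    change φ (F (D w)) = φ (F (F' (e ⊗ₜ 1) - e ⊗ₜ φ (F' (e ⊗ₜ 1)))) at h4
    rw [h1, hφD, map_sub, map_sub, h3, hφe] at h4
    exact (sub_eq_zero.1 h4.symm).symm
  have k1 := key G G' hGD hG'D hGG'
  have k2 := key G' G hG'D hGD hG'G
  rw [hG1, hG'1, mul_one] at k1
  rw [hG1, hG'1, mul_one] at k2
  exact ⟨k1, k2⟩

end InverseKoszul

/-! ### The crossing relations between a quantum matrix and its inverse -/

section Crossing

variable {K : Type*} [Field K] {d : ℕ} {L : Type*} [Ring L] [Algebra K L]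

/-- Multiply `P Z₁ Z₂ = Z₁ Z₂ P` by `Z₁⁻¹` on the left and by `Z₂⁻¹` on the right. -/
theorem IsQuantumMatrix.crossing {P : Fin d → Fin d → Fin d → Fin d → K}
    {Z T : Matrix (Fin d) (Fin d) L} (hZ : IsQuantumMatrix P Z) (hZT : Z * T = 1)
    (hTZ : T * Z = 1) (k l i j : Fin d) :
    ∑ a, ∑ b, P a l b j • (T k a * Z b i) = ∑ a, ∑ b, P k a i b • (Z l a * T b j) := by
  have h1 : ∀ i j, ∑ a, Z i a * T a j = if i = j then 1 else 0 := fun i j => by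
    rw [← Matrix.mul_apply, hZT, Matrix.one_apply]
  have h2 : ∀ i j, ∑ a, T i a * Z a j = if i = j then 1 else 0 := fun i j => by
    rw [← Matrix.mul_apply, hTZ, Matrix.one_apply]
  have hZ' : ∀ k l i j, ∑ a, ∑ b, P k l a b • (Z a i * Z b j) =
      ∑ a, ∑ b, P a b i j • (Z k a * Z l b) := by
    simpa [IsQuantumMatrix, IsQuantumSuperMatrix] using hZ
  have e1 : ∀ a, ∑ e, T k a * (∑ b, ∑ f, P a l b f • (Z b i * Z f e)) * T e j =
      ∑ b, P a l b j • (T k a * Z b i) := by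
    intro a
    simp only [Finset.mul_sum, Finset.sum_mul]
    rw [Finset.sum_comm]
    refine Finset.sum_congr rfl fun b _ => ?_
    rw [Finset.sum_comm]
    have : ∀ f, ∑ e, T k a * (P a l b f • (Z b i * Z f e)) * T e j =
        P a l b f • (T k a * Z b i * if f = j then 1 else 0) := fun f => by
      simp only [← h1, Finset.mul_sum, Finset.smul_sum, mul_smul_comm, smul_mul_assoc, mul_assoc]
    rw [Finset.sum_congr rfl fun f _ => this f]
    simp
  have e2 : ∀ e, ∑ a, T k a * (∑ c, ∑ f, P c f i e • (Z a c * Z l f)) * T e j =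
      ∑ f, P k f i e • (Z l f * T e j) := by
    intro e
    simp only [Finset.mul_sum, Finset.sum_mul]
    rw [Finset.sum_comm]
    have : ∀ c, ∑ a, ∑ f, T k a * (P c f i e • (Z a c * Z l f)) * T e j =
        ∑ f, P c f i e • ((if k = c then 1 else 0) * (Z l f * T e j)) := fun c => by
      rw [Finset.sum_comm]
      refine Finset.sum_congr rfl fun f _ => ?_
      simp only [← h2, Finset.sum_mul, Finset.smul_sum, mul_smul_comm, smul_mul_assoc, mul_assoc]
    simp only [this]
    rw [Finset.sum_eq_single k] <;> simp +contextual [eq_comm]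
  simp only [← e1, hZ']
  rw [Finset.sum_comm]
  simp only [e2]
  rw [Finset.sum_comm]

/-- When `l ≠ j` and `k ≠ i` only the flip terms remain, so the entries of `Z` and `T` commute up to
a ratio of scalars. The diagonal terms are what leads to the inverse of the transpose. -/
theorem IsQuantumMatrix.crossing_of_diag_flip {P : Fin d → Fin d → Fin d → Fin d → K}
    {dg fl : Fin d → Fin d → K}
    (hP : ∀ k l i j, P k l i j = dg i j * (if k = i ∧ l = j then 1 else 0) +
      fl i j * (if k = j ∧ l = i then 1 else 0))
    {Z T : Matrix (Fin d) (Fin d) L} (hZ : IsQuantumMatrix P Z) (hZT : Z * T = 1)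
    (hTZ : T * Z = 1) (k l i j : Fin d) :
    (if l = j then ∑ a, dg a j • (T k a * Z a i) else 0) + fl l j • (T k j * Z l i) =
      (if k = i then ∑ b, dg i b • (Z l b * T b j) else 0) + fl i k • (Z l i * T k j) := by
  have h := hZ.crossing hZT hTZ k l i j
  have e1 : ∀ a b, P a l b j • (T k a * Z b i) =
      (if a = b then if l = j then dg a j • (T k a * Z a i) else 0 else 0) +
      (if a = j then if l = b then fl l j • (T k j * Z l i) else 0 else 0) := by
    intro a b
    rw [hP, add_smul]
    congr 1
    · by_cases h1 : a = b <;> by_cases h2 : l = j <;> simp [h1, h2]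
    · by_cases h1 : a = j <;> by_cases h2 : l = b <;> simp [h1, h2]
  have e2 : ∀ a b, P k a i b • (Z l a * T b j) =
      (if a = b then if k = i then dg i a • (Z l a * T a j) else 0 else 0) +
      (if a = i then if k = b then fl i k • (Z l i * T k j) else 0 else 0) := by
    intro a b
    rw [hP, add_smul]
    congr 1
    · by_cases h1 : a = b <;> by_cases h2 : k = i <;> simp [h1, h2]
    · by_cases h1 : a = i <;> by_cases h2 : k = b <;> simp [h1, h2]
  simp only [e1, e2, Finset.sum_add_distrib, Finset.sum_ite_eq, Finset.sum_ite_irrel,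
    Finset.sum_const_zero, Finset.mem_univ, if_true] at h
  simpa [Finset.sum_ite_irrel] using h

/-- A weighted version of the inverse relations, with the factors interchanged. -/
theorem sum_weight_smul {ρ : Fin d → Fin d → K} {w : Fin d → K}
    (hw : ∀ a, ∑ b, ρ a b * w b = 1)
    (hinj : ∀ G : Fin d → L, (∀ a, ∑ b, ρ a b • G b = 0) → ∀ a, G a = 0) {s : Fin d → Fin d → K}
    (hs : ∀ i k, s i k ≠ 0) {M N : Fin d → Fin d → Fin d → L}
    (hN : ∀ i k, ∑ a, N a i k = if i = k then 1 else 0)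
    (h1 : ∀ b i k, i ≠ k → s i k • M b i k = ∑ a, ρ a b • N a i k)
    (h2 : ∀ b i, ∑ a, ρ i a • M b a a = ∑ a, ρ a b • N a i i) (i k : Fin d) :
    ∑ b, w b • M b i k = if i = k then w i • 1 else 0 := by
  -- The weights are chosen so that all columns of coefficients sum to `1`, which turns the weighted
  -- sum back into the known inverse relation. For `i = k` only `ρ`-combinations of the desired sums
  -- are known, hence the injectivity of `ρ`.
  have hsum : ∀ i k, ∑ b, w b • ∑ a, ρ a b • N a i k = if i = k then 1 else 0 := by
    intro i k
    rw [← hN]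
    simp only [Finset.smul_sum]
    rw [Finset.sum_comm]
    refine Finset.sum_congr rfl fun a _ => ?_
    simp only [smul_smul]
    rw [← Finset.sum_smul]
    simp only [mul_comm (w _), hw, one_smul]
  by_cases hik : i = k
  · subst hik
    rw [if_pos rfl]
    refine sub_eq_zero.1 (hinj (fun i => ∑ b, w b • M b i i - w i • 1) (fun a => ?_) i)
    have : ∑ c, ρ a c • (∑ b, w b • M b c c) = 1 := by
      simp only [Finset.smul_sum]
      rw [Finset.sum_comm]
      simp only [smul_comm (ρ _ _) (w _), ← Finset.smul_sum, h2, hsum, if_true]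
    simp only [smul_sub, Finset.sum_sub_distrib, this, smul_smul, ← Finset.sum_smul, hw, one_smul,
      sub_self]
  · rw [if_neg hik]
    have := hsum i k
    rw [if_neg hik] at this
    simp only [← h1 _ i k hik, smul_comm (w _) (s i k)] at this
    rw [← Finset.smul_sum] at this
    exact (smul_eq_zero.1 this).resolve_left (hs i k)

/-- The system is triangular for the rank, so it has a unique solution; the explicit form is needed
to see that no weight vanishes. The factors `e` are `q` or `q⁻¹`, and the partial sums telescope. -/
theorem exists_weight {q : K} (hq : q ≠ 0) {rk : Fin d → ℤ} (hrk : Function.Injective rk)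
    {ρ : Fin d → Fin d → K} (hdiag : ∀ i, ρ i i = q ∨ ρ i i = -1)
    (hoff : ∀ i j, i ≠ j → ρ i j = if rk i < rk j then 0 else q - 1) :
    ∃ w : Fin d → K, (∀ i, w i ≠ 0) ∧ ∀ a, ∑ b, ρ a b * w b = 1 := by
  have hρ : ∀ i, ρ i i ≠ 0 := fun i => by rcases hdiag i with h | h <;> simp [h, hq]
  set e : Fin d → K := fun i => 1 - (q - 1) / ρ i i with he
  have he0 : ∀ i, e i ≠ 0 := fun i => by
    rcases hdiag i with h | h
    · have : e i = q⁻¹ := by rw [he]; simp only [h]; field_simp; ring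
      rw [this]; exact inv_ne_zero hq
    · have : e i = q := by rw [he]; simp only [h]; field_simp; ring
      rwa [this]
  set w : Fin d → K := fun i => (∏ j ∈ Finset.univ.filter (fun j => rk j < rk i), e j) / ρ i i
    with hw
  have key : ∀ s : Finset (Fin d), (q - 1) * ∑ j ∈ s,
      (∏ k ∈ s.filter (fun k => rk k < rk j), e k) / ρ j j = 1 - ∏ j ∈ s, e j := by
    intro s
    induction s using Finset.induction_on_max_value rk with
    | empty => simp
    | insert a s ha hmax ih =>
      have hlt : ∀ j ∈ s, rk j < rk a := fun j hj =>
        lt_of_le_of_ne (hmax j hj) fun h => ha (hrk h ▸ hj)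
      rw [Finset.sum_insert ha, Finset.prod_insert ha]
      have h1 : (insert a s).filter (fun k => rk k < rk a) = s := by
        ext k
        simp only [Finset.mem_filter, Finset.mem_insert]
        constructor
        · rintro ⟨rfl | hk, h⟩
          · exact absurd h (lt_irrefl _)
          · exact hk
        · exact fun hk => ⟨Or.inr hk, hlt k hk⟩
      have h2 : ∀ j ∈ s, (insert a s).filter (fun k => rk k < rk j) =
          s.filter fun k => rk k < rk j := by
        intro j hj
        rw [Finset.filter_insert, if_neg (hlt j hj).not_gt]
      rw [h1, Finset.sum_congr rfl fun j hj => by rw [h2 j hj], mul_add, ih]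
      simp only [he]
      ring
  refine ⟨w, fun i => div_ne_zero (Finset.prod_ne_zero_iff.2 fun j _ => he0 j) (hρ i),
    fun a => ?_⟩
  rw [← Finset.add_sum_erase _ _ (Finset.mem_univ a)]
  have h1 : ρ a a * w a = ∏ j ∈ Finset.univ.filter (fun j => rk j < rk a), e j := by
    rw [hw]; exact mul_div_cancel₀ _ (hρ a)
  have h2 : ∑ b ∈ Finset.univ.erase a, ρ a b * w b =
      (q - 1) * ∑ b ∈ Finset.univ.filter (fun j => rk j < rk a), w b := by
    rw [Finset.mul_sum]
    symm
    apply Finset.sum_subset_zero_on_sdiff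
    · intro b hb
      simp only [Finset.mem_filter, Finset.mem_univ, true_and] at hb
      simp only [Finset.mem_erase, Finset.mem_univ, and_true]
      rintro rfl
      exact lt_irrefl _ hb
    · intro b hb
      simp only [Finset.mem_sdiff, Finset.mem_erase, Finset.mem_univ, and_true,
        Finset.mem_filter, true_and] at hb
      have : rk a < rk b := lt_of_le_of_ne (not_lt.1 hb.2) fun h => hb.1 (hrk h).symm
      rw [hoff a b (Ne.symm hb.1), if_pos this, zero_mul]
    · intro b hb
      simp only [Finset.mem_filter, Finset.mem_univ, true_and] at hb
      rw [hoff a b (by rintro rfl; exact lt_irrefl _ hb), if_neg hb.not_gt]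
  have h3 := key (Finset.univ.filter fun j => rk j < rk a)
  rw [h1, h2, ← eq_sub_iff_add_eq']
  rw [← h3]
  congr 1
  refine Finset.sum_congr rfl fun j hj => ?_
  simp only [Finset.mem_filter, Finset.mem_univ, true_and] at hj
  rw [hw]
  simp only
  congr 2
  ext k
  simp only [Finset.mem_filter, Finset.mem_univ, true_and]
  exact ⟨fun hk => ⟨hk.trans hj, hk⟩, fun hk => hk.2⟩

/-- Look at the row of an index of smallest rank with `G` nonzero: all its other terms vanish. -/
theorem eq_zero_of_triangular {rk : Fin d → ℤ} (hrk : Function.Injective rk)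
    {ρ : Fin d → Fin d → K} (hdiag : ∀ i, ρ i i ≠ 0)
    (hoff : ∀ i j, rk i < rk j → ρ i j = 0) (G : Fin d → L)
    (hG : ∀ a, ∑ b, ρ a b • G b = 0) (a : Fin d) : G a = 0 := by
  classical
  by_contra hne
  obtain ⟨i, hi, hmin⟩ := Finset.exists_min_image (Finset.univ.filter fun i => G i ≠ 0) rk
    ⟨a, by simp [hne]⟩
  simp only [Finset.mem_filter, Finset.mem_univ, true_and] at hi hmin
  have := hG i
  rw [Finset.sum_eq_single i] at this
  · exact hi ((smul_eq_zero.1 this).resolve_left (hdiag i))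
  · intro b _ hb
    by_cases h0 : G b = 0
    · rw [h0, smul_zero]
    · rw [hoff i b (lt_of_le_of_ne (hmin b h0) fun h => hb (hrk h).symm), zero_smul]
  · simp

open IsParameterSystem in
/-- The transpose of the inverse of a quantum matrix `Z` is invertible, and its inverse is
conjugate to the transpose of `Z` by a diagonal matrix. -/
theorem exists_inverse_transpose [CharZero K] {q : K} {p r : Fin d → Fin d → K}
    (h : IsParameterSystem q p r) {par : Fin d → ℕ} (hpar : ∀ i, par i = 0 ∨ par i = 1)
    {Z T : Matrix (Fin d) (Fin d) L} (hZ : IsQuantumMatrix (rMatrix par q p r) Z)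
    (hZT : Z * T = 1) (hTZ : T * Z = 1) :
    ∃ w : Fin d → K, (∀ i, w i ≠ 0) ∧
      T.transpose * Matrix.of (fun i j => (w j / w i) • Z j i) = 1 ∧
      Matrix.of (fun i j => (w j / w i) • Z j i) * T.transpose = 1 := by
  obtain ⟨rk, hrk, hpr⟩ := h.exists_rank
  set ρ : Fin d → Fin d → K := fun i j =>
    rDiag q p r i j + if i = j then rFlip par q p r i i else 0 with hρ
  have hdiag : ∀ i, ρ i i = q ∨ ρ i i = -1 := fun i => by
    have := h.diag_add_flip hpar i
    simp only [hρ, if_true, this]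
    split_ifs <;> simp
  have hq := h.q_ne_zero
  have hq1 := h.one_add_q_ne_zero
  have hoff : ∀ i j, i ≠ j → ρ i j = if rk i < rk j then 0 else q - 1 := fun i j hij => by
    simp only [hρ, if_neg hij, add_zero, rDiag, hpr i j hij]
    split_ifs
    · simp
    · have : q + 1 ≠ 0 := by rwa [add_comm]
      field_simp
      ring
  have hρ0 : ∀ i, ρ i i ≠ 0 := fun i => by rcases hdiag i with h | h <;> simp [h, hq]
  have hfl : ∀ i j, rFlip par q p r i j ≠ 0 := fun i j => by
    refine mul_ne_zero (pow_ne_zero _ (by norm_num)) (div_ne_zero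
      (mul_ne_zero (h.p_ne_zero i j) (by rwa [add_comm])) (h.one_add_ne_zero i j))
  have hcr := hZ.crossing_of_diag_flip (rMatrix_eq par q p r) hZT hTZ
  have hZT' : ∀ i j, ∑ a, Z i a * T a j = if i = j then 1 else 0 := fun i j => by
    rw [← Matrix.mul_apply, hZT, Matrix.one_apply]
  have hTZ' : ∀ i j, ∑ a, T j a * Z a i = if i = j then 1 else 0 := fun i j => by
    rw [← Matrix.mul_apply, hTZ, Matrix.one_apply]; simp only [eq_comm]
  obtain ⟨w, hw0, hw⟩ := exists_weight hq hrk hdiag hoff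
  -- The transposed system is triangular for the reversed rank. The weights `w` give a left inverse
  -- of the transpose of `T` and `w'` a right inverse; these must then coincide.
  obtain ⟨w', hw0', hw'⟩ := exists_weight (ρ := fun i j => ρ j i) (rk := fun i => -rk i) hq
    (fun i j hij => hrk (neg_injective hij)) hdiag
    (fun i j hij => by
      rw [hoff j i hij.symm]
      have : rk i ≠ rk j := hrk.ne hij
      split_ifs <;> first | rfl | omega)
  have s1 := sum_weight_smul (L := L) hw (fun G hG => eq_zero_of_triangular hrk hρ0
      (fun i j hij => by
        rw [hoff i j (by rintro rfl; exact lt_irrefl _ hij), if_pos hij]) G hG)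
      hfl (M := fun b i k => Z b i * T k b) (N := fun a i k => T k a * Z a i) hTZ'
      (fun b i k hik => by
        have := hcr k b i b
        rw [if_pos rfl, if_neg (Ne.symm hik), zero_add] at this
        rw [← this]
        simp [hρ, add_smul, Finset.sum_add_distrib, ite_smul])
      (fun b i => by
        have := hcr i b i b
        rw [if_pos rfl, if_pos rfl] at this
        simp [hρ, add_smul, Finset.sum_add_distrib, ite_smul, this])
  have s2 := sum_weight_smul (L := L) hw' (fun G hG => eq_zero_of_triangular
      (rk := fun i => -rk i) (ρ := fun i j => ρ j i) (fun i j hij => hrk (neg_injective hij)) hρ0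
      (fun i j hij => by
        rw [neg_lt_neg_iff] at hij
        rw [hoff j i (by rintro rfl; exact lt_irrefl _ hij), if_pos hij]) G hG)
      hfl (M := fun b i k => T b k * Z i b) (N := fun a i k => Z i a * T a k) hZT'
      (fun b i k hik => by
        have := hcr b i b k
        rw [if_neg hik, if_pos rfl, zero_add] at this
        rw [this]
        simp [hρ, add_smul, Finset.sum_add_distrib, ite_smul])
      (fun b i => by
        have := hcr b i b i
        rw [if_pos rfl, if_pos rfl] at this
        simp [hρ, add_smul, Finset.sum_add_distrib, ite_smul, ← this])
  have hVT : Matrix.of (fun i j => (w j / w i) • Z j i) * T.transpose = 1 := by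
    ext i k
    have e : ∀ b, (Matrix.of fun i j => (w j / w i) • Z j i) i b * T.transpose b k =
        (w i)⁻¹ • (w b • (Z b i * T k b)) := fun b => by
      rw [Matrix.of_apply, Matrix.transpose_apply, smul_mul_assoc, smul_smul, div_eq_inv_mul]
    rw [Matrix.mul_apply, Finset.sum_congr rfl fun b _ => e b, ← Finset.smul_sum, s1,
      Matrix.one_apply]
    split_ifs
    · rw [smul_smul, inv_mul_cancel₀ (hw0 i), one_smul]
    · simp
  have hTV : T.transpose * Matrix.of (fun i j => (w' i / w' j) • Z j i) = 1 := by
    ext j l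
    have e : ∀ b, T.transpose j b * (Matrix.of fun i j => (w' i / w' j) • Z j i) b l =
        (w' l)⁻¹ • (w' b • (T b j * Z l b)) := fun b => by
      rw [Matrix.of_apply, Matrix.transpose_apply, mul_smul_comm, smul_smul, div_eq_inv_mul]
    rw [Matrix.mul_apply, Finset.sum_congr rfl fun b _ => e b, ← Finset.smul_sum, s2,
      Matrix.one_apply]
    by_cases hlj : l = j
    · rw [if_pos hlj, if_pos hlj.symm, smul_smul, inv_mul_cancel₀ (hw0' l), one_smul]
    · rw [if_neg hlj, if_neg (Ne.symm hlj), smul_zero]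
  refine ⟨w, hw0, ?_, hVT⟩
  rw [left_inv_eq_right_inv hVT hTV]
  exact hTV

end Crossing

/-! ### Commuting determinants and diagonal conjugation -/

section Commutation

variable {K : Type*} [Field K] {L : Type*} [Ring L] [Algebra K L]

theorem prod_ofFn_smul {k : ℕ} (t : Fin k → K) (x : Fin k → L) :
    (List.ofFn fun i => t i • x i).prod = (∏ i, t i) • (List.ofFn x).prod := by
  induction k with
  | zero => simp
  | succ k ih =>
    rw [List.ofFn_succ, List.prod_cons, ih (fun i => t i.succ), Fin.prod_univ_succ,
      smul_mul_smul_comm, List.ofFn_succ, List.prod_cons]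

theorem smul_prod_mul {n : ℕ} {a : L} {b : Fin n → L} {s t : Fin n → K}
    (h : ∀ v, s v • (b v * a) = t v • (a * b v)) :
    (∏ v, s v) • ((List.ofFn b).prod * a) = (∏ v, t v) • (a * (List.ofFn b).prod) := by
  induction n with
  | zero => simp
  | succ n ih =>
    rw [List.ofFn_succ, List.prod_cons, Fin.prod_univ_succ, Fin.prod_univ_succ, mul_assoc, mul_smul,
      ← mul_smul_comm, ih fun v => h v.succ, mul_smul_comm, smul_comm, ← mul_assoc,
      ← smul_mul_assoc, h, smul_mul_assoc, mul_assoc, smul_smul, mul_comm (∏ i, _)]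

theorem smul_prod_mul_prod {m n : ℕ} {a : Fin m → L} {b : Fin n → L} {s t : Fin m → Fin n → K}
    (h : ∀ u v, s u v • (b v * a u) = t u v • (a u * b v)) :
    (∏ u, ∏ v, s u v) • ((List.ofFn b).prod * (List.ofFn a).prod) =
      (∏ u, ∏ v, t u v) • ((List.ofFn a).prod * (List.ofFn b).prod) := by
  induction m with
  | zero => simp
  | succ m ih =>
    rw [List.ofFn_succ, List.prod_cons, Fin.prod_univ_succ, Fin.prod_univ_succ, ← mul_assoc,
      mul_comm (∏ v, s 0 v), mul_smul, ← smul_mul_assoc, smul_prod_mul (h 0), smul_mul_assoc,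
      smul_comm, mul_assoc, ← mul_smul_comm, ih fun u => h u.succ, mul_smul_comm, smul_smul,
      mul_assoc]

/-- Interchanging a full product of entries of `A` with one of `B` multiplies by `F` over permuted
pairs on one side and over all pairs on the other. Both are the same product, so the scalars cancel.
-/
theorem commute_qdet {m n : ℕ} {A : Matrix (Fin m) (Fin m) L} {B : Matrix (Fin n) (Fin n) L}
    {F : Fin m → Fin n → K} (hF : ∀ u v, F u v ≠ 0)
    (h : ∀ l i j k, F l j • (B j k * A l i) = F i k • (A l i * B j k))
    (c : Fin m → Fin m → K) (c' : Fin n → Fin n → K) : Commute (qdet c A) (qdet c' B) := by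
  refine Commute.sum_left _ _ _ fun σ _ => Commute.sum_right _ _ _ fun σ' _ =>
    Commute.smul_left (Commute.smul_right ?_ _) _
  have := smul_prod_mul_prod (a := fun u => A (σ u) u) (b := fun v => B (σ' v) v)
    (fun u v => h (σ u) u (σ' v) v)
  have e : ∏ u, ∏ v, F (σ u) (σ' v) = ∏ u, ∏ v, F u v := by
    rw [Equiv.prod_comp σ fun u => ∏ v, F u (σ' v)]
    exact Finset.prod_congr rfl fun u _ => Equiv.prod_comp σ' fun v => F u v
  rw [e] at this
  exact (smul_right_injective L (Finset.prod_ne_zero_iff.2 fun u _ =>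
    Finset.prod_ne_zero_iff.2 fun v _ => hF u v) this).symm

theorem op_qdetRev {d : ℕ} (c : Fin d → Fin d → K) (Z : Matrix (Fin d) (Fin d) L) :
    MulOpposite.op (qdetRev c Z) = qdet c (Z.map MulOpposite.op) := by
  simp only [qdetRev, qdet, Finset.op_sum, MulOpposite.op_smul, MulOpposite.op_list_prod,
    List.map_reverse, List.reverse_reverse, List.map_ofFn]
  rfl

/-- Each monomial meets every row and every column once, so the weights cancel. -/
theorem qdet_conj {d : ℕ} (c : Fin d → Fin d → K) {w : Fin d → K} (hw : ∀ i, w i ≠ 0)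
    (Z : Matrix (Fin d) (Fin d) L) :
    qdet c (Matrix.of fun i j => (w j / w i) • Z i j) = qdet c Z := by
  refine Finset.sum_congr rfl fun σ _ => ?_
  simp only [Matrix.of_apply]
  rw [prod_ofFn_smul, Finset.prod_div_distrib, Equiv.prod_comp σ w,
    div_self (Finset.prod_ne_zero_iff.2 fun i _ => hw i), one_smul]

theorem qdetRev_conj {d : ℕ} (c : Fin d → Fin d → K) {w : Fin d → K} (hw : ∀ i, w i ≠ 0)
    (Z : Matrix (Fin d) (Fin d) L) :
    qdetRev c (Matrix.of fun i j => (w j / w i) • Z i j) = qdetRev c Z := by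
  apply MulOpposite.op_injective
  rw [op_qdetRev, op_qdetRev]
  exact qdet_conj c hw (Z.map MulOpposite.op)

end Commutation

open IsParameterSystem in
-- The inverse of the transpose of `T` is a diagonal conjugate of the transpose of `Z`, so its
-- determinant is that of the transpose itself. The commutation statements use crossing relations
-- with one even and one odd index on each side, where no diagonal term survives.
theorem qdet_relations_of_isQuantumMatrix {K : Type*} [Field K] [CharZero K] {d m n : ℕ}
    {L : Type*} [Ring L] [Algebra K L] {q : K} {p r : Fin d → Fin d → K}
    (h : IsParameterSystem q p r) {par : Fin d → ℕ} (hpar : ∀ i, par i = 0 ∨ par i = 1)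
    (ι : Fin m ↪o Fin d) (hι : ∀ i, par i = 0 ↔ i ∈ Set.range ι)
    (κ : Fin n ↪o Fin d) (hκ : ∀ i, ¬ par i = 0 ↔ i ∈ Set.range κ)
    {Z T : Matrix (Fin d) (Fin d) L} (hZ : IsQuantumMatrix (rMatrix par q p r) Z)
    (hZT : Z * T = 1) (hTZ : T * Z = 1) {α β γ τ : L}
    (hα : α = qdet (fun i j => cMinus par p (ι i) (ι j)) (Z.submatrix ι ι))
    (hβ : β = qdet (fun i j => cPlus par p (κ i) (κ j)) (T.submatrix κ κ).transpose)
    (hγ : γ = qdetRev (fun i j => cPlus par p (κ i) (κ j)) (Z.submatrix κ κ).transpose)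
    (hτ : τ = qdetRev (fun i j => cMinus par p (ι i) (ι j)) (T.submatrix ι ι)) :
    (α * β) * (γ * τ) = 1 ∧ (γ * τ) * (α * β) = 1 ∧ Commute α β ∧ Commute γ τ := by
  have hP := preservesPairs_rMatrix par q p r
  obtain ⟨w, hw, hTV, hVT⟩ := exists_inverse_transpose h hpar hZ hZT hTZ
  have hx : IsQAffinePresentation (cMinus par p) (fun i => par i = 0) (lx (rMatrix par q p r)) :=
    (isQuadraticAlgebra_lambda _).isQAffinePresentation
      (fun y => h.quadraticRel_neg_one_iff hpar y) fun i j _ => h.cMinus_inv par i j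
  have hξ : IsQAffinePresentation (cPlus par p) (fun i => ¬ par i = 0)
      (sxi q (rMatrix par q p r)) :=
    (isQuadraticAlgebra_sDual q _).isQAffinePresentation
      (fun y => h.quadraticRel_dual_q_iff hpar y) fun i j _ => h.cPlus_inv par i j
  have key := qdet_mul_qdet_mul_qdetRev_mul_qdetRev hP (isQuadraticAlgebra_lambda _)
    (isQuadraticAlgebra_sDual q _) hx hξ (fun i j _ => h.cMinus_mul_cPlus par i j) ι hι κ hκ hZ
    hZT hTZ hTV hVT
  have hγ' : qdetRev (fun i j => cPlus par p (κ i) (κ j))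
      ((Matrix.of fun i j => (w j / w i) • Z j i).submatrix κ κ) = γ := by
    rw [hγ]
    exact qdetRev_conj _ (w := fun i => w (κ i)) (fun i => hw _) (Z.submatrix κ κ).transpose
  rw [hγ', ← hα, ← hβ, ← hτ] at key
  have hq1 : q + 1 ≠ 0 := by rw [add_comm]; exact h.one_add_q_ne_zero
  have hfl : ∀ i j, rFlip par q p r i j ≠ 0 := fun i j =>
    mul_ne_zero (pow_ne_zero _ (by norm_num)) (div_ne_zero
      (mul_ne_zero (h.p_ne_zero i j) hq1) (h.one_add_ne_zero i j))
  have hne : ∀ u v, ι u ≠ κ v := fun u v huv =>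
    (hκ (κ v)).2 ⟨v, rfl⟩ ((hι _).2 ⟨u, huv⟩)
  have hcr := hZ.crossing_of_diag_flip (rMatrix_eq par q p r) hZT hTZ
  refine ⟨key.1, key.2, ?_, ?_⟩
  · rw [hα, hβ]
    refine commute_qdet (F := fun u v => rFlip par q p r (ι u) (κ v)) (fun u v => hfl _ _)
      (fun l i j k => ?_) _ _
    have := hcr (κ k) (ι l) (ι i) (κ j)
    rwa [if_neg (hne _ _), if_neg (hne _ _).symm, zero_add, zero_add] at this
  · apply Commute.symm
    apply MulOpposite.op_injective
    rw [MulOpposite.op_mul, MulOpposite.op_mul, hγ, hτ, op_qdetRev, op_qdetRev]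
    refine (commute_qdet (F := fun u v => (rFlip par q p r (κ v) (ι u))⁻¹)
      (fun u v => inv_ne_zero (hfl _ _)) (fun l i j k => ?_) _ _).symm
    have := hcr (ι l) (κ k) (κ j) (ι i)
    rw [if_neg (hne _ _), if_neg (hne _ _).symm, zero_add, zero_add] at this
    have h1 := hfl (κ k) (ι i)
    have h2 := hfl (κ j) (ι l)
    rw [inv_smul_eq_iff₀ h2, smul_comm, eq_inv_smul_iff₀ h1]
    apply MulOpposite.unop_injective
    exact this

/-! ### Reduction of super matrices to ordinary matrices over a larger algebra -/

section Unsigned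

variable {K : Type*} [Field K] {d : ℕ} {L E : Type*} [Ring L] [Algebra K L] [Ring E] [Algebra K E]

theorem mul_pow_of_anticomm {η f : E} (h : f * η = -(η * f)) (a b : ℕ) :
    f ^ a * η ^ b = (-1 : K) ^ (a * b) • (η ^ b * f ^ a) := by
  have h' : f * η = (-1 : K) • (η * f) := by rw [h, neg_one_smul]
  have h1 := mul_pow_smul_comm h' b
  have h2 := pow_mul_smul_comm h1 a
  rw [h2, ← pow_mul, mul_comm b a]

/-- An ordinary matrix over `E ⊗ L` built from a super matrix over `L` and anticommuting
elements of `E`. -/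
def unsignedMatrix (par : Fin d → ℕ) (η f : E) (Z : Matrix (Fin d) (Fin d) L) :
    Matrix (Fin d) (Fin d) (E ⊗[K] L) :=
  Matrix.of fun j i => (η ^ par j * f ^ par i) ⊗ₜ Z j i

/-- In a product of two entries, moving `f` past `η` produces the sign `(-1)^{par i * par b}`. This
differs from the super sign by one that depends only on a pair preserved by `P`, so it is constant
throughout the relation. -/
theorem isQuantumMatrix_unsignedMatrix {par : Fin d → ℕ} {P : Fin d → Fin d → Fin d → Fin d → K}
    (hP : PreservesPairs P) {Z : Matrix (Fin d) (Fin d) L} (hZ : IsQuantumSuperMatrix par P Z)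
    {η f : E} (h : f * η = -(η * f)) :
    IsQuantumMatrix P (unsignedMatrix (K := K) par η f Z) := by
  have hmul : ∀ a i b j, unsignedMatrix (K := K) par η f Z a i * unsignedMatrix par η f Z b j =
      (η ^ (par a + par b) * f ^ (par i + par j)) ⊗ₜ[K]
        ((-1 : K) ^ (par i * par b) • (Z a i * Z b j)) := by
    intro a i b j
    rw [unsignedMatrix, Matrix.of_apply, Matrix.of_apply, Algebra.TensorProduct.tmul_mul_tmul,
      mul_assoc, ← mul_assoc (f ^ _), mul_pow_of_anticomm (K := K) h, smul_mul_assoc,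
      mul_smul_comm, TensorProduct.smul_tmul, pow_add, pow_add]
    simp only [mul_assoc]
  intro k l i j
  have := congrArg (fun x => (-1 : K) ^ (par k * par l) •
    ((η ^ (par k + par l) * f ^ (par i + par j)) ⊗ₜ[K] x)) (hZ k l i j)
  simp only [TensorProduct.tmul_sum, Finset.smul_sum] at this
  simp only [zero_mul, pow_zero, one_mul, hmul]
  refine Eq.trans ?_ (this.trans ?_)
  · refine Finset.sum_congr rfl fun a _ => Finset.sum_congr rfl fun b _ => ?_
    rw [mul_comm _ (P _ _ _ _), mul_smul, TensorProduct.tmul_smul (P k l a b),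
      smul_comm _ (P k l a b), ← TensorProduct.tmul_smul ((-1 : K) ^ (par k * par l)), smul_smul,
      ← pow_add]
    refine hP.smul_congr (M := E ⊗[K] L) ?_ ?_
    · rintro rfl rfl
      congr 2
      apply neg_one_pow_congr_zmod
      push_cast
      generalize (par k : ZMod 2) = x
      generalize (par l : ZMod 2) = y
      generalize (par i : ZMod 2) = z
      revert x y z; decide
    · rintro rfl rfl
      rw [add_comm (par k)]
      congr 2
      apply neg_one_pow_congr_zmod
      push_cast
      generalize (par k : ZMod 2) = x
      generalize (par l : ZMod 2) = y
      generalize (par i : ZMod 2) = z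
      revert x y z; decide
  · refine Finset.sum_congr rfl fun a _ => Finset.sum_congr rfl fun b _ => ?_
    rw [mul_comm _ (P _ _ _ _), mul_smul, TensorProduct.tmul_smul (P a b i j),
      smul_comm _ (P a b i j), ← TensorProduct.tmul_smul ((-1 : K) ^ (par k * par l)), smul_smul,
      ← pow_add]
    refine hP.smul_congr (M := E ⊗[K] L) ?_ ?_
    · rintro rfl rfl
      congr 2
      apply neg_one_pow_congr_zmod
      push_cast
      generalize (par k : ZMod 2) = x
      generalize (par l : ZMod 2) = y
      generalize (par a : ZMod 2) = z
      revert x y z; decide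
    · rintro rfl rfl
      rw [add_comm (par b)]
      congr 2
      apply neg_one_pow_congr_zmod
      push_cast
      generalize (par k : ZMod 2) = x
      generalize (par l : ZMod 2) = y
      generalize (par a : ZMod 2) = z
      revert x y z; decide

/-- In the inverse the roles of `η` and `f` are exchanged, so the adjacent powers cancel for every
parity of the summation index. -/
theorem unsignedMatrix_mul_eq_one (par : Fin d → ℕ) {η f : E} (hη : η * η = 1) (hf : f * f = 1)
    {Z T : Matrix (Fin d) (Fin d) L} (h : Z * T = 1) :
    unsignedMatrix (K := K) par η f Z * unsignedMatrix par f η T = 1 := by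
  have h' : ∀ i j, ∑ a, Z i a * T a j = if i = j then 1 else 0 := fun i j => by
    rw [← Matrix.mul_apply, h, Matrix.one_apply]
  have hpow : ∀ {x : E}, x * x = 1 → ∀ a : ℕ, x ^ a * x ^ a = 1 := fun hx a => by
    rw [← (Commute.refl _).mul_pow, hx, one_pow]
  ext i j
  have e : ∀ a, unsignedMatrix (K := K) par η f Z i a * unsignedMatrix par f η T a j =
      (η ^ par i * η ^ par j) ⊗ₜ (Z i a * T a j) := fun a => by
    rw [unsignedMatrix, unsignedMatrix, Matrix.of_apply, Matrix.of_apply,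
      Algebra.TensorProduct.tmul_mul_tmul, mul_assoc, ← mul_assoc (f ^ _), hpow hf, one_mul]
  rw [Matrix.mul_apply, Finset.sum_congr rfl fun a _ => e a, ← TensorProduct.tmul_sum, h',
    Matrix.one_apply]
  by_cases hij : i = j
  · subst hij
    rw [if_pos rfl, if_pos rfl, hpow hη]; rfl
  · rw [if_neg hij, if_neg hij, TensorProduct.tmul_zero]

theorem prod_ofFn_tmul (e : E) {k : ℕ} (x : Fin k → L) :
    (List.ofFn fun i => e ⊗ₜ[K] x i).prod = (e ^ k) ⊗ₜ (List.ofFn x).prod := by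
  induction k with
  | zero => simp [Algebra.TensorProduct.one_def]
  | succ k ih =>
    rw [List.ofFn_succ, List.prod_cons, ih (fun i => x i.succ), List.ofFn_succ, List.prod_cons,
      Algebra.TensorProduct.tmul_mul_tmul, pow_succ']

theorem reverse_prod_ofFn_tmul (e : E) {k : ℕ} (x : Fin k → L) :
    (List.ofFn fun i => e ⊗ₜ[K] x i).reverse.prod = (e ^ k) ⊗ₜ (List.ofFn x).reverse.prod := by
  induction k with
  | zero => simp [Algebra.TensorProduct.one_def]
  | succ k ih =>
    rw [List.ofFn_succ, List.reverse_cons, List.prod_append, List.prod_singleton,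
      ih (fun i => x i.succ), List.ofFn_succ, List.reverse_cons, List.prod_append,
      List.prod_singleton, Algebra.TensorProduct.tmul_mul_tmul, pow_succ]

theorem qdet_tmul (c : Fin d → Fin d → K) (e : E) (Z : Matrix (Fin d) (Fin d) L) :
    qdet c (Matrix.of fun j i => e ⊗ₜ[K] Z j i) = (e ^ d) ⊗ₜ qdet c Z := by
  simp only [qdet, Matrix.of_apply, prod_ofFn_tmul, TensorProduct.tmul_sum,
    TensorProduct.tmul_smul]

theorem qdetRev_tmul (c : Fin d → Fin d → K) (e : E) (Z : Matrix (Fin d) (Fin d) L) :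
    qdetRev c (Matrix.of fun j i => e ⊗ₜ[K] Z j i) = (e ^ d) ⊗ₜ qdetRev c Z := by
  simp only [qdetRev, Matrix.of_apply, reverse_prod_ofFn_tmul, TensorProduct.tmul_sum,
    TensorProduct.tmul_smul]

open IsParameterSystem in
-- After passage to the ordinary matrix, even blocks are unchanged and odd blocks carry the constant
-- `η f` or `f η`. The determinants only pick up powers of these mutually inverse elements, which
-- are then removed by injectivity of `L → E ⊗ L`.
theorem qdet_relations {K : Type*} [Field K] [CharZero K] {d m n : ℕ}
    {L : Type*} [Ring L] [Algebra K L] {q : K} {p r : Fin d → Fin d → K}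
    (h : IsParameterSystem q p r) {par : Fin d → ℕ} (hpar : ∀ i, par i = 0 ∨ par i = 1)
    (ι : Fin m ↪o Fin d) (hι : ∀ i, par i = 0 ↔ i ∈ Set.range ι)
    (κ : Fin n ↪o Fin d) (hκ : ∀ i, ¬ par i = 0 ↔ i ∈ Set.range κ)
    {Z T : Matrix (Fin d) (Fin d) L} (hZ : IsQuantumSuperMatrix par (rMatrix par q p r) Z)
    (hZT : Z * T = 1) (hTZ : T * Z = 1) {α β γ τ : L}
    (hα : α = qdet (fun i j => cMinus par p (ι i) (ι j)) (Z.submatrix ι ι))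
    (hβ : β = qdet (fun i j => cPlus par p (κ i) (κ j)) (T.submatrix κ κ).transpose)
    (hγ : γ = qdetRev (fun i j => cPlus par p (κ i) (κ j)) (Z.submatrix κ κ).transpose)
    (hτ : τ = qdetRev (fun i j => cMinus par p (ι i) (ι j)) (T.submatrix ι ι)) :
    (α * β) * (γ * τ) = 1 ∧ (γ * τ) * (α * β) = 1 ∧ Commute α β ∧ Commute γ τ := by
  have hι0 : ∀ i, par (ι i) = 0 := fun i => (hι _).2 ⟨i, rfl⟩
  have hκ1 : ∀ i, par (κ i) = 1 := fun i => (hpar _).resolve_left ((hκ _).2 ⟨i, rfl⟩)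
  -- Two anticommuting involutions are needed; size two is enough.
  let η : Matrix (Fin 2) (Fin 2) K := !![1, 0; 0, -1]
  let f : Matrix (Fin 2) (Fin 2) K := !![0, 1; 1, 0]
  have hη : η * η = 1 := by ext i j; fin_cases i <;> fin_cases j <;> simp [η]
  have hf : f * f = 1 := by ext i j; fin_cases i <;> fin_cases j <;> simp [f]
  have hfη : f * η = -(η * f) := by ext i j; fin_cases i <;> fin_cases j <;> simp [f, η]
  have e1 : ∀ Z : Matrix (Fin d) (Fin d) L, ∀ η f : Matrix (Fin 2) (Fin 2) K,
      (unsignedMatrix (K := K) par η f Z).submatrix ι ι =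
        Matrix.of fun j i => (1 : Matrix (Fin 2) (Fin 2) K) ⊗ₜ[K] Z.submatrix ι ι j i := by
    intro Z η f
    ext j i
    simp [unsignedMatrix, hι0]
  have e2 : ∀ Z : Matrix (Fin d) (Fin d) L, ∀ η f : Matrix (Fin 2) (Fin 2) K,
      ((unsignedMatrix (K := K) par η f Z).submatrix κ κ).transpose =
        Matrix.of fun j i => (η * f) ⊗ₜ[K] (Z.submatrix κ κ).transpose j i := by
    intro Z η f
    ext j i
    simp [unsignedMatrix, hκ1]
  obtain ⟨h1, h2, h3, h4⟩ := qdet_relations_of_isQuantumMatrix h hpar ι hι κ hκ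
    (isQuantumMatrix_unsignedMatrix (preservesPairs_rMatrix par q p r) hZ hfη)
    (unsignedMatrix_mul_eq_one par hη hf hZT) (unsignedMatrix_mul_eq_one par hf hη hTZ)
    rfl rfl rfl rfl
  simp only [e1, e2, qdet_tmul, qdetRev_tmul, one_pow, ← hα, ← hβ, ← hγ, ← hτ] at h1 h2 h3 h4
  have w1 : (η * f) ^ n * (f * η) ^ n = 1 := by
    have : (η * f) * (f * η) = 1 := by rw [mul_assoc, ← mul_assoc f, hf, one_mul, hη]
    rw [← Commute.mul_pow, this, one_pow]
    rw [commute_iff_eq, this, mul_assoc, ← mul_assoc η, hη, one_mul, hf]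
  have w2 : (f * η) ^ n * (η * f) ^ n = 1 := mul_eq_one_comm.1 w1
  have hinj : Function.Injective fun x : L => (1 : Matrix (Fin 2) (Fin 2) K) ⊗ₜ[K] x :=
    Algebra.TensorProduct.includeRight_injective (algebraMap K (Matrix (Fin 2) (Fin 2) K)).injective
  refine ⟨hinj ?_, hinj ?_, hinj ?_, hinj ?_⟩
  · simpa only [Algebra.TensorProduct.tmul_mul_tmul, one_mul, mul_one, w2] using
      h1.trans Algebra.TensorProduct.one_def
  · simpa only [Algebra.TensorProduct.tmul_mul_tmul, one_mul, mul_one, w1] using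
      h2.trans Algebra.TensorProduct.one_def
  · have := congrArg (fun x => ((η * f) ^ n) ⊗ₜ[K] (1 : L) * x) h3
    simpa only [Algebra.TensorProduct.tmul_mul_tmul, one_mul, mul_one, w1] using this
  · have := congrArg (fun x => ((f * η) ^ n) ⊗ₜ[K] (1 : L) * x) h4
    simpa only [Algebra.TensorProduct.tmul_mul_tmul, one_mul, mul_one, w2] using this

end Unsigned

/-! ### Quantum determinants of ordinary quantum matrices -/

section ExteriorCoefficients

variable {K : Type*} [Field K] {d : ℕ} {c : Fin d → Fin d → K}

open Classical in
/-- The coefficient of a word with respect to the product of all generators in their natural order,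
when the squares of the generators vanish. -/
def extCoef (c : Fin d → Fin d → K) (f : Fin d → Fin d) : K :=
  if Function.Injective f then wordCoef c f else 0

theorem extCoef_of_not_injective {f : Fin d → Fin d} (h : ¬ Function.Injective f) :
    extCoef c f = 0 := if_neg h

theorem extCoef_id (c : Fin d → Fin d → K) : extCoef c (fun i => i) = 1 := by
  have h : Function.Injective fun i : Fin d => i := fun _ _ h => h
  rw [extCoef, if_pos h]
  exact wordCoef_orderEmbedding (RelEmbedding.refl (α := Fin d) (· ≤ ·))

theorem wordCoef_ne_zero (hc : ∀ i j, c i j ≠ 0) {k : ℕ} (f : Fin k → Fin d) :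
    wordCoef c f ≠ 0 := by
  refine Finset.prod_ne_zero_iff.2 fun u _ => Finset.prod_ne_zero_iff.2 fun v _ => ?_
  split_ifs
  · exact hc _ _
  · exact one_ne_zero

theorem sum_extCoef {M : Type*} [AddCommGroup M] [Module K M] (c : Fin d → Fin d → K)
    (F : (Fin d → Fin d) → M) :
    ∑ f, extCoef c f • F f = ∑ s : Equiv.Perm (Fin d),
      (∏ i, ∏ j, if i < j ∧ s j < s i then c (s i) (s j) else 1) • F s := by
  symm
  refine Finset.sum_of_injOn (fun s u => s u) ?_ ?_ ?_ ?_
  · intro s _ s' _ h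
    exact Equiv.ext fun u => congrFun h u
  · intro s _; simp
  · intro f _ hf
    rw [extCoef_of_not_injective, zero_smul]
    intro h
    exact hf ⟨Equiv.ofBijective f (Finite.injective_iff_bijective.1 h), by simp, rfl⟩
  · intro s _
    rw [extCoef, if_pos s.injective, wordCoef]

theorem qdet_eq_sum {L : Type*} [Ring L] [Algebra K L] (c : Fin d → Fin d → K)
    (X : Matrix (Fin d) (Fin d) L) :
    qdet c X = ∑ f, extCoef c f • (List.ofFn fun u => X (f u) u).prod :=
  (sum_extCoef c fun f => (List.ofFn fun u => X (f u) u).prod).symm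

theorem qdetRev_eq_sum {L : Type*} [Ring L] [Algebra K L] (c : Fin d → Fin d → K)
    (X : Matrix (Fin d) (Fin d) L) :
    qdetRev c X = ∑ f, extCoef c f • (List.ofFn fun u => X (f u) u).reverse.prod :=
  (sum_extCoef c fun f => (List.ofFn fun u => X (f u) u).reverse.prod).symm

theorem wordCount_of_bijective {f : Fin d → Fin d} (h : Function.Bijective f) :
    wordCount f = topExp fun _ => True := by
  funext i
  obtain ⟨u, rfl⟩ := h.2 i
  simp [wordCount_apply, topExp, h.1.eq_iff, Finset.filter_eq']

/-- In degree `d` every monomial other than the product of all generators contains a square. -/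
theorem IsQAffine.prod_word_of_nil {𝓑 : Type*} [Ring 𝓑] [Algebra K 𝓑] {y : Fin d → 𝓑}
    (h : IsQAffine c (fun _ => True) y) (f : Fin d → Fin d) :
    (List.ofFn fun u => y (f u)).prod = extCoef c f • omon y (topExp fun _ => True) := by
  rw [h.prod_word]
  by_cases hf : Function.Injective f
  · rw [wordCount_of_bijective (Finite.injective_iff_bijective.1 hf), extCoef, if_pos hf]
  · rw [extCoef_of_not_injective hf, zero_smul]
    simp only [Function.Injective, not_forall] at hf
    obtain ⟨u, v, huv, hne⟩ := hf
    rw [h.omon_eq_zero (i := f u) trivial, smul_zero]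
    rw [wordCount_apply, not_le, Finset.one_lt_card]
    exact ⟨u, by simp, v, by simp [huv], hne⟩

end ExteriorCoefficients

/-! ### Laplace expansion and Cramer's rule -/

section Cramer

/-- The relations given by `P` and `μ` are those of a quantum exterior algebra, as far as algebras
in a fixed universe are concerned. -/
structure IsExterior.{u, w} {K : Type u} [Field K] {d : ℕ} (P : Fin d → Fin d → Fin d → Fin d → K)
    (μ : K) (c : Fin d → Fin d → K) : Prop where
  inv : ∀ i j, c i j * c j i = 1
  iff_isQAffine : ∀ {𝓑 : Type w} [Ring 𝓑] [Algebra K 𝓑] (y : Fin d → 𝓑),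
    QuadraticRel P μ y ↔ IsQAffine c (fun _ => True) y

theorem IsExterior.ne_zero.{u, w} {K : Type u} [Field K] {d : ℕ}
    {P : Fin d → Fin d → Fin d → Fin d → K} {μ : K} {c : Fin d → Fin d → K}
    (h : IsExterior.{u, w} P μ c) (i j : Fin d) : c i j ≠ 0 :=
  left_ne_zero_of_mul (by rw [h.inv i j]; exact one_ne_zero)

theorem coactGen_word_apply {K : Type*} [Field K] {d : ℕ} {𝒜 : Type*} [Ring 𝒜] [Algebra K 𝒜]
    {N : Type*} [AddCommGroup N] [Module K N] (y : Fin d → 𝒜)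
    (u : Matrix (Fin d) (Fin d) (Module.End K N)) {k : ℕ} (a : Fin k → Fin d) (n : N) :
    (List.ofFn fun s => coactGen (fun _ => 0) y 1 u (a s)).prod (1 ⊗ₜ n) =
      ∑ c : Fin k → Fin d, (List.ofFn fun s => y (c s)).prod ⊗ₜ[K]
        (List.ofFn fun s => u (c s) (a s)).prod n := by
  induction k with
  | zero => simp
  | succ k ih =>
    rw [List.ofFn_succ, List.prod_cons, Module.End.mul_apply, ih (fun s => a s.succ),
      map_sum, sum_fin_cons, Finset.sum_comm]
    refine Finset.sum_congr rfl fun c _ => ?_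
    rw [coactGen_tmul]
    refine Finset.sum_congr rfl fun j _ => ?_
    rw [List.ofFn_succ, List.ofFn_succ]
    simp

variable {K : Type*} [Field K] {d : ℕ} {L : Type*} [Ring L] [Algebra K L]

/-- The coaction on the product of all generators of a quantum exterior algebra. -/
theorem IsQuantumMatrix.sum_word.{u, v} {K : Type u} [Field K] {d : ℕ} {L : Type v} [Ring L]
    [Algebra K L] {P : Fin d → Fin d → Fin d → Fin d → K} {μ : K} {c : Fin d → Fin d → K}
    (hP : PreservesPairs P) (h₁ : IsExterior.{u, u} P μ c) (h₂ : IsExterior.{u, max u v} P μ c)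
    {X : Matrix (Fin d) (Fin d) L} (hX : IsQuantumMatrix P X) (f : Fin d → Fin d) :
    ∑ g, extCoef c g • (List.ofFn fun u => X (g u) (f u)).prod = extCoef c f • qdet c X := by
  -- The monomial operators serve as a concrete exterior algebra, and `φ` reads off the top
  -- coefficient. The coacted generators satisfy the exterior relations as well, so their product
  -- along `f` is `extCoef c f` times the product in natural order.
  set y := ly c fun _ => True with hy
  have hy' : IsQAffine c (fun _ => True) y := isQAffine_ly (fun i j _ => h₁.inv i j) _
  have hX' : IsQuantumSuperMatrix (fun _ => 0) P X := hX
  have hη : IsQAffine c (fun _ => True) (coactGen (fun _ => 0) y 1 (leftMatrix K X)) :=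
    (h₂.iff_isQAffine _).1 (quadraticRel_coactGen hP ((h₁.iff_isQAffine y).2 hy')
      (isParityAut_one y) (hX'.map (Algebra.lmul K L)))
  let φ : Module.End K ((Fin d → ℕ) →₀ K) →ₗ[K] K :=
    Finsupp.lapply (topExp fun _ => True) ∘ₗ LinearMap.applyₗ (Finsupp.single 0 1)
  have hφ : φ (omon y (topExp fun _ => True)) = 1 := by
    have := model_omon hy' (Φ := AlgHom.id K _) (fun i => rfl) _ (adm_topExp fun _ => True)
    rw [AlgHom.id_apply] at this
    simp [φ, this]
  have key : ∀ f : Fin d → Fin d, (TensorProduct.lid K L) (φ.rTensor L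
      ((List.ofFn fun s => coactGen (fun _ => 0) y 1 (leftMatrix K X) (f s)).prod (1 ⊗ₜ 1))) =
      ∑ g, extCoef c g • (List.ofFn fun u => X (g u) (f u)).prod := by
    intro f
    rw [coactGen_word_apply]
    simp only [leftMatrix_word, hy'.prod_word_of_nil, map_sum, LinearMap.rTensor_tmul, map_smul,
      hφ, TensorProduct.lid_tmul, smul_eq_mul, mul_one]
  have h3 := key fun i => i
  rw [← qdet_eq_sum, hη.prod_word_of_nil, extCoef_id, one_smul] at h3
  rw [← key f, hη.prod_word_of_nil, LinearMap.smul_apply, map_smul, map_smul, h3]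

/-- The matrix over the opposite ring with the transposed entries. -/
theorem IsQuantumMatrix.transpose_op {P : Fin d → Fin d → Fin d → Fin d → K}
    {X : Matrix (Fin d) (Fin d) L} (hX : IsQuantumMatrix P X) :
    IsQuantumMatrix (dualTensor P) (X.transpose.map MulOpposite.op) := by
  have h : ∀ k l i j, ∑ a, ∑ b, P k l a b • (X a i * X b j) =
      ∑ a, ∑ b, P a b i j • (X k a * X l b) := by
    simpa [IsQuantumMatrix, IsQuantumSuperMatrix] using hX
  intro k l i j
  apply MulOpposite.unop_injective
  simp only [zero_mul, pow_zero, one_mul, Finset.unop_sum, MulOpposite.unop_smul,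
    MulOpposite.unop_mul, Matrix.map_apply, Matrix.transpose_apply, MulOpposite.unop_op, dualTensor]
  rw [Finset.sum_comm, ← h j i l k, Finset.sum_comm]

theorem qdetRev_map_op (c : Fin d → Fin d → K) (X : Matrix (Fin d) (Fin d) L) :
    qdetRev c (X.map MulOpposite.op) = MulOpposite.op (qdet c X) := by
  simp only [qdetRev, qdet, Finset.op_sum, MulOpposite.op_smul, MulOpposite.op_list_prod,
    List.map_ofFn]
  rfl

theorem reverse_ofFn {M : Type*} {k : ℕ} (x : Fin k → M) :
    (List.ofFn x).reverse = List.ofFn fun i => x i.rev := by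
  apply List.ext_getElem
  · simp
  · intro i h1 h2
    simp only [List.length_reverse, List.length_ofFn] at h1
    simp only [List.getElem_reverse, List.getElem_ofFn, List.length_ofFn]
    congr 1
    ext
    simp only [Fin.val_rev]
    omega

theorem IsQuantumMatrix.sum_word_transpose.{u, v} {K : Type u} [Field K] {d : ℕ} {L : Type v}
    [Ring L] [Algebra K L] {P : Fin d → Fin d → Fin d → Fin d → K} {μ : K} {c : Fin d → Fin d → K}
    (hP : PreservesPairs P) (h₁ : IsExterior.{u, u} (dualTensor P) μ c)
    (h₂ : IsExterior.{u, max u v} (dualTensor P) μ c)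
    {X : Matrix (Fin d) (Fin d) L} (hX : IsQuantumMatrix P X) (f : Fin d → Fin d) :
    ∑ g : Fin d → Fin d, extCoef c (fun u => g u.rev) • (List.ofFn fun u => X (f u) (g u)).prod =
      extCoef c (fun u => f u.rev) • qdetRev c X.transpose := by
  have h := congrArg MulOpposite.unop
    (hX.transpose_op.sum_word hP.dualTensor h₁ h₂ fun u => f u.rev)
  rw [← op_qdetRev] at h
  simp only [Finset.unop_sum, MulOpposite.unop_smul, MulOpposite.unop_op,
    MulOpposite.unop_list_prod, List.map_ofFn] at h
  rw [← h, ← (Equiv.arrowCongr Fin.revPerm (Equiv.refl (Fin d))).sum_comp]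
  refine Finset.sum_congr rfl fun g _ => ?_
  rw [reverse_ofFn]
  simp [Function.comp_def]

/-- The determinants built from the columns and from the rows agree up to a scalar. -/
theorem IsQuantumMatrix.smul_qdet.{u, v} {K : Type u} [Field K] {d : ℕ} {L : Type v}
    [Ring L] [Algebra K L] {P : Fin d → Fin d → Fin d → Fin d → K} {μ μ' : K}
    {c c' : Fin d → Fin d → K} (hP : PreservesPairs P) (h₁ : IsExterior.{u, u} P μ c)
    (h₂ : IsExterior.{u, max u v} P μ c) (h₁' : IsExterior.{u, u} (dualTensor P) μ' c')
    (h₂' : IsExterior.{u, max u v} (dualTensor P) μ' c')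
    {X : Matrix (Fin d) (Fin d) L} (hX : IsQuantumMatrix P X) :
    (∑ f : Fin d → Fin d, extCoef c f * extCoef c' fun u => f u.rev) • qdet c X =
      (∑ f : Fin d → Fin d, extCoef c f * extCoef c' fun u => f u.rev) •
        qdetRev c' X.transpose := by
  -- The same double sum over row words `g` and column words `f` is evaluated twice: the sum over
  -- `g` gives the column determinant, the sum over `f` the row determinant.
  calc _ = ∑ f : Fin d → Fin d, ∑ g : Fin d → Fin d, (extCoef c g * extCoef c' fun u => f u.rev) •
        (List.ofFn fun u => X (g u) (f u)).prod := by
        rw [Finset.sum_smul]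
        refine Finset.sum_congr rfl fun f _ => ?_
        rw [mul_comm, mul_smul, ← hX.sum_word hP h₁ h₂ f, Finset.smul_sum]
        simp only [smul_smul, mul_comm]
    _ = _ := by
        rw [Finset.sum_comm, Finset.sum_smul]
        refine Finset.sum_congr rfl fun f _ => ?_
        rw [mul_smul, ← hX.sum_word_transpose hP h₁' h₂' f, Finset.smul_sum]
        simp only [smul_smul]

/-- The determinant of a quantum matrix is inverse to the reversed determinant of its inverse. -/
theorem IsQuantumMatrix.qdet_mul_qdetRev.{u, v} {K : Type u} [Field K] {d : ℕ} {L : Type v}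
    [Ring L] [Algebra K L] {P : Fin d → Fin d → Fin d → Fin d → K} {μ : K} {c : Fin d → Fin d → K}
    (hP : PreservesPairs P) (h₁ : IsExterior.{u, u} P μ c)
    (h₂ : IsExterior.{u, max u v} P μ c) {X Y : Matrix (Fin d) (Fin d) L}
    (hX : IsQuantumMatrix P X) (hXY : X * Y = 1) : qdet c X * qdetRev c Y = 1 := by
  rw [qdetRev_eq_sum, Finset.mul_sum]
  simp only [mul_smul_comm, ← smul_mul_assoc, ← hX.sum_word hP h₁ h₂, Finset.sum_mul]
  rw [Finset.sum_comm]
  simp only [smul_mul_assoc, ← Finset.smul_sum, sum_prod_mul_reverse_prod hXY]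
  rw [Finset.sum_eq_single fun i => i]
  · simp [extCoef_id]
  · intro f _ hf
    rw [if_neg hf, smul_zero]
  · simp

/-- Apply `IsQuantumMatrix.qdet_mul_qdetRev` to the transposed matrices over the opposite ring; the
order of the two factors is reversed on the way back. -/
theorem IsQuantumMatrix.qdet_transpose_mul_qdetRev.{u, v} {K : Type u} [Field K] {d : ℕ}
    {L : Type v} [Ring L] [Algebra K L] {P : Fin d → Fin d → Fin d → Fin d → K} {μ : K}
    {c : Fin d → Fin d → K} (hP : PreservesPairs P) (h₁ : IsExterior.{u, u} (dualTensor P) μ c)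
    (h₂ : IsExterior.{u, max u v} (dualTensor P) μ c) {X Y : Matrix (Fin d) (Fin d) L}
    (hX : IsQuantumMatrix P X) (hYX : Y * X = 1) :
    qdet c Y.transpose * qdetRev c X.transpose = 1 := by
  have h : X.transpose.map MulOpposite.op * Y.transpose.map MulOpposite.op = 1 := by
    ext i j
    have := congrFun (congrFun hYX j) i
    rw [Matrix.mul_apply, Matrix.one_apply] at this
    rw [Matrix.mul_apply, Matrix.one_apply]
    simp only [Matrix.map_apply, Matrix.transpose_apply, ← MulOpposite.op_mul, ← Finset.op_sum,
      this]
    simp only [eq_comm (a := j)]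
    split_ifs <;> rfl
  have := hX.transpose_op.qdet_mul_qdetRev hP.dualTensor h₁ h₂ h
  rw [qdetRev_map_op, ← op_qdetRev, ← MulOpposite.op_mul] at this
  exact MulOpposite.op_injective this

/-- The word `f j l` consists of all indices except `j`, followed by `l`. Expanding its determinant
along the last letter gives a matrix of cofactors: for `l ≠ j` a letter is repeated and the result
is zero, and for `l = j` it is a nonzero scalar times the determinant. -/
theorem IsQuantumMatrix.exists_left_inverse.{u, v} {K : Type u} [Field K] {d : ℕ} {L : Type v}
    [Ring L] [Algebra K L] {P : Fin d → Fin d → Fin d → Fin d → K} {μ : K} {c : Fin d → Fin d → K}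
    (hP : PreservesPairs P) (h₁ : IsExterior.{u, u} P μ c)
    (h₂ : IsExterior.{u, max u v} P μ c) {X : Matrix (Fin d) (Fin d) L}
    (hX : IsQuantumMatrix P X) (hdet : IsUnit (qdet c X)) :
    ∃ Y : Matrix (Fin d) (Fin d) L, Y * X = 1 := by
  obtain ⟨e, he⟩ := hdet
  cases d with
  | zero => exact ⟨0, Subsingleton.elim _ _⟩
  | succ k =>
    let f : Fin (k + 1) → Fin (k + 1) → Fin (k + 1) → Fin (k + 1) :=
      fun j l => Fin.snoc (α := fun _ => Fin (k + 1)) (fun u : Fin k => j.succAbove u) l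
    have hf0 : ∀ j, extCoef c (f j j) ≠ 0 := by
      intro j
      rw [extCoef, if_pos]
      · exact wordCoef_ne_zero h₁.ne_zero _
      · refine (Fin.snoc_injective_iff (α := Fin (k + 1))).2 ⟨Fin.succAbove_right_injective, ?_⟩
        rintro ⟨u, hu⟩
        exact Fin.succAbove_ne j u hu
    have hf1 : ∀ j l, j ≠ l → extCoef c (f j l) = 0 := by
      intro j l hjl
      obtain ⟨u, hu⟩ := Fin.exists_succAbove_eq (Ne.symm hjl)
      refine extCoef_of_not_injective fun h => ?_
      have := @h u.castSucc (Fin.last k) (by simp [f, hu])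
      exact (Fin.castSucc_lt_last u).ne this
    let M : Matrix (Fin (k + 1)) (Fin (k + 1)) L := Matrix.of fun j i =>
      ∑ g : Fin k → Fin (k + 1), extCoef c (Fin.snoc (α := fun _ => Fin (k + 1)) g i) •
        (List.ofFn fun u => X (g u) (j.succAbove u)).prod
    have hM : ∀ j l, ∑ i, M j i * X i l = extCoef c (f j l) • (e : L) := by
      intro j l
      rw [he, ← hX.sum_word hP h₁ h₂, ← (Fin.snocEquiv fun _ => Fin (k + 1)).sum_comp,
        Fintype.sum_prod_type]
      refine Finset.sum_congr rfl fun i _ => ?_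
      rw [show M j i = _ from Matrix.of_apply _ _ _, Finset.sum_mul]
      refine Finset.sum_congr rfl fun g _ => ?_
      rw [List.ofFn_succ', List.concat_eq_append, List.prod_append, List.prod_singleton,
        smul_mul_assoc]
      simp [Fin.snocEquiv, f]
    refine ⟨Matrix.of fun j i => (extCoef c (f j j))⁻¹ • (((e⁻¹ : Lˣ) : L) * M j i), ?_⟩
    ext j l
    rw [Matrix.mul_apply, Matrix.one_apply]
    simp only [Matrix.of_apply, smul_mul_assoc, mul_assoc]
    rw [← Finset.smul_sum, ← Finset.mul_sum, hM]
    split_ifs with hjl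
    · subst hjl
      rw [mul_smul_comm, smul_smul, inv_mul_cancel₀ (hf0 j), one_smul, Units.inv_mul]
    · rw [hf1 j l hjl, zero_smul, mul_zero, smul_zero]

/-- Column expansion gives only a left inverse; a right inverse comes from the transpose over the
opposite ring, whence the second determinant. -/
theorem IsQuantumMatrix.isUnit_of_isUnit_qdet.{u, v} {K : Type u} [Field K] {d : ℕ} {L : Type v}
    [Ring L] [Algebra K L] {P : Fin d → Fin d → Fin d → Fin d → K} {μ μ' : K}
    {c c' : Fin d → Fin d → K} (hP : PreservesPairs P) (h₁ : IsExterior.{u, u} P μ c)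
    (h₂ : IsExterior.{u, max u v} P μ c) (h₁' : IsExterior.{u, u} (dualTensor P) μ' c')
    (h₂' : IsExterior.{u, max u v} (dualTensor P) μ' c')
    {X : Matrix (Fin d) (Fin d) L} (hX : IsQuantumMatrix P X) (hdet : IsUnit (qdet c X))
    (hdet' : IsUnit (qdetRev c' X.transpose)) : IsUnit X := by
  obtain ⟨Y, hY⟩ := hX.exists_left_inverse hP h₁ h₂ hdet
  obtain ⟨Y', hY'⟩ := hX.transpose_op.exists_left_inverse hP.dualTensor h₁' h₂'
    (by rw [← op_qdetRev]; exact hdet'.op)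
  have h : X * (Y'.map MulOpposite.unop).transpose = 1 := by
    ext i j
    have := congrArg MulOpposite.unop (congrFun (congrFun hY' j) i)
    rw [Matrix.mul_apply, Matrix.one_apply] at this
    rw [Matrix.mul_apply, Matrix.one_apply]
    simp only [Finset.unop_sum, MulOpposite.unop_mul, Matrix.map_apply, Matrix.transpose_apply,
      MulOpposite.unop_op] at this ⊢
    rw [this]
    simp only [eq_comm (a := j)]
    split_ifs <;> rfl
  exact ⟨⟨X, Y, by rw [left_inv_eq_right_inv hY h]; exact h, hY⟩, rfl⟩

end Cramer

/-! ### Comparison of the row and column determinants -/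

section QFactorial

variable {K : Type*} [Field K]

/-- An element with `j` larger ones contributes `q ^ j`, and ordering by `ρ` makes every `j` occur
once. -/
theorem sum_prod_ite_lt {X : Type*} [DecidableEq X] (q : K) (ρ : X → ℤ) (s : Finset X)
    (hρ : Set.InjOn ρ s) :
    ∑ a ∈ s, ∏ b ∈ s, (if ρ a < ρ b then q else 1) = ∑ j ∈ Finset.range s.card, q ^ j := by
  induction s using Finset.induction_on_max_value ρ with
  | empty => simp
  | insert a s ha hmax ih =>
    have hlt : ∀ b ∈ s, ρ b < ρ a := fun b hb => lt_of_le_of_ne (hmax b hb) fun h =>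
      ha (hρ (by simp [hb]) (by simp) h ▸ hb)
    rw [Finset.sum_insert ha, Finset.card_insert_of_notMem ha, geom_sum_succ, add_comm]
    congr 1
    · rw [← ih (hρ.mono (by simp)), Finset.mul_sum]
      refine Finset.sum_congr rfl fun b hb => ?_
      rw [Finset.prod_insert ha, if_pos (hlt b hb)]
    · refine Finset.prod_eq_one fun b hb => if_neg ?_
      rw [Finset.mem_insert] at hb
      rcases hb with rfl | hb
      · exact lt_irrefl _
      · exact (hlt b hb).not_gt

/-- The sum over all orderings of a product of weights, where the weights of a pair of elements in
the two possible orders differ by the factor `q`. -/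
theorem sum_perm_prod {X : Type*} {q : K} {ρ : X → ℤ} {h : X → X → K}
    (hh : ∀ a b, ρ a < ρ b → h a b = q * h b a) {k : ℕ} (g : Fin k → X)
    (hg : Function.Injective fun u => ρ (g u)) :
    ∑ σ : Equiv.Perm (Fin k), ∏ u, ∏ v, (if u < v then h (g (σ u)) (g (σ v)) else 1) =
      (∏ i ∈ Finset.range k, ∑ j ∈ Finset.range (i + 1), q ^ j) *
        ∏ u, ∏ v, if ρ (g u) < ρ (g v) then h (g v) (g u) else 1 := by
  induction k with
  | zero => simp
  | succ k ih =>
    rw [← Equiv.Perm.decomposeFin.symm.sum_comp, Fintype.sum_prod_type]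
    set gp : Fin (k + 1) → Fin k → X := fun p v => g (Equiv.swap 0 p v.succ) with hgp
    have hgp_inj : ∀ p, Function.Injective fun u => ρ (gp p u) := fun p u v huv =>
      Fin.succ_injective _ ((Equiv.swap 0 p).injective (hg huv))
    have hne : ∀ p v, ρ (g p) ≠ ρ (gp p v) := by
      intro p v hv
      have h1 : p = Equiv.swap 0 p v.succ := hg hv
      have h2 : Equiv.swap 0 p 0 = Equiv.swap 0 p v.succ := by rwa [Equiv.swap_apply_left]
      exact (Fin.succ_ne_zero v) ((Equiv.swap 0 p).injective h2).symm
    have e1 : ∀ p, ∑ e : Equiv.Perm (Fin k), ∏ u, ∏ v,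
        (if u < v then h (g (Equiv.Perm.decomposeFin.symm (p, e) u))
          (g (Equiv.Perm.decomposeFin.symm (p, e) v)) else 1) =
        (∏ v, h (g p) (gp p v)) * ((∏ i ∈ Finset.range k, ∑ j ∈ Finset.range (i + 1), q ^ j) *
        ∏ u, ∏ v, if ρ (gp p u) < ρ (gp p v) then h (gp p v) (gp p u) else 1) := by
      intro p
      rw [← ih _ (hgp_inj p), Finset.mul_sum]
      refine Finset.sum_congr rfl fun e _ => ?_
      rw [← Equiv.prod_comp e fun v => h (g p) (gp p v)]
      simp [Fin.prod_univ_succ, hgp, Fin.succ_lt_succ_iff]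
    have e2 : ∀ p, (∏ u, ∏ v, if ρ (g u) < ρ (g v) then h (g v) (g u) else 1) =
        (∏ v, if ρ (g p) < ρ (gp p v) then h (gp p v) (g p) else 1) *
        ((∏ u, if ρ (gp p u) < ρ (g p) then h (g p) (gp p u) else 1) *
        ∏ u, ∏ v, if ρ (gp p u) < ρ (gp p v) then h (gp p v) (gp p u) else 1) := by
      intro p
      rw [← Equiv.prod_comp (Equiv.swap 0 p)]
      simp_rw [← Equiv.prod_comp (Equiv.swap 0 p) (fun v => if ρ (g (Equiv.swap 0 p _)) < ρ (g v)
        then h (g v) (g (Equiv.swap 0 p _)) else 1)]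
      simp only [Fin.prod_univ_succ, Equiv.swap_apply_left, lt_irrefl, if_false, one_mul,
        Finset.prod_mul_distrib, hgp]
      exact mul_left_comm _ _ _
    -- With `g p` as first letter, each larger element costs one factor `q` relative to the
    -- reference ordering. Summing over `p` gives the next factor of the `q`-factorial.
    have e3 : ∀ p, ∏ v, h (g p) (gp p v) = (∏ u, if ρ (g p) < ρ (g u) then q else 1) *
        ((∏ v, if ρ (g p) < ρ (gp p v) then h (gp p v) (g p) else 1) *
        ∏ u, if ρ (gp p u) < ρ (g p) then h (g p) (gp p u) else 1) := by
      intro p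
      rw [← Equiv.prod_comp (Equiv.swap 0 p)
        (fun u => if ρ (g p) < ρ (g u) then q else 1), Fin.prod_univ_succ, Equiv.swap_apply_left,
        if_neg (lt_irrefl _), one_mul, ← Finset.prod_mul_distrib, ← Finset.prod_mul_distrib]
      refine Finset.prod_congr rfl fun v _ => ?_
      change _ = (if ρ (g p) < ρ (gp p v) then q else 1) * _
      rcases lt_or_gt_of_ne (hne p v) with h1 | h1
      · simp [h1, h1.not_gt, hh _ _ h1]
      · simp [h1, h1.not_gt]
    have e4 : ∀ p, (∏ v, h (g p) (gp p v)) *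
        ((∏ i ∈ Finset.range k, ∑ j ∈ Finset.range (i + 1), q ^ j) *
        ∏ u, ∏ v, if ρ (gp p u) < ρ (gp p v) then h (gp p v) (gp p u) else 1) =
        (∏ u, if ρ (g p) < ρ (g u) then q else 1) *
        ((∏ i ∈ Finset.range k, ∑ j ∈ Finset.range (i + 1), q ^ j) *
        ∏ u, ∏ v, if ρ (g u) < ρ (g v) then h (g v) (g u) else 1) := by
      intro p
      rw [e2 p, e3 p]
      ring
    simp only [e1, e4]
    rw [← Finset.sum_mul, sum_prod_ite_lt q (fun u => ρ (g u)) Finset.univ hg.injOn,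
      Finset.card_univ, Fintype.card_fin, Finset.prod_range_succ]
    ring

theorem wordCoef_rev {d k : ℕ} (c : Fin d → Fin d → K) (f : Fin k → Fin d) :
    wordCoef c (fun u => f u.rev) = ∏ u, ∏ v, if u < v ∧ f u < f v then c (f v) (f u) else 1 := by
  set F : Fin k → Fin k → K := fun u v =>
    if u < v ∧ f v.rev < f u.rev then c (f u.rev) (f v.rev) else 1 with hF
  calc wordCoef c (fun u => f u.rev) = ∏ u, ∏ v, F u v := rfl
    _ = ∏ u : Fin k, ∏ v : Fin k, F u v.rev :=
        Finset.prod_congr rfl fun u _ => (Equiv.prod_comp Fin.revPerm (F u)).symm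
    _ = ∏ v : Fin k, ∏ u : Fin k, F u v.rev := Finset.prod_comm
    _ = ∏ v : Fin k, ∏ u : Fin k, F u.rev v.rev :=
        Finset.prod_congr rfl fun v _ => (Equiv.prod_comp Fin.revPerm fun u => F u v.rev).symm
    _ = _ := by simp only [hF, Fin.rev_lt_rev, Fin.rev_rev]

/-- For each pair of positions the first coefficient records an inversion and the reversed second
one a non-inversion, so every ordered pair has one weight `h`. Exchanging a pair changes the weight
by `q`, and the sum is a `q`-factorial times a nonzero product. For `q = 1` the factorial is nonzero
by characteristic zero, otherwise because `q` is not a root of unity. -/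
theorem sum_extCoef_mul_ne_zero [CharZero K] {d : ℕ} {q : K}
    (hq : ∀ k : ℕ, 0 < k → q ^ k = 1 → q = 1) {c c' : Fin d → Fin d → K}
    (hc : ∀ i j, c i j * c j i = 1) (hc' : ∀ i j, c' i j * c' j i = 1) {rk : Fin d → ℤ}
    (hrk : Function.Injective rk) (hcc' : ∀ i j, rk i < rk j → c i j = q * c' i j) :
    (∑ f : Fin d → Fin d, extCoef c f * extCoef c' fun u => f u.rev) ≠ 0 := by
  set h : Fin d → Fin d → K := fun a b => if b < a then c a b else c' b a with hh
  have hc0 : ∀ i j, c i j ≠ 0 := fun i j =>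
    left_ne_zero_of_mul (by rw [hc i j]; exact one_ne_zero)
  have hc0' : ∀ i j, c' i j ≠ 0 := fun i j =>
    left_ne_zero_of_mul (by rw [hc' i j]; exact one_ne_zero)
  have hswap : ∀ a b, rk a < rk b → h a b = q * h b a := by
    intro a b hab
    have hne : a ≠ b := by rintro rfl; exact lt_irrefl _ hab
    rcases lt_or_gt_of_ne hne with hlt | hlt
    · simp only [hh, if_neg hlt.not_gt, if_pos hlt]
      have h1 := hcc' a b hab
      have h2 := hc a b
      have h3 := hc' a b
      apply mul_left_cancel₀ (hc0' a b)
      rw [h3, ← h2, h1]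
      ring
    · simp only [hh, if_pos hlt, if_neg hlt.not_gt]
      exact hcc' a b hab
  have key := sum_perm_prod hswap (fun u => u) hrk
  have e : (∑ f : Fin d → Fin d, extCoef c f * extCoef c' fun u => f u.rev) =
      ∑ σ : Equiv.Perm (Fin d), ∏ u, ∏ v, (if u < v then h (σ u) (σ v) else 1) := by
    simp only [← smul_eq_mul]
    rw [sum_extCoef]
    refine Finset.sum_congr rfl fun σ _ => ?_
    have hinj : Function.Injective fun u : Fin d => σ u.rev :=
      σ.injective.comp Fin.rev_injective
    rw [extCoef, if_pos hinj, wordCoef_rev, smul_eq_mul, ← Finset.prod_mul_distrib]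
    refine Finset.prod_congr rfl fun u _ => ?_
    rw [← Finset.prod_mul_distrib]
    refine Finset.prod_congr rfl fun v _ => ?_
    by_cases huv : u < v
    · rcases lt_or_gt_of_ne (σ.injective.ne huv.ne) with h1 | h1
      · simp [hh, huv, h1, h1.not_gt]
      · simp [hh, huv, h1, h1.not_gt]
    · simp [huv]
  rw [e, key]
  refine mul_ne_zero (Finset.prod_ne_zero_iff.2 fun i _ => ?_)
    (Finset.prod_ne_zero_iff.2 fun u _ => Finset.prod_ne_zero_iff.2 fun v _ => ?_)
  · by_cases hq1 : q = 1
    · simp only [hq1, one_pow, Finset.sum_const, Finset.card_range, nsmul_eq_mul, mul_one]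
      exact Nat.cast_ne_zero.2 (Nat.succ_ne_zero i)
    · rw [geom_sum_eq hq1]
      exact div_ne_zero (sub_ne_zero.2 fun h1 => hq1 (hq _ (Nat.succ_pos i) h1))
        (sub_ne_zero.2 hq1)
  · split_ifs
    · simp only [hh]
      split_ifs
      · exact hc0 _ _
      · exact hc0' _ _
    · exact one_ne_zero

end QFactorial

/-! ### Row and column determinants of the even and odd types -/

section ConstantParity

open IsParameterSystem

variable {K : Type*} [Field K] [CharZero K] {d : ℕ} {q : K} {p r : Fin d → Fin d → K}

theorem isExterior_even.{u, w} {K : Type u} [Field K] [CharZero K] {d : ℕ} {q : K}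
    {p r : Fin d → Fin d → K} (h : IsParameterSystem q p r) :
    IsExterior.{u, w} (rMatrix (fun _ => 0) q p r) (-1) (cMinus (fun _ => 0) p) where
  inv := h.cMinus_inv _
  iff_isQAffine y := by
    simpa using h.quadraticRel_neg_one_iff (par := fun _ => 0) (fun _ => Or.inl rfl) y

theorem isExterior_even_dual.{u, w} {K : Type u} [Field K] [CharZero K] {d : ℕ} {q : K}
    {p r : Fin d → Fin d → K} (h : IsParameterSystem q p r) :
    IsExterior.{u, w} (dualTensor (rMatrix (fun _ => 0) q p r)) (-1)
      (cMinus (fun _ => 0) fun i j => (r i j)⁻¹) where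
  inv := h.swap.cMinus_inv _
  iff_isQAffine y := by
    simpa using h.quadraticRel_dual_neg_one_iff (par := fun _ => 0) (fun _ => Or.inl rfl) y

theorem isExterior_odd.{u, w} {K : Type u} [Field K] [CharZero K] {d : ℕ} {q : K}
    {p r : Fin d → Fin d → K} (h : IsParameterSystem q p r) :
    IsExterior.{u, w} (rMatrix (fun _ => 1) q p r) q (cPlus (fun _ => 1) fun i j => (r i j)⁻¹) where
  inv := h.swap.cPlus_inv _
  iff_isQAffine y := by
    simpa using h.quadraticRel_q_iff (par := fun _ => 1) (fun _ => Or.inr rfl) y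

theorem isExterior_odd_dual.{u, w} {K : Type u} [Field K] [CharZero K] {d : ℕ} {q : K}
    {p r : Fin d → Fin d → K} (h : IsParameterSystem q p r) :
    IsExterior.{u, w} (dualTensor (rMatrix (fun _ => 1) q p r)) q (cPlus (fun _ => 1) p) where
  inv := h.cPlus_inv _
  iff_isQAffine y := by
    simpa using h.quadraticRel_dual_q_iff (par := fun _ => 1) (fun _ => Or.inr rfl) y

variable {L : Type*} [Ring L] [Algebra K L] {X : Matrix (Fin d) (Fin d) L}

/-- The two scalar systems differ by `p_{ij} r_{ij}`, which is `q` when `i` has the smaller rank; so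
the common factor in `IsQuantumMatrix.smul_qdet` can be cancelled. -/
theorem qdet_eq_qdetRev_even (h : IsParameterSystem q p r)
    (hX : IsQuantumMatrix (rMatrix (fun _ => 0) q p r) X) :
    qdet (cMinus (fun _ => 0) p) X =
      qdetRev (cMinus (fun _ => 0) fun i j => (r i j)⁻¹) X.transpose := by
  obtain ⟨rk, hrk, hpr⟩ := h.exists_rank
  refine smul_right_injective L (sum_extCoef_mul_ne_zero h.q_root (h.cMinus_inv _)
    (h.swap.cMinus_inv _) hrk fun i j hij => ?_) (hX.smul_qdet (preservesPairs_rMatrix _ q p r)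
    (isExterior_even h) (isExterior_even h) (isExterior_even_dual h) (isExterior_even_dual h))
  have h1 := hpr i j (by rintro rfl; exact lt_irrefl _ hij)
  rw [if_pos hij] at h1
  have h2 := h.r_ne_zero i j
  simp only [cMinus]
  field_simp
  linear_combination -h1

/-- Here the ratio is `(p_{ij} r_{ij})⁻¹`, so the rank has to be reversed. -/
theorem qdet_eq_qdetRev_odd (h : IsParameterSystem q p r)
    (hX : IsQuantumMatrix (rMatrix (fun _ => 1) q p r) X) :
    qdet (cPlus (fun _ => 1) fun i j => (r i j)⁻¹) X =
      qdetRev (cPlus (fun _ => 1) p) X.transpose := by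
  obtain ⟨rk, hrk, hpr⟩ := h.exists_rank
  refine smul_right_injective L (sum_extCoef_mul_ne_zero (rk := fun i => -rk i) h.q_root
    (h.swap.cPlus_inv _) (h.cPlus_inv _) (fun i j hij => hrk (neg_injective hij))
    fun i j hij => ?_) (hX.smul_qdet (preservesPairs_rMatrix _ q p r)
    (isExterior_odd h) (isExterior_odd h) (isExterior_odd_dual h) (isExterior_odd_dual h))
  rw [neg_lt_neg_iff] at hij
  have h1 := hpr i j (by rintro rfl; exact lt_irrefl _ hij)
  rw [if_neg hij.not_gt] at h1
  have h2 := h.r_ne_zero i j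
  have h3 := h.q_ne_zero
  simp only [cPlus]
  field_simp
  field_simp at h1
  linear_combination -h1

end ConstantParity

/-! ### Diagonal blocks of a quantum super matrix and of its inverse -/

section Blocks

variable {K : Type*} [Field K] {d e : ℕ} {L : Type*} [Ring L] [Algebra K L]

/-- Starting from indices in the range of `ι`, a tensor preserving pairs never leaves it, so all
other terms of the sums vanish. -/
theorem Intertwines.restrict {P : Fin d → Fin d → Fin d → Fin d → K} (hP : PreservesPairs P)
    {Q : Fin d → Fin d → Fin d → Fin d → L} (h : Intertwines P Q) (ι : Fin e ↪o Fin d) :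
    Intertwines (fun k l i j => P (ι k) (ι l) (ι i) (ι j))
      fun k l i j => Q (ι k) (ι l) (ι i) (ι j) := by
  have key : ∀ f : Fin d → Fin d → L,
      (∀ a b, (a ∉ Set.range ι ∨ b ∉ Set.range ι) → f a b = 0) →
      ∑ a, ∑ b, f a b = ∑ a, ∑ b, f (ι a) (ι b) := by
    intro f hf
    rw [← Fintype.sum_of_injective ι ι.injective _ (fun a => ∑ b, f a b)
      (fun a ha => Finset.sum_eq_zero fun b _ => hf a b (Or.inl ha)) fun a => rfl]
    refine Finset.sum_congr rfl fun a _ => ?_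
    exact (Fintype.sum_of_injective ι ι.injective _ _ (fun b hb => hf _ b (Or.inr hb))
      fun b => rfl).symm
  intro k l i j
  have := h (ι k) (ι l) (ι i) (ι j)
  rw [key _ fun a b hab => ?_, key _ fun a b hab => ?_] at this
  · exact this
  · rw [show P a b (ι i) (ι j) = 0 from ?_, zero_smul]
    by_contra hne
    rcases hP _ _ _ _ hne with ⟨rfl, rfl⟩ | ⟨rfl, rfl⟩ <;> simp at hab
  · rw [show P (ι k) (ι l) a b = 0 from ?_, zero_smul]
    by_contra hne
    rcases hP _ _ _ _ hne with ⟨rfl, rfl⟩ | ⟨rfl, rfl⟩ <;> simp at hab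

variable {par : Fin d → ℕ} {q : K} {p r : Fin d → Fin d → K} {ι : Fin e ↪o Fin d} {ε : ℕ}

theorem rMatrix_comp (hι : ∀ i, par (ι i) = ε) :
    (fun k l i j => rMatrix par q p r (ι k) (ι l) (ι i) (ι j)) =
      rMatrix (fun _ => ε) q (fun i j => p (ι i) (ι j)) fun i j => r (ι i) (ι j) := by
  funext k l i j
  simp only [rMatrix, hι, EmbeddingLike.apply_eq_iff_eq]

/-- A diagonal block of constant parity of a quantum super matrix is a quantum matrix. -/
theorem IsQuantumSuperMatrix.submatrix (hι : ∀ i, par (ι i) = ε) {Z : Matrix (Fin d) (Fin d) L}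
    (hZ : IsQuantumSuperMatrix par (rMatrix par q p r) Z) :
    IsQuantumMatrix (rMatrix (fun _ => ε) q (fun i j => p (ι i) (ι j)) fun i j => r (ι i) (ι j))
      (Z.submatrix ι ι) := by
  have h := (isQuantumSuperMatrix_iff.1 hZ).restrict (preservesPairs_rMatrix _ _ _ _) ι
  rw [rMatrix_comp hι] at h
  refine isQuantumSuperMatrix_iff.2 ?_
  convert h using 5
  simp [superSquare, hι, ← two_mul, mul_left_comm ε 2 ε, pow_mul]

/-- The inverse of a diagonal block of constant parity of the inverse of a quantum super matrix is
a quantum matrix. -/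
theorem IsQuantumSuperMatrix.isQuantumMatrix_of_mul_eq_one (hι : ∀ i, par (ι i) = ε)
    {Z T : Matrix (Fin d) (Fin d) L} (hZ : IsQuantumSuperMatrix par (rMatrix par q p r) Z)
    (hZT : Z * T = 1) (hTZ : T * Z = 1) {X : Matrix (Fin e) (Fin e) L}
    (h₁ : X * T.submatrix ι ι = 1) (h₂ : T.submatrix ι ι * X = 1) :
    IsQuantumMatrix (rMatrix (fun _ => ε) q (fun i j => p (ι i) (ι j)) fun i j => r (ι i) (ι j))
      X := by
  have h := ((isQuantumSuperMatrix_iff.1 hZ).superSquareInv hZT hTZ).restrict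
    (preservesPairs_rMatrix _ _ _ _) ι
  rw [rMatrix_comp hι] at h
  refine isQuantumSuperMatrix_iff.2 (Intertwines.inverse (Q := QSuper.superSquareInv K (fun _ => 0)
    (T.submatrix ι ι)) ?_ (superSquareInv_mul _ h₂) (superSquare_mul_inv _ h₁))
  convert h using 5
  simp [QSuper.superSquareInv, hι, ← two_mul, mul_left_comm ε 2 ε, pow_mul]

theorem qdet_map {L' : Type*} [Ring L'] [Algebra K L'] (φ : L →ₐ[K] L') (c : Fin d → Fin d → K)
    (Z : Matrix (Fin d) (Fin d) L) : φ (qdet c Z) = qdet c (Z.map φ) := by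
  simp only [qdet, map_sum, map_smul, map_list_prod, List.map_ofFn, Function.comp_def,
    Matrix.map_apply]

theorem evalAt_hz {R : Fin d → Fin d → Fin d → Fin d → K} {Z : Matrix (Fin d) (Fin d) L}
    (hZ : IsQuantumSuperMatrix par R Z) (hU : IsUnit Z) (j i : Fin d) :
    evalAt hZ hU (hz par R j i) = Z j i := by
  refine (RingQuot.liftAlgHom_mkAlgHom_apply K _ _ _).trans ?_
  simp [freeEval, freeZ]

theorem evalAt_ht {R : Fin d → Fin d → Fin d → Fin d → K} {Z : Matrix (Fin d) (Fin d) L}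
    (hZ : IsQuantumSuperMatrix par R Z) (hU : IsUnit Z) (j i : Fin d) :
    evalAt hZ hU (ht par R j i) = (-1 : K) ^ (par i * (par j + 1)) •
      ((hU.unit⁻¹ : (Matrix (Fin d) (Fin d) L)ˣ) : Matrix (Fin d) (Fin d) L) j i := by
  refine (RingQuot.liftAlgHom_mkAlgHom_apply K _ _ _).trans ?_
  simp [freeEval, freeT]

end Blocks

/-! ### Schur complements as inverses of blocks of the inverse -/

section Schur

variable {L : Type*} [Ring L] {α β : Type*} [Fintype α] [Fintype β] [DecidableEq α] [DecidableEq β]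
  {A A' : Matrix α α L} {B B' : Matrix α β L} {C C' : Matrix β α L} {D : Matrix β β L}

/-- The second equation expresses `D⁻¹ C A'` as `-C'`; substituting it turns the product into the
left side of the first equation. -/
theorem schur_mul (hD : IsUnit D) (h₁ : A * A' + B * C' = 1) (h₂ : C * A' + D * C' = 0) :
    (A - B * Ring.inverse D * C) * A' = 1 := by
  have h : Ring.inverse D * (C * A') = -C' := by
    rw [eq_neg_of_add_eq_zero_left h₂, Matrix.mul_neg, ← Matrix.mul_assoc,
      Ring.inverse_mul_cancel _ hD, Matrix.one_mul]
  rw [Matrix.sub_mul, Matrix.mul_assoc, Matrix.mul_assoc, h, Matrix.mul_neg, sub_neg_eq_add, h₁]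

theorem mul_schur (hD : IsUnit D) (h₁ : A' * A + B' * C = 1) (h₂ : A' * B + B' * D = 0) :
    A' * (A - B * Ring.inverse D * C) = 1 := by
  have h : A' * B * Ring.inverse D = -B' := by
    rw [eq_neg_of_add_eq_zero_left h₂, Matrix.neg_mul, Matrix.mul_assoc,
      Ring.mul_inverse_cancel _ hD, Matrix.mul_one]
  rw [Matrix.mul_sub, ← Matrix.mul_assoc, ← Matrix.mul_assoc, h, Matrix.neg_mul, sub_neg_eq_add, h₁]

theorem submatrix_mul_add {m n : ℕ} {γ δ : Type*} (Z T : Matrix (Fin (m + n)) (Fin (m + n)) L)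
    (f : γ → Fin (m + n)) (g : δ → Fin (m + n)) :
    Z.submatrix f (Fin.castAdd n) * T.submatrix (Fin.castAdd n) g +
      Z.submatrix f (Fin.natAdd m) * T.submatrix (Fin.natAdd m) g = (Z * T).submatrix f g := by
  ext i j
  simp [Matrix.mul_apply, Fin.sum_univ_add]

end Schur

end QSuper

end

/-! ### The main theorem -/

theorem mainTheorem2 {K : Type*} [Field K] [CharZero K] (m n : ℕ) (q : K)
    (p r : Fin (m + n) → Fin (m + n) → K) (hpar : QSuper.IsParameterSystem q p r)
    (R : Fin (m + n) → Fin (m + n) → Fin (m + n) → Fin (m + n) → K)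
    (hR : R = QSuper.rMatrix (QSuper.parity m n) q p r)
    {L : Type*} [Ring L] [Algebra K L] (Z : Matrix (Fin (m + n)) (Fin (m + n)) L)
    (hZ : QSuper.IsQuantumSuperMatrix (QSuper.parity m n) R Z)
    (A : Matrix (Fin m) (Fin m) L) (B : Matrix (Fin m) (Fin n) L)
    (C : Matrix (Fin n) (Fin m) L) (D : Matrix (Fin n) (Fin n) L)
    (hA : A = QSuper.blockA Z) (hB : B = QSuper.blockB Z)
    (hC : C = QSuper.blockC Z) (hD : D = QSuper.blockD Z) :
    QSuper.IsQuantumMatrix (QSuper.rEven R) A ∧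
    QSuper.IsQuantumMatrix (QSuper.rOdd R) D ∧
    (∃! b : QSuper.HopfEnvelope (QSuper.parity m n) R,
      QSuper.IsBerezinian m n (QSuper.parity m n) q R b) ∧
    ∀ hU : IsUnit Z,
      IsUnit A ∧ IsUnit D ∧
      IsUnit (A - B * Ring.inverse D * C) ∧
      IsUnit (D - C * Ring.inverse A * B) ∧
      QSuper.IsQuantumMatrix (QSuper.rEven R) (A - B * Ring.inverse D * C) ∧
      QSuper.IsQuantumMatrix (QSuper.rOdd R) (D - C * Ring.inverse A * B) ∧
      IsUnit (QSuper.detOdd r D) ∧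
      IsUnit (QSuper.detOdd r (D - C * Ring.inverse A * B)) ∧
      ∀ b : QSuper.HopfEnvelope (QSuper.parity m n) R,
        QSuper.IsBerezinian m n (QSuper.parity m n) q R b →
        QSuper.evalAt hZ hU b =
          QSuper.detEven p A * Ring.inverse (QSuper.detOdd r (D - C * Ring.inverse A * B)) ∧
        QSuper.evalAt hZ hU b =
          Ring.inverse (QSuper.detOdd r D) * QSuper.detEven p (A - B * Ring.inverse D * C) := by
  subst hR
  let ι : Fin m ↪o Fin (m + n) := Fin.castAddOrderEmb n
  let κ : Fin n ↪o Fin (m + n) := Fin.natAddOrderEmb m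
  have hpar01 : ∀ i, QSuper.parity m n i = 0 ∨ QSuper.parity m n i = 1 := fun i => by
    unfold QSuper.parity; split_ifs <;> simp
  have hι0 : ∀ i, QSuper.parity m n (ι i) = 0 := fun i => by simp [QSuper.parity, ι]
  have hκ1 : ∀ i, QSuper.parity m n (κ i) = 1 := fun i => by simp [QSuper.parity, κ]
  have hrange : ∀ i, i ∈ Set.range ι ∨ i ∈ Set.range κ := fun i =>
    Fin.addCases (fun a => Or.inl ⟨a, rfl⟩) (fun a => Or.inr ⟨a, rfl⟩) i
  have hι : ∀ i, QSuper.parity m n i = 0 ↔ i ∈ Set.range ι := fun i => by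
    refine ⟨fun h => (hrange i).resolve_right ?_, ?_⟩
    · rintro ⟨a, rfl⟩
      simp [hκ1] at h
    · rintro ⟨a, rfl⟩
      exact hι0 a
  have hκ : ∀ i, ¬ QSuper.parity m n i = 0 ↔ i ∈ Set.range κ := fun i => by
    refine ⟨fun h => (hrange i).resolve_left fun h' => h ((hι i).2 h'), ?_⟩
    rintro ⟨a, rfl⟩
    simp [hκ1]
  have hE : QSuper.rEven (QSuper.rMatrix (QSuper.parity m n) q p r) = _ :=
    QSuper.rMatrix_comp (ι := ι) hι0
  have hO : QSuper.rOdd (QSuper.rMatrix (QSuper.parity m n) q p r) = _ :=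
    QSuper.rMatrix_comp (ι := κ) hκ1
  rw [hE, hO]
  have hpE := hpar.comp ι
  have hpO := hpar.comp κ
  have hAq := hZ.submatrix hι0
  have hDq := hZ.submatrix hκ1
  rw [show Z.submatrix ι ι = A from hA.symm] at hAq
  rw [show Z.submatrix κ κ = D from hD.symm] at hDq
  have hber := QSuper.isBerezinian_iff hpar hpar01 ι hι κ hκ
  refine ⟨hAq, hDq, ⟨_, (hber _).2 rfl, fun b hb => (hber b).1 hb⟩, fun hU => ?_⟩
  have hevenDet : ∀ X : Matrix (Fin m) (Fin m) L,
      QSuper.qdet (QSuper.IsParameterSystem.cMinus (fun _ => 0) fun i j => p (ι i) (ι j)) X =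
        QSuper.detEven p X := by
    intro X
    unfold QSuper.detEven
    congr 1
    funext i j
    simp [QSuper.IsParameterSystem.cMinus, ι]
  have hoddDet : ∀ X : Matrix (Fin n) (Fin n) L,
      QSuper.qdet (QSuper.IsParameterSystem.cPlus (fun _ => 1) fun i j => (r (κ i) (κ j))⁻¹) X =
        QSuper.detOdd r X := by
    intro X
    unfold QSuper.detOdd
    congr 1
    funext i j
    simp [QSuper.IsParameterSystem.cPlus, κ]
  have hcE : (fun i j => QSuper.IsParameterSystem.cMinus (QSuper.parity m n) p (ι i) (ι j)) =
      QSuper.IsParameterSystem.cMinus (fun _ => 0) fun i j => p (ι i) (ι j) := by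
    funext i j
    simp only [QSuper.IsParameterSystem.cMinus, hι0]
  have hcO : (fun i j => QSuper.IsParameterSystem.cPlus (QSuper.parity m n) p (κ i) (κ j)) =
      QSuper.IsParameterSystem.cPlus (fun _ => 1) fun i j => p (κ i) (κ j) := by
    funext i j
    simp only [QSuper.IsParameterSystem.cPlus, hκ1]
  set T : Matrix (Fin (m + n)) (Fin (m + n)) L :=
    ((hU.unit⁻¹ : (Matrix (Fin (m + n)) (Fin (m + n)) L)ˣ) :
      Matrix (Fin (m + n)) (Fin (m + n)) L) with hT
  have hZT : Z * T = 1 := IsUnit.mul_val_inv hU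
  have hTZ : T * Z = 1 := IsUnit.val_inv_mul hU
  obtain ⟨α, hα⟩ : ∃ α, α = QSuper.qdet
    (fun i j => QSuper.IsParameterSystem.cMinus (QSuper.parity m n) p (ι i) (ι j))
    (Z.submatrix ι ι) := ⟨_, rfl⟩
  obtain ⟨β, hβ⟩ : ∃ β, β = QSuper.qdet
    (fun i j => QSuper.IsParameterSystem.cPlus (QSuper.parity m n) p (κ i) (κ j))
    (T.submatrix κ κ).transpose := ⟨_, rfl⟩
  obtain ⟨γ, hγ⟩ : ∃ γ, γ = QSuper.qdetRev
    (fun i j => QSuper.IsParameterSystem.cPlus (QSuper.parity m n) p (κ i) (κ j))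
    (Z.submatrix κ κ).transpose := ⟨_, rfl⟩
  obtain ⟨τ, hτ⟩ : ∃ τ, τ = QSuper.qdetRev
    (fun i j => QSuper.IsParameterSystem.cMinus (QSuper.parity m n) p (ι i) (ι j))
    (T.submatrix ι ι) := ⟨_, rfl⟩
  obtain ⟨h₁, h₂, h₃, h₄⟩ := QSuper.qdet_relations hpar hpar01 ι hι κ hκ hZ hZT hTZ hα hβ hγ hτ
  -- In a noncommutative ring the factors of a unit need not be units; here they are, because they
  -- commute.
  obtain ⟨hαU, hβU⟩ := h₃.isUnit_mul_iff.1 (⟨⟨α * β, γ * τ, h₁, h₂⟩, rfl⟩ : IsUnit (α * β))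
  obtain ⟨hγU, hτU⟩ := h₄.isUnit_mul_iff.1 (⟨⟨γ * τ, α * β, h₂, h₁⟩, rfl⟩ : IsUnit (γ * τ))
  have hb : QSuper.evalAt hZ hU
      (QSuper.berezinian (QSuper.parity m n) (QSuper.rMatrix (QSuper.parity m n) q p r) p ι κ) = α * β := by
    rw [QSuper.berezinian, map_mul, QSuper.qdet_map, QSuper.qdet_map, hα, hβ]
    congr 2
    · ext j i
      exact QSuper.evalAt_hz hZ hU _ _
    · ext j i
      refine (QSuper.evalAt_ht hZ hU _ _).trans ?_
      simp [hκ1, hT]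
  rw [hcE] at hα hτ
  rw [hcO] at hβ hγ
  rw [hevenDet, show Z.submatrix ι ι = A from hA.symm] at hα
  -- The row determinant `γ` is thereby the determinant of `D`, so the unit property of `γ` gives
  -- the invertibility of `D`.
  rw [show Z.submatrix κ κ = D from hD.symm, ← QSuper.qdet_eq_qdetRev_odd hpO hDq, hoddDet] at hγ
  have hAU : IsUnit A := hAq.isUnit_of_isUnit_qdet (QSuper.preservesPairs_rMatrix _ _ _ _)
    (QSuper.isExterior_even hpE) (QSuper.isExterior_even hpE) (QSuper.isExterior_even_dual hpE)
    (QSuper.isExterior_even_dual hpE) (by rwa [hevenDet, ← hα])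
    (by rwa [← QSuper.qdet_eq_qdetRev_even hpE hAq, hevenDet, ← hα])
  have hDU : IsUnit D := hDq.isUnit_of_isUnit_qdet (QSuper.preservesPairs_rMatrix _ _ _ _)
    (QSuper.isExterior_odd hpO) (QSuper.isExterior_odd hpO) (QSuper.isExterior_odd_dual hpO)
    (QSuper.isExterior_odd_dual hpO) (by rwa [hoddDet, ← hγ])
    (by rwa [← QSuper.qdet_eq_qdetRev_odd hpO hDq, hoddDet, ← hγ])
  have s1 : ∀ {e : ℕ} (f : Fin e → Fin (m + n)), Function.Injective f →
      (1 : Matrix (Fin (m + n)) (Fin (m + n)) L).submatrix f f = 1 :=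
    fun f hf => Matrix.submatrix_one f hf
  have s0 : (1 : Matrix (Fin (m + n)) (Fin (m + n)) L).submatrix κ ι = 0 := by
    ext i j
    exact Matrix.one_apply_ne fun h => by simpa [hκ1, hι0] using congrArg (QSuper.parity m n) h
  have s0' : (1 : Matrix (Fin (m + n)) (Fin (m + n)) L).submatrix ι κ = 0 := by
    ext i j
    exact Matrix.one_apply_ne fun h => by simpa [hκ1, hι0] using congrArg (QSuper.parity m n) h
  have zt := fun {e e' : ℕ} (f : Fin e → Fin (m + n)) (g : Fin e' → Fin (m + n)) =>
    QSuper.submatrix_mul_add Z T f g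
  have tz := fun {e e' : ℕ} (f : Fin e → Fin (m + n)) (g : Fin e' → Fin (m + n)) =>
    QSuper.submatrix_mul_add T Z f g
  simp only [hZT, hTZ] at zt tz
  have hA1 : (A - B * Ring.inverse D * C) * T.submatrix ι ι = 1 := by
    rw [hA, hB, hC]
    exact QSuper.schur_mul hDU ((zt ι ι).trans (s1 _ ι.injective))
      (by rw [hD]; exact (zt κ ι).trans s0)
  have hA2 : T.submatrix ι ι * (A - B * Ring.inverse D * C) = 1 := by
    rw [hA, hB, hC]
    exact QSuper.mul_schur hDU ((tz ι ι).trans (s1 _ ι.injective))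
      (by rw [hD]; exact (tz ι κ).trans s0')
  have hD1 : (D - C * Ring.inverse A * B) * T.submatrix κ κ = 1 := by
    rw [hD, hB, hC]
    exact QSuper.schur_mul hAU ((add_comm _ _).trans ((zt κ κ).trans (s1 _ κ.injective)))
      (by rw [hA]; exact (add_comm _ _).trans ((zt ι κ).trans s0'))
  have hD2 : T.submatrix κ κ * (D - C * Ring.inverse A * B) = 1 := by
    rw [hD, hB, hC]
    exact QSuper.mul_schur hAU ((add_comm _ _).trans ((tz κ κ).trans (s1 _ κ.injective)))
      (by rw [hA]; exact (add_comm _ _).trans ((tz κ ι).trans s0))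
  have hA'q := hZ.isQuantumMatrix_of_mul_eq_one hι0 hZT hTZ hA1 hA2
  have hD'q := hZ.isQuantumMatrix_of_mul_eq_one hκ1 hZT hTZ hD1 hD2
  -- The Schur complements are inverse to the diagonal blocks of `T`, so their determinants are
  -- inverse to `τ` and, after passing to row determinants in the odd case, to `β`.
  have hdA := hA'q.qdet_mul_qdetRev (QSuper.preservesPairs_rMatrix _ _ _ _)
    (QSuper.isExterior_even hpE) (QSuper.isExterior_even hpE) hA1
  rw [hevenDet, ← hτ] at hdA
  have hdD := hD'q.qdet_transpose_mul_qdetRev (QSuper.preservesPairs_rMatrix _ _ _ _)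
    (QSuper.isExterior_odd_dual hpO) (QSuper.isExterior_odd_dual hpO) hD2
  rw [← QSuper.qdet_eq_qdetRev_odd hpO hD'q, hoddDet, ← hβ] at hdD
  obtain ⟨β, rfl⟩ := hβU
  obtain ⟨γ, rfl⟩ := hγU
  obtain ⟨τ, rfl⟩ := hτU
  have hdD' := Units.eq_inv_of_mul_eq_one_left hdD
  have hdA' := Units.eq_inv_of_mul_eq_one_right hdA
  refine ⟨hAU, hDU, ⟨⟨_, _, hA1, hA2⟩, rfl⟩, ⟨⟨_, _, hD1, hD2⟩, rfl⟩, hA'q, hD'q, ?_, ?_, ?_⟩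
  · exact hγ ▸ γ.isUnit
  · exact hdD' ▸ Units.isUnit _
  · intro b hb'
    -- The first formula is now `α β` itself. The second is `γ⁻¹ τ⁻¹ = (τ γ)⁻¹`, and it equals `α β`
    -- because `γ` and `τ` commute and `γ τ` is inverse to `α β`.
    rw [(hber b).1 hb', hb, hdD', hdA', ← hα, ← hγ, Ring.inverse_unit, Ring.inverse_unit, inv_inv,
      ← Units.val_mul, ← mul_inv_rev, ← (Units.ext h₄ : γ * τ = τ * γ)]
    exact ⟨rfl, Units.eq_inv_of_mul_eq_one_right h₁⟩
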